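/- Let $n\ge 2$. Let $\mathfrak g=\mathfrak p(n)$ be the complex periplectic Lie superalgebra of block matrices $\begin{pmatrix}A&B\\ C&-A^t\end{pmatrix}$ with $A,B,C$ complex $n\times n$ matrices, $B$ symmetric and $C$ antisymmetric, with $\mathbb Z$-grading $\mathfrak g=\mathfrak g_{-1}\oplus\mathfrak g_0\oplus\mathfrak g_1$, where $\mathfrak g_0\cong\mathfrak{gl}(n)$, $\mathfrak g_{1}$ consists of the $B$-blocks and $\mathfrak g_{-1}$ of the $C$-blocks. Let $\mathfrak h\subset\mathfrak g_0$ be the diagonal Cartan subalgebra with dual basis $\varepsilon_1,\dots,\varepsilon_n$. Let $\mathcal F_n$ be the category of finite-dimensional representations of the algebraic supergroup $P(n)$, that is, of finite-dimensional $\mathfrak p(n)$-modules (on super vector spaces) that are integrable over $GL(n)$, equivalently on which $\mathfrak h$ acts diagonalizably with weights in $\bigoplus_i\mathbb Z\varepsilon_i$. Put $x_i=e^{\varepsilon_i}$; for $M\in\mathcal F_n$ let $\operatorname{sch}M=\sum_\mu \operatorname{sdim}(M_\mu)\,e^\mu\in\mathbb Z[x_1^{\pm1},\dots,x_n^{\pm1}]$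 be its supercharacter, and let $J(P(n))$ be the ring of supercharacters, i.e. the additive group generated by all $\operatorname{sch} M$, $M\in\mathcal F_n$. Let $$J_n=\{f\in\mathbb Z[x_1^{\pm1},\dots,x_n^{\pm1}]^{S_n} : f|_{x_i=x_j^{-1}=t}\text{ is independent of } t\text{ for all } i\ne j\}.$$ For an integral weight $\lambda=\sum_i\lambda_i\varepsilon_i$ with $\lambda_1\ge\dots\ge\lambda_n$, let the thin Kac module be $\nabla(\lambda)=\Pi^{n(n-1)/2}\operatorname{Ind}_{\mathfrak g_0\oplus\mathfrak g_1}^{\mathfrak g}V(\lambda-\gamma)$, where $\Pi$ is the parity shift, $\gamma=\sum_{i=1}^n(1-n)\varepsilon_i$, and $V(\lambda-\gamma)$ is the simple $\mathfrak{gl}(n)$-module with highest weight $\lambda-\gamma$ (with respect to the upper triangular Borel subalgebra), placed in parity $\lceil\frac12\sum_i\lambda_i\rceil \bmod 2$ and with $\mathfrak g_1$ acting by zero. Let $x\in\mathfrak g_{-1}$ be a root vector of weight $-(\varepsilon_{n-1}+\varepsilon_n)$, and for $M\in\mathcal F_n$ let $DS_n(M)=\ker_M x/xM$, a module over $\mathfrak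 p(n-2)$ embedded in $\mathfrak p(n)$ through the first $n-2$ coordinates. Then: 1. There is an additive homomorphism $ds_n:J(P(n))\to J(P(n-2))$ (necessarily unique) with $ds_n(\operatorname{sch}M)=\operatorname{sch}(DS_n(M))$ for all $M\in\mathcal F_n$; it is given by the evaluation $f\mapsto f|_{x_{n-1}=x_n^{-1}=t}$ (which is independent of $t$); and its kernel is the $\mathbb Z$-span of the supercharacters $\operatorname{sch}\nabla(\lambda)$, $\lambda_1\ge\dots\ge\lambda_n$. 2. The kernel of the extension of $ds_n$ to $J_n$ given by the same evaluation $f\mapsto f|_{x_{n-1}=x_n^{-1}=t}$ is also the $\mathbb Z$-span of the supercharacters $\operatorname{sch}\nabla(\lambda)$, $\lambda_1\ge\dots\ge\lambda_n$. -/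

import Mathlib

open scoped TensorProduct

noncomputable section

namespace Periplectic

/-! ### The Lie superalgebra `p(n)` -/

/-- The associative superalgebra `End(ℂ^{n|n})`, in block form: the first `n` basis vectors are
even and the last `n` are odd. -/
abbrev SMat (n : ℕ) := Matrix (Fin n ⊕ Fin n) (Fin n ⊕ Fin n) ℂ

/-- The even part of a block matrix. -/
def evenPart {n : ℕ} (X : SMat n) : SMat n := Matrix.fromBlocks X.toBlocks₁₁ 0 0 X.toBlocks₂₂

/-- The odd part of a block matrix. -/
def oddPart {n : ℕ} (X : SMat n) : SMat n := Matrix.fromBlocks 0 X.toBlocks₁₂ X.toBlocks₂₁ 0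

/-- The matrix `X` is homogeneous of parity `i`. -/
def IsHomogeneous {n : ℕ} (i : ZMod 2) (X : SMat n) : Prop :=
  if i = 0 then oddPart X = 0 else evenPart X = 0

/-- The sign `(-1)^{i j}`. -/
def sign (i j : ZMod 2) : ℂ := (-1) ^ (i.val * j.val)

/-- The bilinear supercommutator, equal to `X Y - (-1)^{|X||Y|} Y X` on homogeneous elements. -/
def superBracket {n : ℕ} (X Y : SMat n) : SMat n :=
  X * Y - Y * evenPart X - (evenPart Y - oddPart Y) * oddPart X

/-- The Lie superalgebra `p(n)`: block matrices `(A B; C -Aᵀ)` with `B` symmetric and `C`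
antisymmetric. -/
def periplectic (n : ℕ) : Submodule ℂ (SMat n) where
  carrier := {X | X.toBlocks₂₂ = -X.toBlocks₁₁.transpose ∧
    X.toBlocks₁₂.transpose = X.toBlocks₁₂ ∧ X.toBlocks₂₁.transpose = -X.toBlocks₂₁}
  add_mem' := by
    rintro X Y ⟨h1, h2, h3⟩ ⟨k1, k2, k3⟩
    have e11 : (X + Y).toBlocks₁₁ = X.toBlocks₁₁ + Y.toBlocks₁₁ := rfl
    have e12 : (X + Y).toBlocks₁₂ = X.toBlocks₁₂ + Y.toBlocks₁₂ := rfl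
    have e21 : (X + Y).toBlocks₂₁ = X.toBlocks₂₁ + Y.toBlocks₂₁ := rfl
    have e22 : (X + Y).toBlocks₂₂ = X.toBlocks₂₂ + Y.toBlocks₂₂ := rfl
    refine ⟨?_, ?_, ?_⟩
    · rw [e11, e22, h1, k1, Matrix.transpose_add, neg_add]
    · rw [e12, Matrix.transpose_add, h2, k2]
    · rw [e21, Matrix.transpose_add, h3, k3, neg_add]
  zero_mem' := by
    refine ⟨?_, ?_, ?_⟩ <;> ext i j <;>
      simp [Matrix.toBlocks₁₁, Matrix.toBlocks₁₂, Matrix.toBlocks₂₁, Matrix.toBlocks₂₂]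
  smul_mem' := by
    rintro c X ⟨h1, h2, h3⟩
    have e11 : (c • X).toBlocks₁₁ = c • X.toBlocks₁₁ := rfl
    have e12 : (c • X).toBlocks₁₂ = c • X.toBlocks₁₂ := rfl
    have e21 : (c • X).toBlocks₂₁ = c • X.toBlocks₂₁ := rfl
    have e22 : (c • X).toBlocks₂₂ = c • X.toBlocks₂₂ := rfl
    simp [e11, e12, e21, e22, h1, h2, h3]

theorem fromBlocks_mem {n : ℕ} {A B C D : Matrix (Fin n) (Fin n) ℂ} :
    Matrix.fromBlocks A B C D ∈ periplectic n ↔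
      D = -A.transpose ∧ B.transpose = B ∧ C.transpose = -C := by
  change (_ ∧ _ ∧ _) ↔ _
  simp

theorem eq_fromBlocks {n : ℕ} {X : SMat n} (hX : X ∈ periplectic n) :
    ∃ A B C : Matrix (Fin n) (Fin n) ℂ, B.transpose = B ∧ C.transpose = -C ∧
      X = Matrix.fromBlocks A B C (-A.transpose) := by
  obtain ⟨h1, h2, h3⟩ := hX
  refine ⟨X.toBlocks₁₁, X.toBlocks₁₂, X.toBlocks₂₁, h2, h3, ?_⟩
  rw [← h1, Matrix.fromBlocks_toBlocks]

theorem superBracket_mem {n : ℕ} {X Y : SMat n} (hX : X ∈ periplectic n)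
    (hY : Y ∈ periplectic n) : superBracket X Y ∈ periplectic n := by
  obtain ⟨A, B, C, hB, hC, rfl⟩ := eq_fromBlocks hX
  obtain ⟨A', B', C', hB', hC', rfl⟩ := eq_fromBlocks hY
  simp only [superBracket, evenPart, oddPart, Matrix.toBlocks_fromBlocks₁₁,
    Matrix.toBlocks_fromBlocks₁₂, Matrix.toBlocks_fromBlocks₂₁, Matrix.toBlocks_fromBlocks₂₂,
    sub_eq_add_neg, Matrix.fromBlocks_neg, Matrix.fromBlocks_add, Matrix.fromBlocks_multiply,
    fromBlocks_mem]
  refine ⟨?_, ?_, ?_⟩ <;>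
    simp only [Matrix.transpose_add, Matrix.transpose_neg, Matrix.transpose_mul, hB, hC, hB', hC',
      Matrix.transpose_transpose, Matrix.transpose_zero] <;> noncomm_ring

/-- The superbracket of `p(n)`. -/
def bracket {n : ℕ} (X Y : periplectic n) : periplectic n :=
  ⟨superBracket (X : SMat n) Y, superBracket_mem X.2 Y.2⟩

/-! ### Representations of `p(n)`, weights and supercharacters -/

/-- A representation of the Lie superalgebra `p(n)` on a complex super vector space. The
`ℤ/2`-grading is recorded by the parity involution, which is `1` on even vectors and `-1` on odd
vectors. -/
structure PRep (n : ℕ) where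
  carrier : Type
  [addCommGroup : AddCommGroup carrier]
  [module : Module ℂ carrier]
  parity : Module.End ℂ carrier
  parity_sq : parity * parity = 1
  act : periplectic n →ₗ[ℂ] Module.End ℂ carrier
  parity_act : ∀ (i : ZMod 2) (X : periplectic n), IsHomogeneous i (X : SMat n) →
    parity * act X = sign i 1 • (act X * parity)
  act_bracket : ∀ (i j : ZMod 2) (X Y : periplectic n),
    IsHomogeneous i (X : SMat n) → IsHomogeneous j (Y : SMat n) →
    act (bracket X Y) = act X * act Y - sign i j • (act Y * act X)

attribute [instance] PRep.addCommGroup PRep.module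

/-- The element of the Cartan subalgebra with `ε_i`-coordinates `h_i`. -/
def cartan {n : ℕ} (h : Fin n → ℂ) : periplectic n :=
  ⟨Matrix.fromBlocks (Matrix.diagonal h) 0 0 (-(Matrix.diagonal h).transpose), by
    rw [fromBlocks_mem]; simp⟩

namespace PRep

variable {n : ℕ} (M : PRep n)

/-- The subspace of even vectors. -/
def even : Submodule ℂ M.carrier := LinearMap.ker (M.parity - 1)

/-- The subspace of odd vectors. -/
def odd : Submodule ℂ M.carrier := LinearMap.ker (M.parity + 1)

/-- The weight space of the integral weight `μ = ∑ μ_i ε_i`. -/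
def weightSpace (μ : Fin n → ℤ) : Submodule ℂ M.carrier :=
  ⨅ h : Fin n → ℂ, LinearMap.ker (M.act (cartan h) - (∑ i, h i * (μ i : ℂ)) • 1)

/-- The objects of the category `F_n` of finite-dimensional representations of the algebraic
supergroup `P(n)`: the finite-dimensional representations of `p(n)` which are integrable over
`GL(n)`, i.e. those on which the Cartan subalgebra acts diagonalizably with integral weights. -/
def IsIntegrable : Prop :=
  FiniteDimensional ℂ M.carrier ∧ ⨆ μ : Fin n → ℤ, M.weightSpace μ = ⊤

/-- The superdimension of a weight space. -/
def sdimWeight (μ : Fin n → ℤ) : ℤ :=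
  (Module.finrank ℂ ↥(M.weightSpace μ ⊓ M.even) : ℤ) -
    (Module.finrank ℂ ↥(M.weightSpace μ ⊓ M.odd) : ℤ)

end PRep

/-- The ring `ℤ[x_1^{±1}, …, x_n^{±1}]`, as the group ring of the lattice of integral weights;
the monomial `x^μ = e^μ` is `AddMonoidAlgebra.single μ 1`. -/
abbrev Laurent (n : ℕ) := AddMonoidAlgebra ℤ (Fin n → ℤ)

/-- The supercharacter `∑_μ sdim(M_μ) e^μ` (a finite sum when `M` is finite-dimensional). -/
def PRep.sch {n : ℕ} (M : PRep n) : Laurent n :=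
  ∑ᶠ μ : Fin n → ℤ, AddMonoidAlgebra.single μ (M.sdimWeight μ)

/-- The ring of supercharacters `J(P(n))`, as an additive group of Laurent polynomials: the group
generated by the supercharacters of the objects of `F_n`. -/
def JP (n : ℕ) : AddSubgroup (Laurent n) :=
  AddSubgroup.closure {f | ∃ M : PRep n, M.IsIntegrable ∧ M.sch = f}

theorem sch_mem_JP {n : ℕ} (M : PRep n) (hM : M.IsIntegrable) : M.sch ∈ JP n :=
  AddSubgroup.subset_closure ⟨M, hM, rfl⟩

/-- The parity shift `Π`. -/
def PRep.parityShift {n : ℕ} (M : PRep n) : PRep n where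
  carrier := M.carrier
  parity := -M.parity
  parity_sq := by rw [neg_mul_neg, M.parity_sq]
  act := M.act
  parity_act i X hX := by rw [neg_mul, M.parity_act i X hX, mul_neg, smul_neg]
  act_bracket := M.act_bracket

/-! ### The enveloping superalgebra and induction -/

/-- The defining relations `X Y - (-1)^{|X||Y|} Y X = [X, Y]` of the enveloping superalgebra. -/
inductive EnvRel (n : ℕ) :
    TensorAlgebra ℂ (periplectic n) → TensorAlgebra ℂ (periplectic n) → Prop
  | mk (i j : ZMod 2) (X Y : periplectic n) (hX : IsHomogeneous i (X : SMat n))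
      (hY : IsHomogeneous j (Y : SMat n)) :
      EnvRel n (TensorAlgebra.ι ℂ (bracket X Y))
        (TensorAlgebra.ι ℂ X * TensorAlgebra.ι ℂ Y -
          sign i j • (TensorAlgebra.ι ℂ Y * TensorAlgebra.ι ℂ X))

/-- The universal enveloping superalgebra `U(p(n))`. -/
def Env (n : ℕ) : Type := RingQuot (EnvRel n)

instance (n : ℕ) : Ring (Env n) := inferInstanceAs (Ring (RingQuot (EnvRel n)))

instance (n : ℕ) : Algebra ℂ (Env n) := inferInstanceAs (Algebra ℂ (RingQuot (EnvRel n)))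

/-- The quotient map from the tensor algebra to `U(p(n))`. -/
def envMk (n : ℕ) : TensorAlgebra ℂ (periplectic n) →ₐ[ℂ] Env n := RingQuot.mkAlgHom ℂ (EnvRel n)

/-- The canonical map `p(n) → U(p(n))`. -/
def envι (n : ℕ) : periplectic n →ₗ[ℂ] Env n :=
  (envMk n).toLinearMap ∘ₗ TensorAlgebra.ι ℂ

theorem envι_bracket {n : ℕ} (i j : ZMod 2) (X Y : periplectic n)
    (hX : IsHomogeneous i (X : SMat n)) (hY : IsHomogeneous j (Y : SMat n)) :
    envι n (bracket X Y) = envι n X * envι n Y - sign i j • (envι n Y * envι n X) := by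
  have h : envMk n (TensorAlgebra.ι ℂ (bracket X Y)) =
      envMk n (TensorAlgebra.ι ℂ X * TensorAlgebra.ι ℂ Y -
          sign i j • (TensorAlgebra.ι ℂ Y * TensorAlgebra.ι ℂ X)) :=
    RingQuot.mkAlgHom_rel ℂ (EnvRel.mk i j X Y hX hY)
  rw [map_sub, map_smul, map_mul, map_mul] at h
  exact h

theorem evenPart_add {n : ℕ} (X Y : SMat n) : evenPart (X + Y) = evenPart X + evenPart Y := by
  rw [evenPart, evenPart, evenPart, Matrix.fromBlocks_add, add_zero]
  rfl

theorem oddPart_add {n : ℕ} (X Y : SMat n) : oddPart (X + Y) = oddPart X + oddPart Y := by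
  rw [oddPart, oddPart, oddPart, Matrix.fromBlocks_add, add_zero]
  rfl

theorem evenPart_smul {n : ℕ} (c : ℂ) (X : SMat n) : evenPart (c • X) = c • evenPart X := by
  rw [evenPart, evenPart, Matrix.fromBlocks_smul, smul_zero]
  rfl

theorem oddPart_smul {n : ℕ} (c : ℂ) (X : SMat n) : oddPart (c • X) = c • oddPart X := by
  rw [oddPart, oddPart, Matrix.fromBlocks_smul, smul_zero]
  rfl

theorem bracket_smul_smul {n : ℕ} (a b : ℂ) (X Y : periplectic n) :
    bracket (a • X) (b • Y) = (a * b) • bracket X Y := by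
  apply Subtype.ext
  change superBracket (a • (X : SMat n)) (b • (Y : SMat n)) =
    (a * b) • superBracket (X : SMat n) Y
  simp only [superBracket, evenPart_smul, oddPart_smul, smul_mul_smul_comm, ← smul_sub,
    mul_comm b a]

/-- The parity automorphism `X ↦ (-1)^{|X|} X` of `p(n)`. -/
def parityAut (n : ℕ) : periplectic n →ₗ[ℂ] periplectic n where
  toFun X := ⟨evenPart (X : SMat n) - oddPart (X : SMat n), by
    obtain ⟨A, B, C, hB, hC, h⟩ := eq_fromBlocks X.2
    rw [h]
    simp only [evenPart, oddPart, Matrix.toBlocks_fromBlocks₁₁,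
      Matrix.toBlocks_fromBlocks₁₂, Matrix.toBlocks_fromBlocks₂₁, Matrix.toBlocks_fromBlocks₂₂,
      sub_eq_add_neg, Matrix.fromBlocks_neg, Matrix.fromBlocks_add, fromBlocks_mem]
    simp [hB, hC]⟩
  map_add' X Y := by
    apply Subtype.ext
    simp only [Submodule.coe_add, evenPart_add, oddPart_add]
    abel
  map_smul' c X := by
    apply Subtype.ext
    simp only [Submodule.coe_smul, evenPart_smul, oddPart_smul, RingHom.id_apply, smul_sub]

theorem even_add_odd {n : ℕ} (X : SMat n) : evenPart X + oddPart X = X := by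
  conv_rhs => rw [← Matrix.fromBlocks_toBlocks X]
  simp [evenPart, oddPart, Matrix.fromBlocks_add]

theorem parityAut_homogeneous {n : ℕ} (i : ZMod 2) (X : periplectic n)
    (hX : IsHomogeneous i (X : SMat n)) : parityAut n X = sign i 1 • X := by
  apply Subtype.ext
  change evenPart (X : SMat n) - oddPart (X : SMat n) = sign i 1 • (X : SMat n)
  conv_rhs => rw [← even_add_odd (X : SMat n)]
  have h01 : ∀ k : ZMod 2, k = 0 ∨ k = 1 := by decide
  rcases h01 i with rfl | rfl
  · have h : oddPart (X : SMat n) = 0 := hX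
    simp [h, sign]
  · have h : evenPart (X : SMat n) = 0 := hX
    simp [h, sign, ZMod.val_one]

theorem parityAut_parityAut {n : ℕ} (X : periplectic n) :
    parityAut n (parityAut n X) = X := by
  apply Subtype.ext
  obtain ⟨A, B, C, hB, hC, h⟩ := eq_fromBlocks X.2
  change evenPart (evenPart (X : SMat n) - oddPart (X : SMat n)) -
    oddPart (evenPart (X : SMat n) - oddPart (X : SMat n)) = (X : SMat n)
  rw [h]
  simp [evenPart, oddPart, sub_eq_add_neg, Matrix.fromBlocks_neg, Matrix.fromBlocks_add]

theorem parityAut_bracket {n : ℕ} (X Y : periplectic n) :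
    parityAut n (bracket X Y) = bracket (parityAut n X) (parityAut n Y) := by
  apply Subtype.ext
  obtain ⟨A, B, C, hB, hC, hX⟩ := eq_fromBlocks X.2
  obtain ⟨A', B', C', hB', hC', hY⟩ := eq_fromBlocks Y.2
  change evenPart (superBracket (X : SMat n) Y) - oddPart (superBracket (X : SMat n) Y) =
    superBracket (evenPart (X : SMat n) - oddPart (X : SMat n))
      (evenPart (Y : SMat n) - oddPart (Y : SMat n))
  rw [hX, hY]
  simp [superBracket, evenPart, oddPart, sub_eq_add_neg, Matrix.fromBlocks_neg,
    Matrix.fromBlocks_add, Matrix.fromBlocks_multiply]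
  constructor <;> abel

/-- The parity automorphism of `U(p(n))`, which defines its `ℤ/2`-grading. -/
def envParity (n : ℕ) : Env n →ₐ[ℂ] Env n :=
  RingQuot.liftAlgHom ℂ ⟨TensorAlgebra.lift ℂ (envι n ∘ₗ parityAut n), by
    rintro _ _ ⟨i, j, X, Y, hX, hY⟩
    simp only [map_sub, map_smul, map_mul, TensorAlgebra.lift_ι_apply, LinearMap.comp_apply,
      parityAut_bracket]
    rw [parityAut_homogeneous i X hX, parityAut_homogeneous j Y hY, bracket_smul_smul]
    simp only [map_smul, envι_bracket i j X Y hX hY, smul_mul_smul_comm, smul_sub]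
    rw [mul_comm (sign j 1) (sign i 1), smul_comm]⟩

theorem envParity_envι {n : ℕ} (X : periplectic n) :
    envParity n (envι n X) = envι n (parityAut n X) := by
  have h : envParity n (envMk n (TensorAlgebra.ι ℂ X)) =
      TensorAlgebra.lift ℂ (envι n ∘ₗ parityAut n) (TensorAlgebra.ι ℂ X) :=
    RingQuot.liftAlgHom_mkAlgHom_apply ℂ _ _ _
  rw [TensorAlgebra.lift_ι_apply] at h
  exact h

theorem envParity_envParity {n : ℕ} (u : Env n) : envParity n (envParity n u) = u := by
  have h : (envParity n).comp (envParity n) = AlgHom.id ℂ (Env n) := by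
    apply RingQuot.ringQuot_ext'
    apply TensorAlgebra.hom_ext
    ext X : 1
    change envParity n (envParity n (envι n X)) = envι n X
    rw [envParity_envι, envParity_envι, parityAut_parityAut]
  exact DFunLike.congr_fun h u

/-- A complex representation of the Lie algebra `gl(n)`. -/
structure GLRep (n : ℕ) where
  carrier : Type
  [addCommGroup : AddCommGroup carrier]
  [module : Module ℂ carrier]
  act : Matrix (Fin n) (Fin n) ℂ →ₗ[ℂ] Module.End ℂ carrier
  act_lie : ∀ X Y, act (X * Y - Y * X) = act X * act Y - act Y * act X

attribute [instance] GLRep.addCommGroup GLRep.module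

/-- `V` is a simple (finite-dimensional) `gl(n)`-module with highest weight `wt` with respect to
the Borel subalgebra of upper triangular matrices. -/
structure GLRep.IsSimpleOfHighestWeight {n : ℕ} (V : GLRep n) (wt : Fin n → ℤ) : Prop where
  finiteDimensional : FiniteDimensional ℂ V.carrier
  simple : ∀ W : Submodule ℂ V.carrier, (∀ X, ∀ v ∈ W, V.act X v ∈ W) → W = ⊥ ∨ W = ⊤
  highest : ∃ v : V.carrier, v ≠ 0 ∧ (∀ i j, i < j → V.act (Matrix.single i j 1) v = 0) ∧
    ∀ i, V.act (Matrix.single i i 1) v = (wt i : ℂ) • v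

/-- The relations `u X ⊗ v = u ⊗ X v` for `u ∈ U(p(n))` and `X ∈ g_0 ⊕ g_1`, where `g_1`, the
upper right block, acts by zero on the `g_0 = gl(n)`-module `V`. -/
def indRelations {n : ℕ} (V : GLRep n) : Submodule ℂ (Env n ⊗[ℂ] V.carrier) :=
  Submodule.span ℂ {z | ∃ (u : Env n) (X : periplectic n) (v : V.carrier),
    (X : SMat n).toBlocks₂₁ = 0 ∧
      z = (u * envι n X) ⊗ₜ[ℂ] v - u ⊗ₜ[ℂ] (V.act (X : SMat n).toBlocks₁₁ v)}

theorem indRelations_mulLeft {n : ℕ} (V : GLRep n) (w : Env n) :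
    indRelations V ≤ (indRelations V).comap
      ((LinearMap.mulLeft ℂ w).rTensor V.carrier) := by
  rw [indRelations, Submodule.span_le]
  rintro _ ⟨u, X, v, hX, rfl⟩
  refine Submodule.subset_span ⟨w * u, X, v, hX, ?_⟩
  simp [mul_assoc]

theorem indRelations_parity {n : ℕ} (V : GLRep n) :
    indRelations V ≤ (indRelations V).comap
      ((envParity n).toLinearMap.rTensor V.carrier) := by
  rw [indRelations, Submodule.span_le]
  rintro _ ⟨u, X, v, hX, rfl⟩
  obtain ⟨A, B, C, hB, hC, h⟩ := eq_fromBlocks X.2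
  have e : (parityAut n X : SMat n) = evenPart (X : SMat n) - oddPart (X : SMat n) := rfl
  have e11 : (parityAut n X : SMat n).toBlocks₁₁ = (X : SMat n).toBlocks₁₁ := by
    rw [e, h]
    simp [evenPart, oddPart, sub_eq_add_neg, Matrix.fromBlocks_neg, Matrix.fromBlocks_add]
  have e21 : (parityAut n X : SMat n).toBlocks₂₁ = 0 := by
    rw [h, Matrix.toBlocks_fromBlocks₂₁] at hX
    rw [e, h]
    simp [evenPart, oddPart, sub_eq_add_neg, Matrix.fromBlocks_neg, Matrix.fromBlocks_add, hX]
  refine Submodule.subset_span ⟨envParity n u, parityAut n X, v, e21, ?_⟩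
  simp [envParity_envι, e11]

/-- The action of `u ∈ U(p(n))` on the induced module. -/
def indAct {n : ℕ} (V : GLRep n) (u : Env n) :
    Module.End ℂ ((Env n ⊗[ℂ] V.carrier) ⧸ indRelations V) :=
  (indRelations V).mapQ (indRelations V) ((LinearMap.mulLeft ℂ u).rTensor V.carrier)
    (indRelations_mulLeft V u)

theorem ind_hom_ext {n : ℕ} {V : GLRep n}
    {f g : Module.End ℂ ((Env n ⊗[ℂ] V.carrier) ⧸ indRelations V)}
    (h : ∀ u v, f (Submodule.Quotient.mk (u ⊗ₜ[ℂ] v)) = g (Submodule.Quotient.mk (u ⊗ₜ[ℂ] v))) :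
    f = g := by
  apply Submodule.linearMap_qext
  apply TensorProduct.ext'
  exact h

theorem indAct_mk {n : ℕ} (V : GLRep n) (w u : Env n) (v : V.carrier) :
    indAct V w (Submodule.Quotient.mk (u ⊗ₜ[ℂ] v)) =
      Submodule.Quotient.mk ((w * u) ⊗ₜ[ℂ] v) := rfl

/-- The parity involution of the induced module of a purely even module. -/
def indParity {n : ℕ} (V : GLRep n) :
    Module.End ℂ ((Env n ⊗[ℂ] V.carrier) ⧸ indRelations V) :=
  (indRelations V).mapQ (indRelations V) ((envParity n).toLinearMap.rTensor V.carrier)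
    (indRelations_parity V)

theorem indParity_mk {n : ℕ} (V : GLRep n) (u : Env n) (v : V.carrier) :
    indParity V (Submodule.Quotient.mk (u ⊗ₜ[ℂ] v)) =
      Submodule.Quotient.mk (envParity n u ⊗ₜ[ℂ] v) := rfl

/-- The action of `p(n)` on the induced module. -/
def indActHom {n : ℕ} (V : GLRep n) :
    periplectic n →ₗ[ℂ] Module.End ℂ ((Env n ⊗[ℂ] V.carrier) ⧸ indRelations V) where
  toFun X := indAct V (envι n X)
  map_add' X Y := by
    apply ind_hom_ext
    intro u v
    rw [LinearMap.add_apply, indAct_mk, indAct_mk, indAct_mk, map_add, add_mul,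
      TensorProduct.add_tmul, Submodule.Quotient.mk_add]
  map_smul' c X := by
    apply ind_hom_ext
    intro u v
    rw [RingHom.id_apply, LinearMap.smul_apply, indAct_mk, indAct_mk, map_smul,
      smul_mul_assoc, ← TensorProduct.smul_tmul', Submodule.Quotient.mk_smul]

/-- The induced module `Ind_{g_0 ⊕ g_1}^{g} V = U(g) ⊗_{U(g_0 ⊕ g_1)} V`, for `g = p(n)` and a
purely even `g_0`-module `V` on which `g_1` acts by zero. -/
def ind {n : ℕ} (V : GLRep n) : PRep n where
  carrier := (Env n ⊗[ℂ] V.carrier) ⧸ indRelations V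
  parity := indParity V
  parity_sq := by
    apply ind_hom_ext
    intro u v
    rw [Module.End.mul_apply, indParity_mk, indParity_mk, envParity_envParity]
    rfl
  act := indActHom V
  parity_act i X hX := by
    apply ind_hom_ext
    intro u v
    change indParity V (indAct V (envι n X) (Submodule.Quotient.mk (u ⊗ₜ[ℂ] v))) =
      sign i 1 • indAct V (envι n X) (indParity V (Submodule.Quotient.mk (u ⊗ₜ[ℂ] v)))
    rw [indAct_mk, indParity_mk, indParity_mk, indAct_mk, map_mul, envParity_envι,
      parityAut_homogeneous i X hX, map_smul, smul_mul_assoc, ← TensorProduct.smul_tmul',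
      Submodule.Quotient.mk_smul]
  act_bracket i j X Y hX hY := by
    apply ind_hom_ext
    intro u v
    change indAct V (envι n (bracket X Y)) (Submodule.Quotient.mk (u ⊗ₜ[ℂ] v)) =
      indAct V (envι n X) (indAct V (envι n Y) (Submodule.Quotient.mk (u ⊗ₜ[ℂ] v))) -
        sign i j • indAct V (envι n Y) (indAct V (envι n X) (Submodule.Quotient.mk (u ⊗ₜ[ℂ] v)))
    rw [indAct_mk, indAct_mk, indAct_mk, indAct_mk, indAct_mk, envι_bracket i j X Y hX hY,
      sub_mul, smul_mul_assoc, TensorProduct.sub_tmul, ← TensorProduct.smul_tmul',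
      Submodule.Quotient.mk_sub, Submodule.Quotient.mk_smul, mul_assoc, mul_assoc]

/-! ### Thin Kac modules -/

/-- The weight `γ = ∑_{α ∈ Δ(g_{-1})} α = ∑_i (1 - n) ε_i`. -/
def gammaWeight (n : ℕ) : Fin n → ℤ := fun _ => 1 - (n : ℤ)

/-- The parity `p(wt)`, namely `⌈(∑ wt_i) / 2⌉` modulo `2`. -/
def weightParity {n : ℕ} (wt : Fin n → ℤ) : ZMod 2 := (((∑ i, wt i) + 1) / 2 : ℤ)

/-- The thin Kac module `∇(wt) = Π^{n(n-1)/2} Ind_{g_0 ⊕ g_1}^{g} V`, where `V` is the simple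
`gl(n)`-module of highest weight `wt - γ`, placed in parity `p(wt)`. -/
def thinKac {n : ℕ} (wt : Fin n → ℤ) (V : GLRep n) : PRep n :=
  PRep.parityShift^[n * (n - 1) / 2] (PRep.parityShift^[(weightParity wt).val] (ind V))

/-- The `ℤ`-span of the supercharacters of the thin Kac modules `∇(wt)`, over all dominant
integral weights `wt_1 ≥ wt_2 ≥ … ≥ wt_n`. -/
def thinKacSpan (n : ℕ) : AddSubgroup (Laurent n) :=
  AddSubgroup.closure {f | ∃ (wt : Fin n → ℤ) (V : GLRep n), Antitone wt ∧
    V.IsSimpleOfHighestWeight (wt - gammaWeight n) ∧ (thinKac wt V).sch = f}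

/-! ### The Duflo–Serganova functor `M ↦ M_x = ker x / x M` -/

/-- The inclusion matrix `ℂ^n → ℂ^{n+2}` onto the first `n` basis vectors. -/
def inclMatrix (n : ℕ) : Matrix (Fin (n + 2)) (Fin n) ℂ :=
  Matrix.of fun a b => if a = Fin.castAdd 2 b then 1 else 0

/-- The embedding of matrices extending every block by zero. -/
def embMatrix {n : ℕ} (X : SMat n) : SMat (n + 2) :=
  let Q := Matrix.fromBlocks (inclMatrix n) 0 0 (inclMatrix n)
  Q * X * Q.transpose

theorem inclMatrix_transpose_mul (n : ℕ) : (inclMatrix n).transpose * inclMatrix n = 1 := by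
  ext a b
  simp only [inclMatrix, Matrix.mul_apply, Matrix.transpose_apply, Matrix.of_apply,
    Matrix.one_apply, ite_mul, one_mul, zero_mul, Finset.sum_ite_eq', Finset.mem_univ, if_true,
    Fin.castAdd_inj]

theorem embMatrix_fromBlocks {n : ℕ} (A B C D : Matrix (Fin n) (Fin n) ℂ) :
    embMatrix (Matrix.fromBlocks A B C D) =
      Matrix.fromBlocks (inclMatrix n * A * (inclMatrix n).transpose)
        (inclMatrix n * B * (inclMatrix n).transpose)
        (inclMatrix n * C * (inclMatrix n).transpose)
        (inclMatrix n * D * (inclMatrix n).transpose) := by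
  simp [embMatrix, Matrix.fromBlocks_transpose, Matrix.fromBlocks_multiply]

theorem embMatrix_mul {n : ℕ} (X Y : SMat n) :
    embMatrix X * embMatrix Y = embMatrix (X * Y) := by
  have h : (Matrix.fromBlocks (inclMatrix n) 0 0 (inclMatrix n)).transpose *
      Matrix.fromBlocks (inclMatrix n) 0 0 (inclMatrix n) = 1 := by
    simp [Matrix.fromBlocks_transpose, Matrix.fromBlocks_multiply, inclMatrix_transpose_mul]
  simp only [embMatrix, Matrix.mul_assoc]
  rw [← Matrix.mul_assoc (Matrix.transpose _) (Matrix.fromBlocks _ _ _ _), h, Matrix.one_mul]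

theorem embMatrix_sub {n : ℕ} (X Y : SMat n) :
    embMatrix (X - Y) = embMatrix X - embMatrix Y := by
  simp only [embMatrix, Matrix.mul_sub, Matrix.sub_mul]

theorem evenPart_embMatrix {n : ℕ} (X : SMat n) :
    evenPart (embMatrix X) = embMatrix (evenPart X) := by
  rw [← Matrix.fromBlocks_toBlocks X]
  simp [embMatrix_fromBlocks, evenPart]

theorem oddPart_embMatrix {n : ℕ} (X : SMat n) :
    oddPart (embMatrix X) = embMatrix (oddPart X) := by
  rw [← Matrix.fromBlocks_toBlocks X]
  simp [embMatrix_fromBlocks, oddPart]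

theorem IsHomogeneous.embMatrix {n : ℕ} {i : ZMod 2} {X : SMat n} (hX : IsHomogeneous i X) :
    IsHomogeneous i (Periplectic.embMatrix X) := by
  have h0 : Periplectic.embMatrix (0 : SMat n) = 0 := by simp [Periplectic.embMatrix]
  unfold IsHomogeneous at hX ⊢
  split_ifs at hX ⊢ with h
  · rw [oddPart_embMatrix, hX, h0]
  · rw [evenPart_embMatrix, hX, h0]

/-- The embedding `p(n) → p(n+2)` using the first `n` coordinates. -/
def emb (n : ℕ) : periplectic n →ₗ[ℂ] periplectic (n + 2) where
  toFun X := ⟨embMatrix (X : SMat n), by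
    obtain ⟨A, B, C, hB, hC, h⟩ := eq_fromBlocks X.2
    rw [h, embMatrix_fromBlocks, fromBlocks_mem]
    simp [Matrix.transpose_mul, Matrix.mul_assoc, hB, hC]⟩
  map_add' X Y := by
    apply Subtype.ext
    simp [embMatrix, Matrix.mul_add, Matrix.add_mul]
  map_smul' c X := by
    apply Subtype.ext
    simp [embMatrix]

theorem emb_bracket {n : ℕ} (X Y : periplectic n) :
    emb n (bracket X Y) = bracket (emb n X) (emb n Y) := by
  apply Subtype.ext
  change embMatrix (superBracket (X : SMat n) Y) =
    superBracket (embMatrix (X : SMat n)) (embMatrix (Y : SMat n))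
  simp only [superBracket, evenPart_embMatrix, oddPart_embMatrix, embMatrix_mul, ← embMatrix_sub]

/-- The odd root vector `x ∈ p(n+2)` of weight `-(ε_{n+1} + ε_{n+2})` (indices starting at `1`). -/
def rootVector (n : ℕ) : periplectic (n + 2) :=
  ⟨Matrix.fromBlocks 0 0
    (Matrix.single (Fin.natAdd n 1) (Fin.natAdd n 0) 1 -
      Matrix.single (Fin.natAdd n 0) (Fin.natAdd n 1) 1) 0, by
    rw [fromBlocks_mem]; simp⟩

theorem rootVector_odd (n : ℕ) : IsHomogeneous 1 (rootVector n : SMat (n + 2)) := by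
  change evenPart _ = 0
  simp [evenPart, rootVector]

theorem bracket_emb_rootVector {n : ℕ} (X : periplectic n) :
    bracket (emb n X) (rootVector n) = 0 := by
  have h1 : ∀ (k : Fin 2) (b : Fin (n + 2)),
      (inclMatrix n).transpose * Matrix.single (Fin.natAdd n k) b (1 : ℂ) =
      0 := by
    intro k b
    ext i j
    simp only [Matrix.mul_apply, Matrix.transpose_apply, inclMatrix, Matrix.of_apply,
      Matrix.single_apply, Matrix.zero_apply]
    apply Finset.sum_eq_zero
    intro a _
    simp only [Fin.ext_iff, Fin.val_castAdd, Fin.val_natAdd]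
    split_ifs <;> first | omega | simp
  have h2 : ∀ (k : Fin 2) (b : Fin (n + 2)),
      Matrix.single b (Fin.natAdd n k) (1 : ℂ) * inclMatrix n = 0 := by
    intro k b
    ext i j
    simp only [Matrix.mul_apply, inclMatrix, Matrix.of_apply,
      Matrix.single_apply, Matrix.zero_apply]
    apply Finset.sum_eq_zero
    intro a _
    simp only [Fin.ext_iff, Fin.val_castAdd, Fin.val_natAdd]
    split_ifs <;> first | omega | simp
  apply Subtype.ext
  obtain ⟨A, B, C, hB, hC, h⟩ := eq_fromBlocks X.2
  change superBracket (embMatrix (X : SMat n)) (Matrix.fromBlocks _ _ _ _) = 0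
  rw [h]
  simp [superBracket, embMatrix_fromBlocks, evenPart, oddPart, Matrix.fromBlocks_multiply,
    Matrix.mul_sub, Matrix.sub_mul, Matrix.mul_assoc, h1]
  simp [← Matrix.mul_assoc, h2]

/-- Elements of `p(n)` supercommute with `x`. -/
theorem act_emb_rootVector {n : ℕ} (M : PRep (n + 2)) (X : periplectic n) :
    M.act (emb n X) * M.act (rootVector n) =
      M.act (rootVector n) * M.act (emb n (parityAut n X)) := by
  have key : ∀ (i : ZMod 2) (Y : periplectic n), IsHomogeneous i (Y : SMat n) →
      M.act (emb n Y) * M.act (rootVector n) =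
        M.act (rootVector n) * M.act (emb n (parityAut n Y)) := by
    intro i Y hY
    have h := M.act_bracket i 1 (emb n Y) (rootVector n) hY.embMatrix (rootVector_odd n)
    rw [bracket_emb_rootVector, map_zero] at h
    rw [parityAut_homogeneous i Y hY, map_smul, map_smul, mul_smul_comm]
    exact sub_eq_zero.mp h.symm
  obtain ⟨A, B, C, hB, hC, h⟩ := eq_fromBlocks X.2
  let X0 : periplectic n := ⟨Matrix.fromBlocks A 0 0 (-A.transpose), by
    rw [fromBlocks_mem]; simp⟩
  let X1 : periplectic n := ⟨Matrix.fromBlocks 0 B C 0, by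
    rw [fromBlocks_mem]; simp [hB, hC]⟩
  have hX : X = X0 + X1 := by
    apply Subtype.ext
    rw [h]
    simp [X0, X1, Matrix.fromBlocks_add]
  have h0 : IsHomogeneous 0 (X0 : SMat n) := by
    change oddPart _ = 0
    simp [oddPart, X0]
  have h1 : IsHomogeneous 1 (X1 : SMat n) := by
    change evenPart _ = 0
    simp [evenPart, X1]
  rw [hX]
  simp only [map_add, add_mul, mul_add]
  rw [key 0 X0 h0, key 1 X1 h1]

theorem parity_rootVector {n : ℕ} (M : PRep (n + 2)) :
    M.parity * M.act (rootVector n) = -(M.act (rootVector n) * M.parity) := by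
  have h := M.parity_act 1 (rootVector n) (rootVector_odd n)
  simpa [sign, ZMod.val_one] using h

/-- The subspace `x M ∩ ker x` of `ker x`; since `x² = 0` on `M`, this is `x M`. -/
def dsRange {n : ℕ} (M : PRep (n + 2)) :
    Submodule ℂ ↥(LinearMap.ker (M.act (rootVector n))) :=
  (LinearMap.range (M.act (rootVector n))).comap
    (LinearMap.ker (M.act (rootVector n))).subtype

/-- An operator which commutes with `x` up to another operator induces an operator on `M_x`. -/
def dsMap {n : ℕ} (M : PRep (n + 2)) (f g : Module.End ℂ M.carrier)
    (h : f * M.act (rootVector n) = M.act (rootVector n) * g)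
    (h' : g * M.act (rootVector n) = M.act (rootVector n) * f) :
    Module.End ℂ (↥(LinearMap.ker (M.act (rootVector n))) ⧸ dsRange M) :=
  (dsRange M).mapQ (dsRange M)
    (f.restrict (p := LinearMap.ker (M.act (rootVector n)))
      (q := LinearMap.ker (M.act (rootVector n))) (fun v hv => by
        have e := LinearMap.congr_fun h' v
        rw [Module.End.mul_apply, Module.End.mul_apply, LinearMap.mem_ker.mp hv, map_zero] at e
        exact LinearMap.mem_ker.mpr e.symm))
    (by
      rintro ⟨v, hv⟩ ⟨w, hw⟩
      exact ⟨g w, by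
        have e := LinearMap.congr_fun h w
        rw [Module.End.mul_apply, Module.End.mul_apply, hw] at e
        exact e.symm⟩)

theorem ds_ext {n : ℕ} {M : PRep (n + 2)}
    {f g : Module.End ℂ (↥(LinearMap.ker (M.act (rootVector n))) ⧸ dsRange M)}
    (h : ∀ v hv, f (Submodule.Quotient.mk ⟨v, hv⟩) = g (Submodule.Quotient.mk ⟨v, hv⟩)) :
    f = g := by
  apply Submodule.linearMap_qext
  ext ⟨v, hv⟩
  exact h v hv

/-- The action of `p(n)` on `M_x`. -/
def dsAct {n : ℕ} (M : PRep (n + 2)) :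
    periplectic n →ₗ[ℂ]
      Module.End ℂ (↥(LinearMap.ker (M.act (rootVector n))) ⧸ dsRange M) where
  toFun X := dsMap M (M.act (emb n X)) (M.act (emb n (parityAut n X)))
    (act_emb_rootVector M X) (by rw [act_emb_rootVector, parityAut_parityAut])
  map_add' X Y := by
    apply ds_ext
    intro v hv
    refine congrArg Submodule.Quotient.mk (Subtype.ext ?_)
    change M.act (emb n (X + Y)) v = M.act (emb n X) v + M.act (emb n Y) v
    simp
  map_smul' c X := by
    apply ds_ext
    intro v hv
    refine congrArg Submodule.Quotient.mk (Subtype.ext ?_)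
    change M.act (emb n (c • X)) v = c • M.act (emb n X) v
    simp

/-- The Duflo–Serganova functor on objects: `M ↦ M_x = ker x / x M` with its induced parity and
the action of `p(n) ≅ p(n+2)_x`. -/
def DS {n : ℕ} (M : PRep (n + 2)) : PRep n where
  carrier := ↥(LinearMap.ker (M.act (rootVector n))) ⧸ dsRange M
  parity := dsMap M M.parity (-M.parity) (by rw [parity_rootVector, mul_neg])
    (by rw [neg_mul, parity_rootVector, neg_neg])
  parity_sq := by
    apply ds_ext
    intro v hv
    refine congrArg Submodule.Quotient.mk (Subtype.ext ?_)
    exact LinearMap.congr_fun M.parity_sq v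
  act := dsAct M
  parity_act i X hX := by
    apply ds_ext
    intro v hv
    refine congrArg Submodule.Quotient.mk (Subtype.ext ?_)
    exact LinearMap.congr_fun (M.parity_act i (emb n X) hX.embMatrix) v
  act_bracket i j X Y hX hY := by
    apply ds_ext
    intro v hv
    refine congrArg Submodule.Quotient.mk (Subtype.ext ?_)
    have h := M.act_bracket i j (emb n X) (emb n Y) hX.embMatrix hY.embMatrix
    rw [← emb_bracket] at h
    exact LinearMap.congr_fun h v

/-! ### The ring `J_n` and evaluation -/

/-- Substitution of units `u_i` of a commutative ring for the variables `x_i`. -/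
def subst {n : ℕ} {R : Type} [CommRing R] (u : Fin n → Rˣ) : Laurent n →+* R :=
  (AddMonoidAlgebra.lift ℤ R (Fin n → ℤ)
    { toFun := fun μ => ((∏ i, u i ^ (Multiplicative.toAdd μ i) : Rˣ) : R)
      map_one' := by simp
      map_mul' := fun μ ν => by
        rw [← Units.val_mul, ← Finset.prod_mul_distrib]
        simp [zpow_add] }).toRingHom

/-- The variable `x_i`, as a unit. -/
def var {n : ℕ} (i : Fin n) : (Laurent n)ˣ where
  val := AddMonoidAlgebra.single (Pi.single i 1) 1
  inv := AddMonoidAlgebra.single (-Pi.single i 1) 1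
  val_inv := by
    rw [AddMonoidAlgebra.single_mul_single, add_neg_cancel, mul_one]; rfl
  inv_val := by
    rw [AddMonoidAlgebra.single_mul_single, neg_add_cancel, mul_one]; rfl

/-- The variable `x_i` in the ring `ℤ[x_1^{±1}, …, x_n^{±1}][t^{±1}]`. -/
def varC {n : ℕ} (i : Fin n) : (LaurentPolynomial (Laurent n))ˣ :=
  Units.map (LaurentPolynomial.C : Laurent n →+* LaurentPolynomial (Laurent n)).toMonoidHom (var i)

/-- The additional variable `t`, as a unit. -/
def varT (n : ℕ) : (LaurentPolynomial (Laurent n))ˣ where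
  val := LaurentPolynomial.T 1
  inv := LaurentPolynomial.T (-1)
  val_inv := by rw [← LaurentPolynomial.T_add]; simp
  inv_val := by rw [← LaurentPolynomial.T_add]; simp

/-- The substitution `f ↦ f|_{x_i = x_j^{-1} = t}`, where the other variables are kept. -/
def substPair {n : ℕ} (i j : Fin n) : Laurent n →+* LaurentPolynomial (Laurent n) :=
  subst fun k => if k = i then varT n else if k = j then (varT n)⁻¹ else varC k

/-- The ring `J_n` of symmetric Laurent polynomials `f` over `ℤ` such that
`f|_{x_i = x_j^{-1} = t}` is independent of `t` for all `i ≠ j`. -/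
def J (n : ℕ) : Subring (Laurent n) :=
  (⨅ s : Equiv.Perm (Fin n), RingHom.eqLocus (subst fun k => var (s k)) (RingHom.id (Laurent n))) ⊓
    ⨅ (i : Fin n) (j : Fin n) (_ : i ≠ j),
      Subring.comap (substPair i j)
        (LaurentPolynomial.C : Laurent n →+* LaurentPolynomial (Laurent n)).range

/-- The evaluation `f ↦ f|_{x_{n+1} = x_{n+2}^{-1} = t}` from Laurent polynomials in `n + 2`
variables to Laurent polynomials in `x_1, …, x_n` and `t`. -/
def evalLast (n : ℕ) : Laurent (n + 2) →+* LaurentPolynomial (Laurent n) :=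
  subst (Fin.append (fun k => varC k) ![varT n, (varT n)⁻¹])

/-- The evaluation map `ds` on `J_{n+2}`. Its values are independent of `t`. -/
def dsJ (n : ℕ) : J (n + 2) →+* LaurentPolynomial (Laurent n) :=
  (evalLast n).comp (J (n + 2)).subtype

end Periplectic

end

/-!
Write `D = ∏_{i < j} (1 - x_i⁻¹ x_j⁻¹)`, the supercharacter of `Λ(g₋₁)` (`denom`). Both kernels and
the span of the supercharacters of the thin Kac modules are equal to the set of all `D * g` with
`g` a symmetric Laurent polynomial.

*The span.* `Ind V` is isomorphic to `Λ(g₋₁) ⊗ V` (`exists_kac_equiv`). In place of the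
Poincaré–Birkhoff–Witt theorem, the action of `p(n)` on `Λ(g₋₁) ⊗ V` is written down explicitly, and
mutually inverse maps are given by the universal properties of the two modules. Hence
`sch ∇(λ) = ± D * ch V(λ - γ)` (`thinKac_sch`). The characters of the simple `gl(n)`-modules of
dominant highest weight span the symmetric Laurent polynomials (`IsSymm.mem_closure`), because such
a module exists for each dominant weight (`exists_simple_of_antitone`), its character is `e^μ` plus
lexicographically smaller terms, and it is symmetric (reflections are realized by products of
exponentials in an `sl₂`-triple, `exists_reflection`).

*The kernel of the evaluation.* A symmetric `f` killed by `x_{n-1} = x_n⁻¹ = t` is killed by all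
substitutions `x_j ↦ x_i⁻¹`. The kernel of such a substitution is generated by
`1 - x_i⁻¹ x_j⁻¹`, and the other factors of `D` are not in it, so that `D` divides `f`
(`denom_dvd`); the quotient is symmetric as well. Conversely, multiples of `D` are killed by the
evaluation.

*The Duflo–Serganova functor.* The torus of `p(n-2)` commutes with the root vector `x`, so the
supercharacters of `M_x` and `M` for this torus agree (`sdimOf_homology`). If `y ∈ g₁` is the
opposite root vector, then `[x, y] = E_{n-1,n-1} - E_{n,n}`, so `x` is acyclic on the weight spaces
on which this element acts by a nonzero scalar, and their superdimensions add up to zero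
(`sdimOf_ext_eq_zero`). These are exactly the terms of `sch M` which contribute to nonzero powers of
`t` under the evaluation; they cancel, and the evaluation of `sch M` is `sch M_x` (`evalLast_sch`).
-/

noncomputable section

namespace Periplectic

/-! ### Weights and supercharacters of super vector spaces with a torus action -/

section Weights

variable {n : ℕ} {V : Type} [AddCommGroup V] [Module ℂ V]

/-- The weight space of weight `μ` for operators `H h` indexed by the Cartan subalgebra. -/
def wtOf (H : (Fin n → ℂ) → Module.End ℂ V) (μ : Fin n → ℤ) : Submodule ℂ V :=
  ⨅ h : Fin n → ℂ, LinearMap.ker (H h - (∑ i, h i * (μ i : ℂ)) • 1)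

/-- The homogeneous part of weight `χ.1` on which the parity involution `P` acts by the sign
`χ.2`. -/
def gr (P : Module.End ℂ V) (H : (Fin n → ℂ) → Module.End ℂ V) (χ : (Fin n → ℤ) × ℤˣ) :
    Submodule ℂ V :=
  wtOf H χ.1 ⊓ LinearMap.ker (P - ((χ.2 : ℤ) : ℂ) • 1)

/-- The superdimension of the weight space of weight `μ`. -/
def sdimOf (P : Module.End ℂ V) (H : (Fin n → ℂ) → Module.End ℂ V) (μ : Fin n → ℤ) : ℤ :=
  (Module.finrank ℂ ↥(wtOf H μ ⊓ LinearMap.ker (P - 1)) : ℤ) -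
    (Module.finrank ℂ ↥(wtOf H μ ⊓ LinearMap.ker (P + 1)) : ℤ)

/-- The supercharacter of a super vector space with parity involution `P` and torus action `H`. -/
def schOf (P : Module.End ℂ V) (H : (Fin n → ℂ) → Module.End ℂ V) : Laurent n :=
  ∑ᶠ μ : Fin n → ℤ, AddMonoidAlgebra.single μ (sdimOf P H μ)

theorem mem_wtOf {H : (Fin n → ℂ) → Module.End ℂ V} {μ : Fin n → ℤ} {v : V} :
    v ∈ wtOf H μ ↔ ∀ h, H h v = (∑ i, h i * (μ i : ℂ)) • v := by
  simp [wtOf, Submodule.mem_iInf, sub_eq_zero]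

theorem mem_gr {P : Module.End ℂ V} {H : (Fin n → ℂ) → Module.End ℂ V}
    {χ : (Fin n → ℤ) × ℤˣ} {v : V} :
    v ∈ gr P H χ ↔ (∀ h, H h v = (∑ i, h i * (χ.1 i : ℂ)) • v) ∧ P v = ((χ.2 : ℤ) : ℂ) • v := by
  simp [gr, mem_wtOf, sub_eq_zero]

theorem sdimOf_eq (P : Module.End ℂ V) (H : (Fin n → ℂ) → Module.End ℂ V) (μ : Fin n → ℤ) :
    sdimOf P H μ = (Module.finrank ℂ ↥(gr P H (μ, 1)) : ℤ) -
      (Module.finrank ℂ ↥(gr P H (μ, -1)) : ℤ) := by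
  have h1 : gr P H (μ, 1) = wtOf H μ ⊓ LinearMap.ker (P - 1) := by simp [gr]
  have h2 : gr P H (μ, -1) = wtOf H μ ⊓ LinearMap.ker (P + 1) := by simp [gr]
  rw [h1, h2, sdimOf]

/-- A finite basis consisting of parity-homogeneous weight vectors. -/
structure WeightBasis (P : Module.End ℂ V) (H : (Fin n → ℂ) → Module.End ℂ V) (ι : Type) where
  basis : Module.Basis ι ℂ V
  wt : ι → Fin n → ℤ
  sg : ι → ℤˣ
  mem : ∀ i, basis i ∈ gr P H (wt i, sg i)

/-- An integral weight is determined by the linear functional it defines. -/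
theorem eq_of_ev_eq {μ ν : Fin n → ℤ}
    (h : ∀ h : Fin n → ℂ, ∑ i, h i * (μ i : ℂ) = ∑ i, h i * (ν i : ℂ)) : μ = ν := by
  funext j
  have := h (Pi.single j 1)
  simpa [Pi.single_apply] using this

namespace WeightBasis

variable {P : Module.End ℂ V} {H : (Fin n → ℂ) → Module.End ℂ V} {ι : Type}

/-- A homogeneous vector only involves basis vectors of the same weight and parity. -/
theorem repr_eq_zero (b : WeightBasis P H ι) {χ : (Fin n → ℤ) × ℤˣ} {v : V}
    (hv : v ∈ gr P H χ) {i : ι} (hi : (b.wt i, b.sg i) ≠ χ) : b.basis.repr v i = 0 := by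
  by_contra h0
  apply hi
  have key : ∀ (T : Module.End ℂ V) (f : ι → ℂ) (c : ℂ),
      (∀ j, T (b.basis j) = f j • b.basis j) → T v = c • v → f i = c := by
    intro T f c hT hc
    have e : ∀ w, b.basis.repr (T w) i = f i * b.basis.repr w i := by
      intro w
      have : (b.basis.coord i).comp T = f i • b.basis.coord i := by
        apply b.basis.ext
        intro j
        by_cases hij : j = i
        · subst hij; simp [hT]
        · simp [hT, hij]
      simpa using LinearMap.congr_fun this w
    have e1 := e v
    rw [hc, map_smul] at e1
    simp only [Finsupp.smul_apply, smul_eq_mul] at e1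
    exact (mul_right_cancel₀ h0 e1).symm
  rw [mem_gr] at hv
  refine Prod.ext (eq_of_ev_eq fun h => ?_) ?_
  · exact key (H h) (fun j => ∑ i, h i * (b.wt j i : ℂ)) _
      (fun j => (mem_gr.mp (b.mem j)).1 h) (hv.1 h)
  · have := key P (fun j => ((b.sg j : ℤ) : ℂ)) _ (fun j => (mem_gr.mp (b.mem j)).2) hv.2
    exact Units.ext (by exact_mod_cast this)

theorem gr_eq_span (b : WeightBasis P H ι) (χ : (Fin n → ℤ) × ℤˣ) :
    gr P H χ = Submodule.span ℂ (b.basis '' {i | (b.wt i, b.sg i) = χ}) := by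
  apply le_antisymm
  · intro v hv
    rw [Module.Basis.mem_span_image]
    intro i hi
    by_contra h
    exact (Finsupp.mem_support_iff.mp hi) (b.repr_eq_zero hv h)
  · rw [Submodule.span_le]
    rintro _ ⟨i, rfl, rfl⟩
    exact b.mem i

theorem finrank_gr [Fintype ι] [DecidableEq ι] (b : WeightBasis P H ι) (χ : (Fin n → ℤ) × ℤˣ) :
    Module.finrank ℂ (gr P H χ) = (Finset.univ.filter fun i => (b.wt i, b.sg i) = χ).card := by
  rw [gr_eq_span b χ, Set.image_eq_range, finrank_span_eq_card, Fintype.card_subtype]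
  · rfl
  · exact b.basis.linearIndependent.comp _ Subtype.val_injective

theorem sdimOf_eq_sum [Fintype ι] (b : WeightBasis P H ι) (μ : Fin n → ℤ) :
    sdimOf P H μ = ∑ i, if b.wt i = μ then (b.sg i : ℤ) else 0 := by
  classical
  rw [sdimOf_eq, b.finrank_gr, b.finrank_gr, Finset.card_filter, Finset.card_filter]
  push_cast
  rw [← Finset.sum_sub_distrib]
  refine Finset.sum_congr rfl fun i _ => ?_
  rcases Int.units_eq_one_or (b.sg i) with h | h <;> by_cases hw : b.wt i = μ <;>
    simp [h, hw]

theorem schOf_eq [Fintype ι] (b : WeightBasis P H ι) :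
    schOf P H = ∑ i, AddMonoidAlgebra.single (b.wt i) (b.sg i : ℤ) := by
  classical
  rw [schOf, finsum_eq_sum_of_support_subset (s := Finset.univ.image b.wt)]
  · simp_rw [b.sdimOf_eq_sum]
    rw [← Finset.sum_fiberwise_of_maps_to (g := b.wt) (t := Finset.univ.image b.wt)
      (fun i _ => Finset.mem_image_of_mem _ (Finset.mem_univ i))]
    refine Finset.sum_congr rfl fun μ _ => ?_
    rw [← Finset.sum_filter]
    rw [← AddMonoidAlgebra.singleAddHom_apply, map_sum]
    refine Finset.sum_congr rfl fun i hi => ?_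
    rw [(Finset.mem_filter.mp hi).2]
    rfl
  · intro μ hμ
    by_contra h
    apply hμ
    have : sdimOf P H μ = 0 := by
      rw [b.sdimOf_eq_sum]
      refine Finset.sum_eq_zero fun i _ => if_neg ?_
      rintro rfl
      exact h (by simp)
    simp [this]

theorem iSup_gr (b : WeightBasis P H ι) : ⨆ χ, gr P H χ = ⊤ := by
  rw [eq_top_iff, ← b.basis.span_eq, Submodule.span_le]
  rintro _ ⟨i, rfl⟩
  exact Submodule.mem_iSup_of_mem _ (b.mem i)

theorem iSup_wtOf (b : WeightBasis P H ι) : ⨆ μ, wtOf H μ = ⊤ := by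
  rw [eq_top_iff, ← b.iSup_gr, iSup_le_iff]
  intro χ
  exact inf_le_left.trans (le_iSup _ _)

/-- The projections to the homogeneous parts. -/
theorem exists_proj (b : WeightBasis P H ι) (χ : (Fin n → ℤ) × ℤˣ) : ∃ p : Module.End ℂ V,
    (∀ v ∈ gr P H χ, p v = v) ∧ ∀ ψ ≠ χ, ∀ v ∈ gr P H ψ, p v = 0 := by
  classical
  let p : Module.End ℂ V :=
    b.basis.constr ℂ fun i => if (b.wt i, b.sg i) = χ then b.basis i else 0
  refine ⟨p, fun v hv => ?_, fun ψ hψ v hv => ?_⟩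
  · rw [b.gr_eq_span] at hv
    refine LinearMap.eqOn_span (f := p) (g := LinearMap.id) ?_ hv
    rintro _ ⟨i, hi, rfl⟩
    simp only [Set.mem_ofPred_eq] at hi
    simp [p, hi]
  · rw [b.gr_eq_span] at hv
    refine LinearMap.eqOn_span (f := p) (g := 0) ?_ hv
    rintro _ ⟨i, hi, rfl⟩
    simp only [Set.mem_ofPred_eq] at hi
    simp [p, hi, hψ]

end WeightBasis

theorem exists_weightBasis_of_span [FiniteDimensional ℂ V] {P : Module.End ℂ V}
    {H : (Fin n → ℂ) → Module.End ℂ V} (h : ⨆ χ, gr P H χ = ⊤) :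
    ∃ (ι : Type) (_ : Fintype ι), Nonempty (WeightBasis P H ι) := by
  have hs : ⊤ ≤ Submodule.span ℂ (⋃ χ, (gr P H χ : Set V)) := by
    rw [← h, Submodule.iSup_eq_span]
  let b := Module.Basis.ofSpan hs
  have hb : ∀ i, ∃ χ, b i ∈ gr P H χ := fun i => by
    exact Set.mem_iUnion.mp (Module.Basis.ofSpan_subset hs ⟨i, rfl⟩)
  choose χ hχ using hb
  exact ⟨_, FiniteDimensional.fintypeBasisIndex b, ⟨⟨b, fun i => (χ i).1, fun i => (χ i).2, hχ⟩⟩⟩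

/-- An involution preserving the weight spaces splits each of them into its even and odd parts. -/
theorem iSup_gr_eq_top {P : Module.End ℂ V} {H : (Fin n → ℂ) → Module.End ℂ V}
    (hP : P * P = 1) (hPH : ∀ h, P * H h = H h * P) (h : ⨆ μ, wtOf H μ = ⊤) :
    ⨆ χ, gr P H χ = ⊤ := by
  rw [eq_top_iff, ← h, iSup_le_iff]
  intro μ v hv
  rw [mem_wtOf] at hv
  have hPP : P (P v) = v := LinearMap.congr_fun hP v
  have hPv : ∀ h, H h (P v) = (∑ i, h i * (μ i : ℂ)) • P v := fun h => by
    have := LinearMap.congr_fun (hPH h) v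
    simp only [Module.End.mul_apply] at this
    rw [← this, hv, map_smul]
  have e : v = (2⁻¹ : ℂ) • (v + P v) + (2⁻¹ : ℂ) • (v - P v) := by
    module
  rw [e]
  refine Submodule.add_mem _
    (Submodule.smul_mem _ _ (Submodule.mem_iSup_of_mem (μ, 1) (mem_gr.mpr ⟨fun h => ?_, ?_⟩)))
    (Submodule.smul_mem _ _ (Submodule.mem_iSup_of_mem (μ, -1) (mem_gr.mpr ⟨fun h => ?_, ?_⟩)))
  · rw [map_add, hv, hPv, smul_add]
  · simp [hPP, add_comm]
  · rw [map_sub, hv, hPv, smul_sub]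
  · simp [hPP]

theorem exists_weightBasis [FiniteDimensional ℂ V] {P : Module.End ℂ V}
    {H : (Fin n → ℂ) → Module.End ℂ V} (hP : P * P = 1) (hPH : ∀ h, P * H h = H h * P)
    (h : ⨆ μ, wtOf H μ = ⊤) :
    ∃ (ι : Type) (_ : Fintype ι), Nonempty (WeightBasis P H ι) :=
  exists_weightBasis_of_span (iSup_gr_eq_top hP hPH h)

theorem ext_of_gr {V' : Type} [AddCommGroup V'] [Module ℂ V'] {P : Module.End ℂ V}
    {H : (Fin n → ℂ) → Module.End ℂ V} {ι : Type} (b : WeightBasis P H ι) {f g : V →ₗ[ℂ] V'}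
    (h : ∀ χ, ∀ v ∈ gr P H χ, f v = g v) : f = g :=
  b.basis.ext fun i => h _ _ (b.mem i)

end Weights

/-! ### Supercharacters and the homology of an odd operator of square zero -/

section Homology

variable {n : ℕ} {V : Type} [AddCommGroup V] [Module ℂ V] {P : Module.End ℂ V}
  {H : (Fin n → ℂ) → Module.End ℂ V} {ι : Type}

theorem mem_gr_of_odd {x : Module.End ℂ V} (hxH : ∀ h, x * H h = H h * x) (hxP : P * x = -(x * P))
    {χ : (Fin n → ℤ) × ℤˣ} {v : V} (hv : v ∈ gr P H χ) : x v ∈ gr P H (χ.1, -χ.2) := by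
  rw [mem_gr] at hv ⊢
  refine ⟨fun h => ?_, ?_⟩
  · have := LinearMap.congr_fun (hxH h) v
    simp only [Module.End.mul_apply] at this
    rw [← this, hv.1, map_smul]
  · have := LinearMap.congr_fun hxP v
    simp only [Module.End.mul_apply, LinearMap.neg_apply] at this
    rw [this, hv.2, map_smul]
    simp

/-- The projections to the homogeneous parts are compatible with an odd operator, and finitely many
of them add up to the identity. -/
theorem exists_proj_odd [Fintype ι] (b : WeightBasis P H ι) {x : Module.End ℂ V}
    (hxH : ∀ h, x * H h = H h * x) (hxP : P * x = -(x * P)) :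
    ∃ p : (Fin n → ℤ) × ℤˣ → Module.End ℂ V,
      (∀ χ v, p χ v ∈ gr P H χ) ∧ (∀ χ, ∀ v ∈ gr P H χ, p χ v = v) ∧
      (∀ χ v, p (χ.1, -χ.2) (x v) = x (p χ v)) ∧
      ∃ s : Finset ((Fin n → ℤ) × ℤˣ), (∀ v, ∑ χ ∈ s, p χ v = v) ∧ ∀ χ ∉ s, p χ = 0 := by
  classical
  choose p hp1 hp2 using b.exists_proj
  have hp : ∀ χ v, p χ v ∈ gr P H χ := by
    intro χ v
    have : v ∈ (⨆ χ, gr P H χ) := b.iSup_gr ▸ Submodule.mem_top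
    refine Submodule.iSup_induction _ (motive := fun v => p χ v ∈ gr P H χ) this ?_ ?_ ?_
    · intro ψ w hw
      by_cases h : ψ = χ
      · subst h; rw [hp1 _ _ hw]; exact hw
      · rw [hp2 _ _ h _ hw]; exact zero_mem _
    · simp
    · intro a b ha hb
      rw [map_add]; exact add_mem ha hb
  refine ⟨p, hp, hp1, fun χ v => ?_, Finset.univ.image fun i => (b.wt i, b.sg i), fun v => ?_,
    fun χ hχ => ?_⟩
  · have : (p (χ.1, -χ.2)) ∘ₗ x = x ∘ₗ p χ := by
      refine ext_of_gr b fun ψ w hw => ?_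
      have hw' := mem_gr_of_odd hxH hxP hw
      by_cases h : ψ = χ
      · subst h
        simp [hp1 _ _ hw, hp1 _ _ hw']
      · have h' : (ψ.1, -ψ.2) ≠ (χ.1, -χ.2) := by
          intro e
          simp only [Prod.mk.injEq, neg_inj] at e
          exact h (Prod.ext e.1 e.2)
        simp [hp2 _ _ h _ hw, hp2 _ _ h' _ hw']
    exact LinearMap.congr_fun this v
  · have : (∑ χ ∈ Finset.univ.image (fun i => (b.wt i, b.sg i)), p χ) = LinearMap.id := by
      refine b.basis.ext fun i => ?_
      rw [LinearMap.sum_apply, Finset.sum_eq_single (b.wt i, b.sg i)]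
      · exact hp1 _ _ (b.mem i)
      · exact fun χ _ h => hp2 _ _ h.symm _ (b.mem i)
      · exact fun h => absurd (Finset.mem_image_of_mem _ (Finset.mem_univ i)) h
    simpa using LinearMap.congr_fun this v
  · refine b.basis.ext fun i => hp2 _ _ ?_ _ (b.mem i)
    rintro rfl
    exact hχ (Finset.mem_image_of_mem _ (Finset.mem_univ i))

/-- Rank-nullity for an odd operator, in one homogeneous part. -/
theorem finrank_gr_ker_range [FiniteDimensional ℂ V] [Fintype ι] (b : WeightBasis P H ι)
    {x : Module.End ℂ V} (hxH : ∀ h, x * H h = H h * x) (hxP : P * x = -(x * P))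
    (χ : (Fin n → ℤ) × ℤˣ) :
    Module.finrank ℂ (gr P H χ) = Module.finrank ℂ ↥(gr P H χ ⊓ LinearMap.ker x) +
      Module.finrank ℂ ↥(gr P H (χ.1, -χ.2) ⊓ LinearMap.range x) := by
  obtain ⟨p, hp, hp1, hpx, -⟩ := exists_proj_odd b hxH hxP
  have hr : Submodule.map x (gr P H χ) = gr P H (χ.1, -χ.2) ⊓ LinearMap.range x := by
    apply le_antisymm
    · rintro _ ⟨v, hv, rfl⟩
      exact ⟨mem_gr_of_odd hxH hxP hv, v, rfl⟩
    · rintro _ ⟨hv, v, rfl⟩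
      exact ⟨p χ v, hp χ v, by rw [← hpx, hp1 _ _ hv]⟩
  have h := LinearMap.finrank_range_add_finrank_ker (x.domRestrict (gr P H χ))
  rw [LinearMap.range_domRestrict, hr, LinearMap.ker_domRestrict] at h
  have e : Module.finrank ℂ ↥(Submodule.comap (gr P H χ).subtype (LinearMap.ker x)) =
      Module.finrank ℂ ↥(gr P H χ ⊓ LinearMap.ker x) := by
    rw [← Submodule.map_comap_subtype]
    exact (Submodule.equivMapOfInjective _ (Submodule.injective_subtype _) _).finrank_eq
  rw [e] at h
  omega

/-- If the homology of the odd operator `x` vanishes in weight `μ`, then so does the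
superdimension. -/
theorem sdimOf_eq_zero_of_acyclic [FiniteDimensional ℂ V] [Fintype ι] (b : WeightBasis P H ι)
    {x : Module.End ℂ V} (hxH : ∀ h, x * H h = H h * x) (hxP : P * x = -(x * P))
    (hxx : x * x = 0) (μ : Fin n → ℤ)
    (hac : ∀ v ∈ wtOf H μ, x v = 0 → v ∈ LinearMap.range x) : sdimOf P H μ = 0 := by
  have hk : ∀ ε : ℤˣ, gr P H (μ, ε) ⊓ LinearMap.ker x = gr P H (μ, ε) ⊓ LinearMap.range x := by
    intro ε
    ext v
    simp only [Submodule.mem_inf, LinearMap.mem_ker]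
    refine and_congr_right fun hv => ⟨fun h => hac v hv.1 h, ?_⟩
    rintro ⟨w, rfl⟩
    exact LinearMap.congr_fun hxx w
  have h1 := finrank_gr_ker_range b hxH hxP (μ, 1)
  have h2 := finrank_gr_ker_range b hxH hxP (μ, -1)
  rw [hk] at h1 h2
  dsimp only at h1 h2
  rw [neg_neg] at h2
  rw [sdimOf_eq]
  omega

/-- Passing to the homology of an odd operator of square zero, commuting with the torus, does not
change superdimensions of weight spaces. The homology is given as a quotient `q` of the kernel. -/
theorem sdimOf_homology [FiniteDimensional ℂ V] [Fintype ι] (b : WeightBasis P H ι)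
    {x : Module.End ℂ V} (hxH : ∀ h, x * H h = H h * x) (hxP : P * x = -(x * P))
    (hxx : x * x = 0)
    {U : Type} [AddCommGroup U] [Module ℂ U] {P' : Module.End ℂ U}
    {H' : (Fin n → ℂ) → Module.End ℂ U} (q : ↥(LinearMap.ker x) →ₗ[ℂ] U)
    (hq : Function.Surjective q)
    (hqk : ∀ v, q v = 0 ↔ (v : V) ∈ LinearMap.range x)
    (hqg : ∀ χ (v : LinearMap.ker x), (v : V) ∈ gr P H χ → q v ∈ gr P' H' χ) :
    (∃ (κ : Type) (_ : Fintype κ), Nonempty (WeightBasis P' H' κ)) ∧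
      ∀ μ, sdimOf P H μ = sdimOf P' H' μ := by
  classical
  have : FiniteDimensional ℂ U := Module.Finite.of_surjective q hq
  obtain ⟨p, hp, hp1, hpx, s, hs, hs'⟩ := exists_proj_odd b hxH hxP
  have hker : ∀ χ, ∀ v ∈ LinearMap.ker x, p χ v ∈ LinearMap.ker x := fun χ v hv => by
    rw [LinearMap.mem_ker, ← hpx, LinearMap.mem_ker.mp hv, map_zero]
  let r : (Fin n → ℤ) × ℤˣ → Module.End ℂ (LinearMap.ker x) := fun χ => (p χ).restrict (hker χ)
  have hr : ∀ v, ∑ χ ∈ s, r χ v = v := fun v => Subtype.ext (by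
    rw [Submodule.coe_sum]; exact hs (v : V))
  have hrg : ∀ χ v, q (r χ v) ∈ gr P' H' χ := fun χ v => hqg χ _ (hp χ v)
  have hb' : ∃ (κ : Type) (_ : Fintype κ), Nonempty (WeightBasis P' H' κ) := by
    apply exists_weightBasis_of_span
    rw [eq_top_iff]
    rintro u -
    obtain ⟨v, rfl⟩ := hq u
    rw [← hr v, map_sum]
    exact Submodule.sum_mem _ fun χ _ => Submodule.mem_iSup_of_mem χ (hrg χ v)
  refine ⟨hb', fun μ => ?_⟩
  obtain ⟨κ, _, ⟨b'⟩⟩ := hb'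
  have key : ∀ χ, Module.finrank ℂ ↥(gr P H χ ⊓ LinearMap.ker x) =
      Module.finrank ℂ ↥(gr P H χ ⊓ LinearMap.range x) + Module.finrank ℂ ↥(gr P' H' χ) := by
    intro χ
    let S : Submodule ℂ (LinearMap.ker x) := Submodule.comap (LinearMap.ker x).subtype (gr P H χ)
    have hS : Submodule.map q S = gr P' H' χ := by
      apply le_antisymm
      · rintro _ ⟨v, hv, rfl⟩
        exact hqg χ v hv
      · intro u hu
        obtain ⟨v, rfl⟩ := hq u
        obtain ⟨p', hp1', hp2'⟩ := b'.exists_proj χ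
        -- the class of the `χ`-component of `v` is the `χ`-component of the class of `v`
        refine ⟨r χ v, hp χ v, ?_⟩
        have e : p' (q v) = ∑ ψ ∈ s, p' (q (r ψ v)) := by
          conv_lhs => rw [← hr v, map_sum, map_sum]
        rw [hp1' _ hu] at e
        rw [e]
        by_cases hχ : χ ∈ s
        · rw [Finset.sum_eq_single χ]
          · exact (hp1' _ (hrg χ v)).symm
          · exact fun ψ _ h => hp2' ψ h _ (hrg ψ v)
          · exact fun h => absurd hχ h
        · rw [Finset.sum_eq_zero]
          · have : r χ v = 0 := Subtype.ext (by
              change p χ v = 0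
              rw [hs' χ hχ, LinearMap.zero_apply])
            rw [this, map_zero]
          · intro ψ hψ
            exact hp2' ψ (fun h => hχ (h ▸ hψ)) _ (hrg ψ v)
    have h := LinearMap.finrank_range_add_finrank_ker (q.domRestrict S)
    rw [LinearMap.range_domRestrict, hS] at h
    have e1 : Module.finrank ℂ S = Module.finrank ℂ ↥(gr P H χ ⊓ LinearMap.ker x) := by
      rw [inf_comm, ← Submodule.map_comap_subtype]
      exact (Submodule.equivMapOfInjective _ (Submodule.injective_subtype _) _).finrank_eq
    have e2 : Module.finrank ℂ (LinearMap.ker (q.domRestrict S)) =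
        Module.finrank ℂ ↥(gr P H χ ⊓ LinearMap.range x) := by
      let f : LinearMap.ker (q.domRestrict S) →ₗ[ℂ] V :=
        (LinearMap.ker x).subtype ∘ₗ S.subtype ∘ₗ (LinearMap.ker (q.domRestrict S)).subtype
      have hf : Function.Injective f := (Submodule.injective_subtype _).comp
        ((Submodule.injective_subtype _).comp (Submodule.injective_subtype _))
      rw [← LinearMap.finrank_range_of_inj hf]
      suffices e : LinearMap.range f = gr P H χ ⊓ LinearMap.range x by rw [e]
      ext v
      constructor
      · rintro ⟨⟨⟨w, hw⟩, hw'⟩, rfl⟩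
        exact ⟨hw, (hqk w).mp hw'⟩
      · rintro ⟨hv, hv'⟩
        have hvk : v ∈ LinearMap.ker x := by
          obtain ⟨w, rfl⟩ := hv'
          exact LinearMap.congr_fun hxx w
        exact ⟨⟨⟨⟨v, hvk⟩, hv⟩, (hqk ⟨v, hvk⟩).mpr hv'⟩, rfl⟩
    rw [← e1, ← h, e2, add_comm]
  have h1 := finrank_gr_ker_range b hxH hxP (μ, 1)
  have h2 := finrank_gr_ker_range b hxH hxP (μ, -1)
  rw [key] at h1 h2
  dsimp only at h1 h2
  rw [neg_neg] at h2
  rw [sdimOf_eq, sdimOf_eq]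
  omega

end Homology

/-! ### Operators on `Λ(W) ⊗ V` -/

section Fock

variable {W V : Type} [AddCommGroup W] [Module ℂ W] [AddCommGroup V] [Module ℂ V]

/-- The space `Λ(W) ⊗ V`. It is a definition of its own, rather than an abbreviation, so that
operators on it do not see the tensor product. -/
def Fock (W V : Type) [AddCommGroup W] [Module ℂ W] [AddCommGroup V] [Module ℂ V] : Type :=
  ExteriorAlgebra ℂ W ⊗[ℂ] V

instance : AddCommGroup (Fock W V) := inferInstanceAs (AddCommGroup (ExteriorAlgebra ℂ W ⊗[ℂ] V))

instance : Module ℂ (Fock W V) := inferInstanceAs (Module ℂ (ExteriorAlgebra ℂ W ⊗[ℂ] V))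

/-- The pure tensors of `Λ(W) ⊗ V`. -/
def Fock.tmul : ExteriorAlgebra ℂ W →ₗ[ℂ] V →ₗ[ℂ] Fock W V :=
  TensorProduct.mk ℂ (ExteriorAlgebra ℂ W) V

theorem Fock.induction {p : Fock W V → Prop} (h0 : p 0) (ht : ∀ ω v, p (Fock.tmul ω v))
    (ha : ∀ a b, p a → p b → p (a + b)) (m : Fock W V) : p m :=
  TensorProduct.induction_on (motive := p) m h0 ht ha

/-- The vector `1 ⊗ v`. -/
def vac (W : Type) {V : Type} [AddCommGroup W] [Module ℂ W] [AddCommGroup V] [Module ℂ V] :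
    V →ₗ[ℂ] Fock W V :=
  Fock.tmul 1

/-- Exterior multiplication by `c ∈ W`. -/
def creat (V : Type) {W : Type} [AddCommGroup W] [Module ℂ W] [AddCommGroup V] [Module ℂ V] :
    W →ₗ[ℂ] Module.End ℂ (Fock W V) :=
  LinearMap.rTensorHom V ∘ₗ LinearMap.mul ℂ (ExteriorAlgebra ℂ W) ∘ₗ ExteriorAlgebra.ι ℂ

@[simp]
theorem creat_tmul (c : W) (ω : ExteriorAlgebra ℂ W) (v : V) :
    creat V c (Fock.tmul ω v) = Fock.tmul (ExteriorAlgebra.ι ℂ c * ω) v := rfl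

theorem creat_creat (c : W) (m : Fock W V) : creat V c (creat V c m) = 0 := by
  induction m using Fock.induction with
  | h0 => simp
  | ht ω v => simp [← mul_assoc]
  | ha a b ha hb => rw [map_add, map_add, ha, hb, add_zero]

theorem creat_anticomm (c d : W) (m : Fock W V) :
    creat V c (creat V d m) = -creat V d (creat V c m) := by
  have h := creat_creat (c + d) m
  simp only [map_add, LinearMap.add_apply, creat_creat] at h
  rw [zero_add, add_zero] at h
  rw [eq_neg_iff_add_eq_zero, ← h, add_comm]

/-- `Λ(W) ⊗ V` is generated by `1 ⊗ V` under exterior multiplication. -/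
theorem fock_eq_top {S : Submodule ℂ (Fock W V)} (h0 : ∀ v, vac W v ∈ S)
    (hS : ∀ c, ∀ m ∈ S, creat V c m ∈ S) : S = ⊤ := by
  rw [eq_top_iff]
  rintro m -
  induction m using Fock.induction with
  | h0 => exact zero_mem _
  | ha a b ha hb => exact add_mem ha hb
  | ht ω v =>
    induction ω using CliffordAlgebra.left_induction with
    | algebraMap r =>
      rw [Algebra.algebraMap_eq_smul_one, map_smul]
      exact S.smul_mem r (h0 v)
    | add x y hx hy => rw [map_add]; exact add_mem hx hy
    | ι_mul x c hx => exact hS c _ hx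

theorem fock_hom_ext {N : Type} [AddCommGroup N] [Module ℂ N] {F G : Fock W V →ₗ[ℂ] N}
    (h0 : ∀ v, F (vac W v) = G (vac W v))
    (h : ∀ c m, F m = G m → F (creat V c m) = G (creat V c m)) : F = G := by
  have : LinearMap.eqLocus F G = ⊤ := fock_eq_top h0 h
  exact LinearMap.ext fun m => (this ▸ Submodule.mem_top : m ∈ LinearMap.eqLocus F G)

/-- The universal property of `Λ(W) ⊗ V`: a map is prescribed by its values on `1 ⊗ V` and by the
operators of square zero to which it takes the exterior multiplications. -/
theorem exists_fock_hom {N : Type} [AddCommGroup N] [Module ℂ N] (f : W →ₗ[ℂ] Module.End ℂ N)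
    (hf : ∀ c, f c * f c = 0) (g : V →ₗ[ℂ] N) :
    ∃ F : Fock W V →ₗ[ℂ] N, (∀ v, F (vac W v) = g v) ∧
      ∀ c m, F (creat V c m) = f c (F m) := by
  let φ := ExteriorAlgebra.lift ℂ ⟨f, hf⟩
  let F : Fock W V →ₗ[ℂ] N := TensorProduct.lift ((LinearMap.lcomp ℂ N g) ∘ₗ φ.toLinearMap)
  have hF : ∀ ω v, F (Fock.tmul ω v) = φ ω (g v) := fun ω v => TensorProduct.lift.tmul _ _
  refine ⟨F, fun v => ?_, fun c m => ?_⟩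
  · rw [vac, hF, map_one]; rfl
  · induction m using Fock.induction with
    | h0 => simp
    | ha a b ha hb => simp only [map_add, ha, hb]
    | ht ω v => rw [creat_tmul, hF, hF, map_mul, ExteriorAlgebra.lift_ι_apply]; rfl

/-- An operator `T` on `Λ(W) ⊗ V` may be prescribed on `1 ⊗ V` together with its commutator
(`s = 1`) or anticommutator (`s = -1`) with all exterior multiplications. -/
theorem exists_fock_op (s : ℂ) (D : W →ₗ[ℂ] Module.End ℂ (Fock W V))
    (hD : ∀ c m, s • creat V c (D c m) + D c (creat V c m) = 0) (T₀ : V →ₗ[ℂ] Fock W V) :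
    ∃ T : Module.End ℂ (Fock W V), (∀ v, T (vac W v) = T₀ v) ∧
      ∀ c m, T (creat V c m) = s • creat V c (T m) + D c m := by
  -- the recursion is run on pairs `(m, T m)`
  let f : W →ₗ[ℂ] Module.End ℂ (Fock W V × Fock W V) :=
    { toFun := fun c => (creat V c ∘ₗ LinearMap.fst ℂ _ _).prod
        (s • (creat V c ∘ₗ LinearMap.snd ℂ _ _) + D c ∘ₗ LinearMap.fst ℂ _ _)
      map_add' := fun c d => by
        refine LinearMap.ext fun p => Prod.ext ?_ ?_
        · simp
        · change s • creat V (c + d) p.2 + D (c + d) p.1 =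
            (s • creat V c p.2 + D c p.1) + (s • creat V d p.2 + D d p.1)
          simp only [map_add, LinearMap.add_apply, smul_add]
          abel
      map_smul' := fun r c => by
        refine LinearMap.ext fun p => Prod.ext ?_ ?_
        · simp
        · change s • creat V (r • c) p.2 + D (r • c) p.1 =
            r • (s • creat V c p.2 + D c p.1)
          simp only [map_smul, LinearMap.smul_apply, smul_add, smul_comm r s] }
  have hf1 : ∀ c p, (f c p).1 = creat V c p.1 := fun _ _ => rfl
  have hf2 : ∀ c p, (f c p).2 = s • creat V c p.2 + D c p.1 := fun _ _ => rfl
  have hff : ∀ c, f c * f c = 0 := fun c => by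
    refine LinearMap.ext fun p => Prod.ext ?_ ?_
    · rw [Module.End.mul_apply, hf1, hf1, creat_creat]; rfl
    · rw [Module.End.mul_apply, hf2, hf2, hf1, map_add, map_smul, creat_creat, smul_zero,
        zero_add, hD]
      rfl
  obtain ⟨F, hF0, hF⟩ := exists_fock_hom f hff ((vac W).prod T₀)
  have h1 : (LinearMap.fst ℂ _ _) ∘ₗ F = LinearMap.id := by
    refine fock_hom_ext (fun v => ?_) fun c m hm => ?_
    · simp [hF0]
    · simp only [LinearMap.comp_apply, LinearMap.fst_apply, LinearMap.id_apply] at hm ⊢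
      rw [hF, hf1, hm]
  refine ⟨(LinearMap.snd ℂ _ _) ∘ₗ F, fun v => by simp [hF0], fun c m => ?_⟩
  have hm : (F m).1 = m := LinearMap.congr_fun h1 m
  simp only [LinearMap.comp_apply, LinearMap.snd_apply]
  rw [hF, hf2, hm]

theorem exists_fockParity (W V : Type) [AddCommGroup W] [Module ℂ W] [AddCommGroup V]
    [Module ℂ V] : ∃ T : Module.End ℂ (Fock W V), (∀ v, T (vac W v) = vac W v) ∧
      ∀ c m, T (creat V c m) = -creat V c (T m) := by
  obtain ⟨T, h0, h⟩ := exists_fock_op (-1) 0 (by simp) (vac (V := V) W)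
  exact ⟨T, h0, fun c m => (h c m).trans (by
    rw [LinearMap.zero_apply, LinearMap.zero_apply, add_zero]
    exact neg_one_smul ℂ (creat V c (T m)))⟩

/-- The parity involution on `Λ(W) ⊗ V`, with `V` in even degree. -/
def fockParity (W V : Type) [AddCommGroup W] [Module ℂ W] [AddCommGroup V] [Module ℂ V] :
    Module.End ℂ (Fock W V) :=
  (exists_fockParity W V).choose

theorem fockParity_vac (v : V) : fockParity W V (vac W v) = vac W v :=
  (exists_fockParity W V).choose_spec.1 v

theorem fockParity_creat (c : W) (m : Fock W V) :
    fockParity W V (creat V c m) = -creat V c (fockParity W V m) :=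
  (exists_fockParity W V).choose_spec.2 c m

theorem fockParity_sq : fockParity W V * fockParity W V = 1 :=
  fock_hom_ext (fun v => by simp [fockParity_vac]) fun c m hm => by
    simp only [Module.End.mul_apply, Module.End.one_apply] at hm ⊢
    rw [fockParity_creat, map_neg, fockParity_creat, hm, neg_neg]

end Fock

/-- The `gl(n)`-module `V` with its torus action. -/
abbrev GLRep.torus {n : ℕ} (V : GLRep n) (h : Fin n → ℂ) : Module.End ℂ V.carrier :=
  V.act (Matrix.diagonal h)

section FockGL

variable {n : ℕ} (U V : GLRep n)

theorem exists_fockAct (A : Matrix (Fin n) (Fin n) ℂ) :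
    ∃ T : Module.End ℂ (Fock U.carrier V.carrier),
      (∀ v, T (vac _ v) = vac _ (V.act A v)) ∧
      ∀ c m, T (creat _ c m) = creat _ c (T m) + creat _ (U.act A c) m := by
  obtain ⟨T, h0, h⟩ := exists_fock_op 1 (creat V.carrier ∘ₗ U.act A)
    (fun c m => by
      rw [one_smul, LinearMap.comp_apply, creat_anticomm c, neg_add_cancel])
    (vac U.carrier ∘ₗ V.act A)
  exact ⟨T, h0, fun c m => by rw [h, one_smul]; rfl⟩

/-- The action of `gl(n)` on `Λ(U) ⊗ V`, by derivations on the first factor. -/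
def fockAct : Matrix (Fin n) (Fin n) ℂ →ₗ[ℂ] Module.End ℂ (Fock U.carrier V.carrier) where
  toFun A := (exists_fockAct U V A).choose
  map_add' A B := by
    refine fock_hom_ext (fun v => ?_) fun c m hm => ?_
    · rw [LinearMap.add_apply, (exists_fockAct U V _).choose_spec.1,
        (exists_fockAct U V _).choose_spec.1, (exists_fockAct U V _).choose_spec.1]
      simp
    · rw [LinearMap.add_apply] at hm ⊢
      rw [(exists_fockAct U V _).choose_spec.2, (exists_fockAct U V _).choose_spec.2,
        (exists_fockAct U V _).choose_spec.2, hm]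
      simp only [map_add, LinearMap.add_apply]
      abel
  map_smul' r A := by
    refine fock_hom_ext (fun v => ?_) fun c m hm => ?_
    · rw [LinearMap.smul_apply, (exists_fockAct U V _).choose_spec.1,
        (exists_fockAct U V _).choose_spec.1]
      simp
    · rw [LinearMap.smul_apply] at hm ⊢
      rw [(exists_fockAct U V _).choose_spec.2, (exists_fockAct U V _).choose_spec.2, hm]
      simp

theorem fockAct_vac (A : Matrix (Fin n) (Fin n) ℂ) (v : V.carrier) :
    fockAct U V A (vac _ v) = vac _ (V.act A v) :=
  (exists_fockAct U V A).choose_spec.1 v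

theorem fockAct_creat (A : Matrix (Fin n) (Fin n) ℂ) (c : U.carrier)
    (m : Fock U.carrier V.carrier) :
    fockAct U V A (creat _ c m) = creat _ c (fockAct U V A m) + creat _ (U.act A c) m :=
  (exists_fockAct U V A).choose_spec.2 c m

/-- The `gl(n)`-module `Λ(U) ⊗ V`. -/
def fockRep : GLRep n where
  carrier := Fock U.carrier V.carrier
  act := fockAct U V
  act_lie X Y := by
    refine fock_hom_ext (fun v => ?_) fun c m hm => ?_
    · rw [fockAct_vac, V.act_lie]
      simp only [LinearMap.sub_apply, Module.End.mul_apply, fockAct_vac, map_sub]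
    · rw [fockAct_creat, hm, U.act_lie]
      simp only [LinearMap.sub_apply, Module.End.mul_apply, fockAct_creat, map_sub, map_add]
      abel

theorem fockParity_fockAct (A : Matrix (Fin n) (Fin n) ℂ) :
    fockParity U.carrier V.carrier * fockAct U V A =
      fockAct U V A * fockParity U.carrier V.carrier :=
  fock_hom_ext (fun v => by simp [fockAct_vac, fockParity_vac]) fun c m hm => by
    simp only [Module.End.mul_apply, fockAct_creat, fockParity_creat, map_add, map_neg] at hm ⊢
    rw [hm]
    abel

variable {U V}

/-- The weight and the parity of a product of weight vectors in `Λ(U) ⊗ V`. -/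
theorem fock_list_mem {I : Type} (b : I → U.carrier) (β : I → Fin n → ℤ)
    (hb : ∀ i, b i ∈ wtOf U.torus (β i)) {v : V.carrier} {μ : Fin n → ℤ}
    (hv : v ∈ wtOf V.torus μ) (l : List I) :
    Fock.tmul (l.map fun i => ExteriorAlgebra.ι ℂ (b i)).prod v ∈
      gr (fockParity U.carrier V.carrier) (fun h => fockAct U V (Matrix.diagonal h))
        ((l.map β).sum + μ, (-1) ^ l.length) := by
  rw [mem_gr]
  rw [mem_wtOf] at hv
  induction l with
  | nil =>
    have e : Fock.tmul (1 : ExteriorAlgebra ℂ U.carrier) v = vac U.carrier v := rfl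
    refine ⟨fun h => ?_, ?_⟩
    · simp only [List.map_nil, List.prod_nil, List.sum_nil, zero_add]
      rw [e, fockAct_vac, hv h, map_smul]
    · simp only [List.map_nil, List.prod_nil]
      rw [e, fockParity_vac]
      simp
  | cons i l ih =>
    have e : Fock.tmul ((i :: l).map fun i => ExteriorAlgebra.ι ℂ (b i)).prod v =
        creat _ (b i) (Fock.tmul (l.map fun i => ExteriorAlgebra.ι ℂ (b i)).prod v) := by simp
    refine ⟨fun h => ?_, ?_⟩
    · rw [e]
      have h1 := ih.1 h
      have h2 := mem_wtOf.mp (hb i) h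
      rw [fockAct_creat, h1, h2, map_smul, map_smul, LinearMap.smul_apply, ← add_smul]
      congr 1
      simp only [List.map_cons, List.sum_cons, Pi.add_apply]
      rw [← Finset.sum_add_distrib]
      refine Finset.sum_congr rfl fun j _ => ?_
      push_cast
      ring
    · rw [e, fockParity_creat, ih.2, map_smul]
      simp [pow_succ]

/-- Bases of weight vectors of `U` and `V` give one of `Λ(U) ⊗ V`. -/
theorem exists_fock_weightBasis {I J : Type} [LinearOrder I]
    (b : Module.Basis I ℂ U.carrier) (β : I → Fin n → ℤ) (hb : ∀ i, b i ∈ wtOf U.torus (β i))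
    (c : Module.Basis J ℂ V.carrier) (μ : J → Fin n → ℤ) (hc : ∀ j, c j ∈ wtOf V.torus (μ j)) :
    ∃ B : WeightBasis (fockParity U.carrier V.carrier)
        (fun h => fockAct U V (Matrix.diagonal h)) (Finset I × J),
      ∀ S j, B.wt (S, j) = ∑ i ∈ S, β i + μ j ∧ B.sg (S, j) = (-1) ^ S.card := by
  refine ⟨⟨(b.ExteriorAlgebra.tensorProduct c :), fun p => ∑ i ∈ p.1, β i + μ p.2,
    fun p => (-1) ^ p.1.card, ?_⟩, fun S j => ⟨rfl, rfl⟩⟩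
  rintro ⟨S, j⟩
  have h := fock_list_mem b β hb (hc j) (List.ofFn (S.orderEmbOfFin rfl))
  rw [List.map_ofFn, List.map_ofFn, List.length_ofFn, List.sum_ofFn] at h
  have e1 : ∑ i, (β ∘ S.orderEmbOfFin rfl) i = ∑ i ∈ S, β i := by
    rw [← Finset.sum_coe_sort S, ← (S.orderIsoOfFin rfl).toEquiv.sum_comp]
    rfl
  rw [e1] at h
  have e2 : b.ExteriorAlgebra.tensorProduct c (S, j) =
      (Fock.tmul (b.ExteriorAlgebra S) (c j) : Fock U.carrier V.carrier) :=
    Module.Basis.tensorProduct_apply _ _ _ _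
  rw [ExteriorAlgebra.basis_apply] at e2
  -- `Fock` is unfolded here, which `rw` does not do
  erw [e2]
  exact h

end FockGL

/-! ### The explicit model `Λ(g₋₁) ⊗ V` of the induced module -/

section Kac

variable {n : ℕ}

/-- The symmetric matrices, i.e. the underlying space of `g₁`. -/
def symMat (n : ℕ) : Submodule ℂ (Matrix (Fin n) (Fin n) ℂ) where
  carrier := {B | B.transpose = B}
  add_mem' := by
    intro a b (ha : _ = _) (hb : _ = _)
    change (a + b).transpose = _
    rw [Matrix.transpose_add, ha, hb]
  zero_mem' := Matrix.transpose_zero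
  smul_mem' := by
    intro r a (ha : _ = _)
    change (r • a).transpose = _
    rw [Matrix.transpose_smul, ha]

/-- The antisymmetric matrices, i.e. the underlying space of `g₋₁`. -/
def skewMat (n : ℕ) : Submodule ℂ (Matrix (Fin n) (Fin n) ℂ) where
  carrier := {C | C.transpose = -C}
  add_mem' := by
    intro a b (ha : _ = _) (hb : _ = _)
    change (a + b).transpose = _
    rw [Matrix.transpose_add, ha, hb, neg_add]
  zero_mem' := by
    change Matrix.transpose 0 = _
    rw [Matrix.transpose_zero, neg_zero]
  smul_mem' := by
    intro r a (ha : _ = _)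
    change (r • a).transpose = _
    rw [Matrix.transpose_smul, ha, smul_neg]

theorem symMat_transpose (B : symMat n) : (B : Matrix (Fin n) (Fin n) ℂ).transpose = B := B.2

theorem skewMat_transpose (C : skewMat n) : (C : Matrix (Fin n) (Fin n) ℂ).transpose = -C := C.2

/-- The action of `gl(n)` on `g₋₁`. -/
def skewAct (n : ℕ) : Matrix (Fin n) (Fin n) ℂ →ₗ[ℂ] Module.End ℂ (skewMat n) where
  toFun A :=
    { toFun := fun C => ⟨-(A.transpose * C + C * A), by
        change Matrix.transpose _ = _
        rw [Matrix.transpose_neg, Matrix.transpose_add, Matrix.transpose_mul,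
          Matrix.transpose_mul, Matrix.transpose_transpose, skewMat_transpose]
        noncomm_ring⟩
      map_add' := fun C C' => Subtype.ext (by simp only [Submodule.coe_add]; noncomm_ring)
      map_smul' := fun r C => Subtype.ext (by
        simp only [Submodule.coe_smul, Matrix.mul_smul, Matrix.smul_mul, RingHom.id_apply]
        rw [← smul_add, smul_neg]) }
  map_add' A A' := LinearMap.ext fun C => Subtype.ext (by
    simp only [LinearMap.coe_mk, AddHom.coe_mk, LinearMap.add_apply, Submodule.coe_add,
      Matrix.transpose_add]
    noncomm_ring)
  map_smul' r A := LinearMap.ext fun C => Subtype.ext (by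
    simp only [LinearMap.coe_mk, AddHom.coe_mk, LinearMap.smul_apply, Submodule.coe_smul,
      Matrix.transpose_smul, Matrix.mul_smul, Matrix.smul_mul, RingHom.id_apply]
    rw [← smul_add, smul_neg])

theorem skewAct_coe (A : Matrix (Fin n) (Fin n) ℂ) (C : skewMat n) :
    (skewAct n A C : Matrix (Fin n) (Fin n) ℂ) = -(A.transpose * C + C * A) := rfl

/-- The `gl(n)`-module `g₋₁`. -/
def skewRep (n : ℕ) : GLRep n where
  carrier := skewMat n
  act := skewAct n
  act_lie X Y := LinearMap.ext fun C => Subtype.ext (by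
    simp only [LinearMap.sub_apply, Module.End.mul_apply, Submodule.coe_sub, skewAct_coe,
      Matrix.transpose_sub, Matrix.transpose_mul]
    noncomm_ring)

/-- The action of `gl(n)` on `g₁`. -/
def symAct (A : Matrix (Fin n) (Fin n) ℂ) (B : symMat n) : symMat n :=
  ⟨A * B + B * A.transpose, by
    change Matrix.transpose _ = _
    rw [Matrix.transpose_add, Matrix.transpose_mul, Matrix.transpose_mul,
      Matrix.transpose_transpose, symMat_transpose, add_comm]⟩

variable (V : GLRep n)

/-- The space `Λ(g₋₁) ⊗ V`. -/
abbrev KacSpace : Type := Fock (skewMat n) V.carrier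

/-- The operator of `A ∈ gl(n)` on `Λ(g₋₁) ⊗ V`. -/
def kacA : Matrix (Fin n) (Fin n) ℂ →ₗ[ℂ] Module.End ℂ (KacSpace V) := fockAct (skewRep n) V

theorem kacA_vac (A : Matrix (Fin n) (Fin n) ℂ) (v : V.carrier) :
    kacA V A (vac (skewMat n) v) = vac (skewMat n) (V.act A v) := fockAct_vac (skewRep n) V A v

theorem kacA_creat (A : Matrix (Fin n) (Fin n) ℂ) (c : skewMat n) (m : KacSpace V) :
    kacA V A (creat _ c m) = creat _ c (kacA V A m) + creat _ (skewAct n A c) m :=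
  fockAct_creat (skewRep n) V A c m

theorem kacA_lie (X Y : Matrix (Fin n) (Fin n) ℂ) :
    kacA V (X * Y - Y * X) = kacA V X * kacA V Y - kacA V Y * kacA V X :=
  (fockRep (skewRep n) V).act_lie X Y

theorem exists_kacB (B : symMat n) : ∃ T : Module.End ℂ (KacSpace V),
    (∀ v, T (vac (skewMat n) v) = 0) ∧
    ∀ c m, T (creat _ c m) = -creat _ c (T m) +
      kacA V (B.1 * c.1) m := by
  obtain ⟨T, h0, h⟩ := exists_fock_op (W := skewMat n) (V := V.carrier) (-1)
    ((kacA V) ∘ₗ LinearMap.mulLeft ℂ (B : Matrix (Fin n) (Fin n) ℂ) ∘ₗ (skewMat n).subtype)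
    (fun c m => by
      -- the double bracket `[[B, c], c]` vanishes
      have hc : skewAct n (B.1 * c.1) c
          = 0 := Subtype.ext (by
        rw [skewAct_coe, Matrix.transpose_mul, skewMat_transpose, symMat_transpose]
        simp only [Submodule.coe_zero]
        noncomm_ring)
      have := kacA_creat V (B.1 * c.1) c m
      rw [hc, map_zero, LinearMap.zero_apply, add_zero] at this
      change (-1 : ℂ) • creat _ c (kacA V _ m) + kacA V _ _ = 0
      have key : ∀ z : KacSpace V, (-1 : ℂ) • z + z = 0 := fun z => by
        rw [neg_one_smul, neg_add_cancel]
      rw [← key (creat _ c (kacA V (B.1 * c.1) m))]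
      exact congrArg _ this) 0
  refine ⟨T, h0, fun c m => (h c m).trans ?_⟩
  congr 1

/-- The operator of `B ∈ g₁` on `Λ(g₋₁) ⊗ V`: it kills `1 ⊗ V`, and its anticommutator with
exterior multiplication by `c` is the action of `[B, c] = B c ∈ gl(n)`. -/
def kacB : symMat n →ₗ[ℂ] Module.End ℂ (KacSpace V) where
  toFun B := (exists_kacB V B).choose
  map_add' B B' := by
    refine fock_hom_ext (fun v => ?_) fun c m hm => ?_
    · rw [LinearMap.add_apply, (exists_kacB V _).choose_spec.1, (exists_kacB V _).choose_spec.1,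
        (exists_kacB V _).choose_spec.1, add_zero]
    · rw [LinearMap.add_apply] at hm ⊢
      rw [(exists_kacB V _).choose_spec.2, (exists_kacB V _).choose_spec.2,
        (exists_kacB V _).choose_spec.2, hm, Submodule.coe_add, add_mul]
      simp only [map_add, LinearMap.add_apply]
      abel
  map_smul' r B := by
    refine fock_hom_ext (fun v => ?_) fun c m hm => ?_
    · rw [LinearMap.smul_apply, (exists_kacB V _).choose_spec.1,
        (exists_kacB V _).choose_spec.1, smul_zero]
    · rw [LinearMap.smul_apply] at hm ⊢
      rw [(exists_kacB V _).choose_spec.2, (exists_kacB V _).choose_spec.2, hm,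
        Submodule.coe_smul, smul_mul_assoc]
      simp

theorem kacB_vac (B : symMat n) (v : V.carrier) : kacB V B (vac (skewMat n) v) = 0 :=
  (exists_kacB V B).choose_spec.1 v

theorem kacB_creat (B : symMat n) (c : skewMat n) (m : KacSpace V) :
    kacB V B (creat _ c m) = -creat _ c (kacB V B m) +
      kacA V (B.1 * c.1) m :=
  (exists_kacB V B).choose_spec.2 c m

/-- The operators of `gl(n)` and `g₁` satisfy the relation `[A, B] = A B + B Aᵗ`. -/
theorem kacA_kacB (A : Matrix (Fin n) (Fin n) ℂ) (B : symMat n) :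
    kacA V A * kacB V B - kacB V B * kacA V A = kacB V (symAct A B) := by
  refine fock_hom_ext (fun v => ?_) fun c m hm => ?_
  · simp only [LinearMap.sub_apply, Module.End.mul_apply, kacA_vac, kacB_vac, map_zero, sub_zero]
  · have h := LinearMap.congr_fun (kacA_lie V A (B.1 * c.1)) m
    have e : A * (B.1 * c.1) -
        (B.1 * c.1) * A = (symAct A B : Matrix (Fin n) (Fin n) ℂ) * c +
        (B : Matrix (Fin n) (Fin n) ℂ) * (skewAct n A c : Matrix (Fin n) (Fin n) ℂ) := by
      rw [skewAct_coe, symAct]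
      noncomm_ring
    rw [e, map_add] at h
    simp only [LinearMap.sub_apply, LinearMap.add_apply, Module.End.mul_apply] at hm h ⊢
    rw [kacB_creat, kacB_creat, ← hm, kacA_creat, map_add, map_add, map_neg, kacA_creat,
      kacB_creat, kacB_creat, map_sub]
    have h' := sub_eq_iff_eq_add.mp h.symm
    rw [h']
    abel

/-- The operators of `g₁` anticommute. -/
theorem kacB_kacB (B B' : symMat n) :
    kacB V B * kacB V B' + kacB V B' * kacB V B = 0 := by
  refine fock_hom_ext (fun v => ?_) fun c m hm => ?_
  · simp only [LinearMap.add_apply, Module.End.mul_apply, kacB_vac, map_zero, add_zero,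
      LinearMap.zero_apply]
  · have h1 := LinearMap.congr_fun (kacA_kacB V (B.1 * c.1) B') m
    have h2 := LinearMap.congr_fun (kacA_kacB V (B'.1 * c.1) B) m
    have e : symAct (B.1 * c.1) B' =
        -symAct (B'.1 * c.1) B := Subtype.ext (by
      simp only [symAct, Submodule.coe_neg, Matrix.transpose_mul, skewMat_transpose,
        symMat_transpose]
      noncomm_ring)
    rw [e, map_neg] at h1
    simp only [LinearMap.sub_apply, LinearMap.add_apply, Module.End.mul_apply,
      LinearMap.zero_apply, LinearMap.neg_apply] at hm h1 h2 ⊢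
    rw [kacB_creat, kacB_creat, map_add, map_add, map_neg, map_neg, kacB_creat, kacB_creat]
    have hm' := congrArg (creat V.carrier c) hm
    rw [map_add, map_zero] at hm'
    rw [← h2] at h1
    have h3 : kacA V (B.1 * c.1) (kacB V B' m) =
      kacB V B' (kacA V (B.1 * c.1) m) -
        (kacA V (B'.1 * c.1) (kacB V B m) -
          kacB V B (kacA V (B'.1 * c.1) m)) := by
      rw [sub_eq_iff_eq_add] at h1
      rw [h1]
      abel
    rw [h3, eq_neg_of_add_eq_zero_left hm']
    abel

/-- The upper left block of an element of `p(n)`. -/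
def blkA (n : ℕ) : periplectic n →ₗ[ℂ] Matrix (Fin n) (Fin n) ℂ where
  toFun X := (X : SMat n).toBlocks₁₁
  map_add' _ _ := rfl
  map_smul' _ _ := rfl

/-- The symmetric block of an element of `p(n)`. -/
def blkB (n : ℕ) : periplectic n →ₗ[ℂ] symMat n where
  toFun X := ⟨(X : SMat n).toBlocks₁₂, X.2.2.1⟩
  map_add' _ _ := rfl
  map_smul' _ _ := rfl

/-- The antisymmetric block of an element of `p(n)`. -/
def blkC (n : ℕ) : periplectic n →ₗ[ℂ] skewMat n where
  toFun X := ⟨(X : SMat n).toBlocks₂₁, X.2.2.2⟩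
  map_add' _ _ := rfl
  map_smul' _ _ := rfl

/-- The inclusion of `g₋₁` into `p(n)`. -/
def inclC (n : ℕ) : skewMat n →ₗ[ℂ] periplectic n where
  toFun C := ⟨Matrix.fromBlocks 0 0 C 0, by
    rw [fromBlocks_mem]
    exact ⟨by simp, by simp, C.2⟩⟩
  map_add' C C' := Subtype.ext (by simp [Matrix.fromBlocks_add])
  map_smul' r C := Subtype.ext (by simp [Matrix.fromBlocks_smul])

/-- The elements of `p(n)` with prescribed blocks. -/
def ofBlocks (A : Matrix (Fin n) (Fin n) ℂ) (B : symMat n) (C : skewMat n) : periplectic n :=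
  ⟨Matrix.fromBlocks A B C (-A.transpose), fromBlocks_mem.mpr ⟨rfl, B.2, C.2⟩⟩

theorem ofBlocks_blk (X : periplectic n) : ofBlocks (blkA n X) (blkB n X) (blkC n X) = X := by
  apply Subtype.ext
  change Matrix.fromBlocks _ _ _ _ = _
  conv_rhs => rw [← Matrix.fromBlocks_toBlocks (X : SMat n)]
  rw [X.2.1]
  rfl

/-- The action of `p(n)` on `Λ(g₋₁) ⊗ V`. -/
def kacAct : periplectic n →ₗ[ℂ] Module.End ℂ (KacSpace V) :=
  kacA V ∘ₗ blkA n + kacB V ∘ₗ blkB n + creat V.carrier ∘ₗ blkC n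

theorem homogeneous_zero_iff {X : periplectic n} :
    IsHomogeneous 0 (X : SMat n) ↔ blkB n X = 0 ∧ blkC n X = 0 := by
  change oddPart _ = 0 ↔ _
  rw [oddPart, ← Matrix.fromBlocks_zero, Matrix.fromBlocks_inj]
  exact ⟨fun h => ⟨Subtype.ext h.2.1, Subtype.ext h.2.2.1⟩,
    fun h => ⟨rfl, congrArg Subtype.val h.1, congrArg Subtype.val h.2, rfl⟩⟩

theorem homogeneous_one_iff {X : periplectic n} :
    IsHomogeneous 1 (X : SMat n) ↔ blkA n X = 0 := by
  change evenPart _ = 0 ↔ _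
  rw [evenPart, ← Matrix.fromBlocks_zero, Matrix.fromBlocks_inj]
  simp only [true_and]
  refine ⟨fun h => h.1, fun h => ⟨h, ?_⟩⟩
  have h' : (X : SMat n).toBlocks₁₁ = 0 := h
  rw [X.2.1, h']
  simp

theorem kacAct_even {X : periplectic n} (hX : IsHomogeneous 0 (X : SMat n)) :
    kacAct V X = kacA V (blkA n X) := by
  rw [homogeneous_zero_iff] at hX
  simp [kacAct, hX.1, hX.2]

theorem kacAct_odd {X : periplectic n} (hX : IsHomogeneous 1 (X : SMat n)) :
    kacAct V X = kacB V (blkB n X) + creat V.carrier (blkC n X) := by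
  rw [homogeneous_one_iff] at hX
  simp [kacAct, hX]

end Kac

/-! ### The Kac module as a representation of `p(n)` -/

section KacModule

variable {n : ℕ} (V : GLRep n)

theorem parity_cases (i : ZMod 2) : i = 0 ∨ i = 1 := by
  revert i; decide

theorem sign_zero_left (j : ZMod 2) : sign 0 j = 1 := by simp [sign]

theorem sign_zero_right (i : ZMod 2) : sign i 0 = 1 := by simp [sign]

theorem sign_one_one : sign 1 1 = -1 := by simp [sign, ZMod.val_one]

theorem even_eq_fromBlocks {X : periplectic n} (hX : IsHomogeneous 0 (X : SMat n)) :
    (X : SMat n) = Matrix.fromBlocks (blkA n X) 0 0 (-(blkA n X).transpose) := by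
  rw [homogeneous_zero_iff] at hX
  conv_lhs => rw [← ofBlocks_blk X, hX.1, hX.2]
  rfl

theorem odd_eq_fromBlocks {X : periplectic n} (hX : IsHomogeneous 1 (X : SMat n)) :
    (X : SMat n) = Matrix.fromBlocks 0 (blkB n X) (blkC n X) 0 := by
  rw [homogeneous_one_iff] at hX
  conv_lhs => rw [← ofBlocks_blk X, hX]
  simp [ofBlocks]

theorem ofBlocks_coe (A : Matrix (Fin n) (Fin n) ℂ) (B : symMat n) (C : skewMat n) :
    (ofBlocks A B C : SMat n) = Matrix.fromBlocks A B C (-A.transpose) := rfl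

theorem kacAct_ofBlocks (A : Matrix (Fin n) (Fin n) ℂ) (B : symMat n) (C : skewMat n) :
    kacAct V (ofBlocks A B C) = kacA V A + kacB V B + creat V.carrier C := rfl

theorem superBracket_fromBlocks (A B C D A' B' C' D' : Matrix (Fin n) (Fin n) ℂ) :
    superBracket (Matrix.fromBlocks A B C D) (Matrix.fromBlocks A' B' C' D') =
      Matrix.fromBlocks (A * A' + B * C' - A' * A + B' * C) (A * B' + B * D' - B' * D - A' * B)
        (C * A' + D * C' - C' * A - D' * C) (C * B' + D * D' - D' * D + C' * B) := by
  simp only [superBracket, evenPart, oddPart, Matrix.toBlocks_fromBlocks₁₁,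
    Matrix.toBlocks_fromBlocks₁₂, Matrix.toBlocks_fromBlocks₂₁, Matrix.toBlocks_fromBlocks₂₂,
    sub_eq_add_neg, Matrix.fromBlocks_neg, Matrix.fromBlocks_add, Matrix.fromBlocks_multiply]
  congr 1 <;> noncomm_ring

theorem bracket_even_even {X Y : periplectic n} (hX : IsHomogeneous 0 (X : SMat n))
    (hY : IsHomogeneous 0 (Y : SMat n)) :
    bracket X Y = ofBlocks (blkA n X * blkA n Y - blkA n Y * blkA n X) 0 0 := by
  apply Subtype.ext
  change superBracket (X : SMat n) Y = _
  rw [even_eq_fromBlocks hX, even_eq_fromBlocks hY, ofBlocks_coe, superBracket_fromBlocks]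
  congr 1
  · noncomm_ring
  · simp
  · simp
  · rw [Matrix.transpose_sub, Matrix.transpose_mul, Matrix.transpose_mul]
    noncomm_ring

theorem bracket_even_odd {X Y : periplectic n} (hX : IsHomogeneous 0 (X : SMat n))
    (hY : IsHomogeneous 1 (Y : SMat n)) :
    bracket X Y = ofBlocks 0 (symAct (blkA n X) (blkB n Y)) (skewAct n (blkA n X) (blkC n Y)) := by
  apply Subtype.ext
  change superBracket (X : SMat n) Y = _
  rw [even_eq_fromBlocks hX, odd_eq_fromBlocks hY, ofBlocks_coe, superBracket_fromBlocks]
  rw [skewAct_coe, symAct, Matrix.transpose_zero]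
  congr 1 <;> noncomm_ring

theorem bracket_odd_even {X Y : periplectic n} (hX : IsHomogeneous 1 (X : SMat n))
    (hY : IsHomogeneous 0 (Y : SMat n)) : bracket X Y = -bracket Y X := by
  apply Subtype.ext
  change superBracket (X : SMat n) Y = -superBracket (Y : SMat n) X
  rw [odd_eq_fromBlocks hX, even_eq_fromBlocks hY, superBracket_fromBlocks,
    superBracket_fromBlocks, Matrix.fromBlocks_neg]
  congr 1 <;> noncomm_ring

theorem bracket_odd_odd {X Y : periplectic n} (hX : IsHomogeneous 1 (X : SMat n))
    (hY : IsHomogeneous 1 (Y : SMat n)) :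
    bracket X Y = ofBlocks ((blkB n X).1 * (blkC n Y).1 +
      (blkB n Y).1 * (blkC n X).1) 0 0 := by
  apply Subtype.ext
  change superBracket (X : SMat n) Y = _
  rw [odd_eq_fromBlocks hX, odd_eq_fromBlocks hY, ofBlocks_coe, superBracket_fromBlocks]
  rw [Matrix.transpose_add, Matrix.transpose_mul, Matrix.transpose_mul, skewMat_transpose,
    skewMat_transpose, symMat_transpose, symMat_transpose, Submodule.coe_zero, Submodule.coe_zero]
  congr 1 <;> noncomm_ring

theorem kac_even_odd {X Y : periplectic n} (hX : IsHomogeneous 0 (X : SMat n))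
    (hY : IsHomogeneous 1 (Y : SMat n)) :
    kacAct V (bracket X Y) = kacAct V X * kacAct V Y - kacAct V Y * kacAct V X := by
  have hc : ∀ (A : Matrix (Fin n) (Fin n) ℂ) (c : skewMat n), creat V.carrier (skewAct n A c) =
      kacA V A * creat V.carrier c - creat V.carrier c * kacA V A := fun A c =>
    LinearMap.ext fun m => by
      simp only [LinearMap.sub_apply, Module.End.mul_apply]
      rw [kacA_creat]
      abel
  rw [bracket_even_odd hX hY, kacAct_ofBlocks, kacAct_even V hX, kacAct_odd V hY, map_zero,
    zero_add, ← kacA_kacB V, hc]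
  noncomm_ring

/-- The operators on `Λ(g₋₁) ⊗ V` satisfy the relations of `p(n)`. -/
theorem kac_bracket (i j : ZMod 2) (X Y : periplectic n) (hX : IsHomogeneous i (X : SMat n))
    (hY : IsHomogeneous j (Y : SMat n)) :
    kacAct V (bracket X Y) =
      kacAct V X * kacAct V Y - sign i j • (kacAct V Y * kacAct V X) := by
  rcases parity_cases i with rfl | rfl <;> rcases parity_cases j with rfl | rfl
  · rw [sign_zero_left, one_smul, bracket_even_even hX hY, kacAct_ofBlocks, kacAct_even V hX,
      kacAct_even V hY, kacA_lie, map_zero, map_zero, add_zero, add_zero]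
  · rw [sign_zero_left, one_smul, kac_even_odd V hX hY]
  · rw [sign_zero_right, one_smul, bracket_odd_even hX hY, map_neg, kac_even_odd V hY hX, neg_sub]
  · have hcc : ∀ c c' : skewMat n, creat V.carrier c * creat V.carrier c' =
        -(creat V.carrier c' * creat V.carrier c) := fun c c' =>
      LinearMap.ext fun m => creat_anticomm c c' m
    have hBc : ∀ (B : symMat n) (c : skewMat n),
        kacB V B * creat V.carrier c = -(creat V.carrier c * kacB V B) +
          kacA V (B.1 * c.1) := fun B c =>
      LinearMap.ext fun m => kacB_creat V B c m
    have hBB := eq_neg_of_add_eq_zero_left (kacB_kacB V (blkB n X) (blkB n Y))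
    rw [sign_one_one, bracket_odd_odd hX hY, kacAct_ofBlocks, kacAct_odd V hX, kacAct_odd V hY,
      map_zero, map_zero, map_add, add_zero, add_zero, neg_one_smul, sub_neg_eq_add]
    simp only [mul_add, add_mul]
    rw [hBB, hcc (blkC n X) (blkC n Y), hBc, hBc]
    abel

/-- The `p(n)`-module `Λ(g₋₁) ⊗ V`. -/
def kac : PRep n where
  carrier := KacSpace V
  parity := fockParity (skewMat n) V.carrier
  parity_sq := fockParity_sq
  act := kacAct V
  parity_act i X hX := by
    have hA : ∀ A, fockParity (skewMat n) V.carrier * kacA V A =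
        kacA V A * fockParity (skewMat n) V.carrier := fockParity_fockAct (skewRep n) V
    rcases parity_cases i with rfl | rfl
    · rw [sign_zero_left, one_smul, kacAct_even V hX, hA]
    · rw [sign_one_one, kacAct_odd V hX]
      have hc : ∀ c, fockParity (skewMat n) V.carrier * creat V.carrier c =
          -(creat V.carrier c * fockParity (skewMat n) V.carrier) := fun c =>
        LinearMap.ext fun m => fockParity_creat c m
      have hB : ∀ B, fockParity (skewMat n) V.carrier * kacB V B =
          -(kacB V B * fockParity (skewMat n) V.carrier) := fun B =>
        fock_hom_ext (fun v => by
          simp only [Module.End.mul_apply, LinearMap.neg_apply, fockParity_vac, kacB_vac,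
            map_zero, neg_zero]) fun c m hm => by
          have hA' := LinearMap.congr_fun (hA (B.1 * c.1)) m
          simp only [Module.End.mul_apply, LinearMap.neg_apply] at hm hA' ⊢
          rw [kacB_creat, map_add, map_neg, fockParity_creat, fockParity_creat, map_neg,
            kacB_creat, hm, map_neg, hA']
          abel
      rw [neg_one_smul, mul_add, add_mul, hc, hB]
      abel
  act_bracket := kac_bracket V

end KacModule

/-! ### The enveloping superalgebra and the induced module -/

section Ind

variable {n : ℕ}

/-- The action of `U(p(n))` on a `p(n)`-module. -/
def PRep.envHom (M : PRep n) : Env n →ₐ[ℂ] Module.End ℂ M.carrier :=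
  RingQuot.liftAlgHom ℂ ⟨TensorAlgebra.lift ℂ M.act, by
    rintro _ _ ⟨i, j, X, Y, hX, hY⟩
    simp only [map_sub, map_smul, map_mul, TensorAlgebra.lift_ι_apply]
    exact M.act_bracket i j X Y hX hY⟩

theorem PRep.envHom_envι (M : PRep n) (X : periplectic n) : M.envHom (envι n X) = M.act X := by
  have h : M.envHom (envMk n (TensorAlgebra.ι ℂ X)) =
      TensorAlgebra.lift ℂ M.act (TensorAlgebra.ι ℂ X) :=
    RingQuot.liftAlgHom_mkAlgHom_apply ℂ _ _ _
  rw [TensorAlgebra.lift_ι_apply] at h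
  exact h

theorem PRep.envHom_mul_envι (M : PRep n) (u : Env n) (X : periplectic n) (m : M.carrier) :
    M.envHom (u * envι n X) m = M.envHom u (M.act X m) := by
  rw [map_mul, Module.End.mul_apply, M.envHom_envι]

theorem PRep.envHom_envι_mul (M : PRep n) (X : periplectic n) (u : Env n) (m : M.carrier) :
    M.envHom (envι n X * u) m = M.act X (M.envHom u m) := by
  rw [map_mul, Module.End.mul_apply, M.envHom_envι]

/-- `U(p(n))` is spanned by products of elements of `p(n)`. -/
theorem env_induction {S : Submodule ℂ (Env n)} (h1 : 1 ∈ S)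
    (hS : ∀ X, ∀ u ∈ S, envι n X * u ∈ S) (u : Env n) : u ∈ S := by
  have key : ∀ t : TensorAlgebra ℂ (periplectic n), ∀ u ∈ S, envMk n t * u ∈ S := by
    intro t
    induction t using TensorAlgebra.induction with
    | algebraMap r =>
      intro u hu
      rw [AlgHom.commutes, ← Algebra.smul_def]
      exact S.smul_mem r hu
    | ι X => exact hS X
    | mul a b ha hb =>
      intro u hu
      rw [map_mul, mul_assoc]
      exact ha _ (hb u hu)
    | add a b ha hb =>
      intro u hu
      rw [map_add, add_mul]
      exact add_mem (ha u hu) (hb u hu)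
  obtain ⟨t, rfl⟩ := RingQuot.mkAlgHom_surjective ℂ (EnvRel n) u
  have := key t 1 h1
  rw [mul_one] at this
  exact this

variable (V : GLRep n)

/-- The class of `u ⊗ v` in the induced module. -/
def indMk (u : Env n) : V.carrier →ₗ[ℂ] (ind V).carrier :=
  (indRelations V).mkQ ∘ₗ TensorProduct.mk ℂ (Env n) V.carrier u

theorem ind_act (X : periplectic n) (u : Env n) (v : V.carrier) :
    (ind V).act X (indMk V u v) = indMk V (envι n X * u) v := rfl

theorem ind_parity (u : Env n) (v : V.carrier) :
    (ind V).parity (indMk V u v) = indMk V (envParity n u) v := rfl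

theorem indMk_rel (u : Env n) {X : periplectic n} (hX : blkC n X = 0) (v : V.carrier) :
    indMk V (u * envι n X) v = indMk V u (V.act (blkA n X) v) := by
  refine (Submodule.Quotient.eq _).mpr (Submodule.subset_span ⟨u, X, v, ?_, rfl⟩)
  exact congrArg Subtype.val hX

/-- The induced module is generated by `1 ⊗ V` over `p(n)`. -/
theorem ind_eq_top {S : Submodule ℂ (ind V).carrier} (h1 : ∀ v, indMk V 1 v ∈ S)
    (hS : ∀ X, ∀ m ∈ S, (ind V).act X m ∈ S) : S = ⊤ := by
  have key : ∀ u v, indMk V u v ∈ S := by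
    intro u v
    let f : Env n →ₗ[ℂ] (ind V).carrier :=
      (indRelations V).mkQ ∘ₗ (TensorProduct.mk ℂ (Env n) V.carrier).flip v
    have : u ∈ S.comap f := env_induction (S := S.comap f) (h1 v) (fun X u hu => hS X _ hu) u
    exact this
  rw [eq_top_iff]
  rintro m -
  obtain ⟨z, rfl⟩ := (indRelations V).mkQ_surjective m
  induction z using TensorProduct.induction_on with
  | zero => rw [map_zero]; exact zero_mem _
  | tmul u v => exact key u v
  | add a b ha hb => rw [map_add]; exact add_mem ha hb

theorem inclC_odd (c : skewMat n) : IsHomogeneous 1 (inclC n c : SMat n) :=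
  homogeneous_one_iff.mpr rfl

theorem bracket_inclC (c : skewMat n) : bracket (inclC n c) (inclC n c) = 0 := by
  rw [bracket_odd_odd (inclC_odd c) (inclC_odd c)]
  apply Subtype.ext
  have : blkB n (inclC n c) = 0 := rfl
  rw [ofBlocks_coe, this]
  simp

theorem act_inclC_sq (M : PRep n) (c : skewMat n) :
    M.act (inclC n c) * M.act (inclC n c) = 0 := by
  have h := M.act_bracket 1 1 _ _ (inclC_odd c) (inclC_odd c)
  rw [bracket_inclC, map_zero, sign_one_one, neg_one_smul, sub_neg_eq_add, ← two_smul ℂ] at h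
  exact (smul_eq_zero.mp h.symm).resolve_left two_ne_zero

theorem kacAct_inclC (c : skewMat n) : kacAct V (inclC n c) = creat V.carrier c := by
  have h1 : blkA n (inclC n c) = 0 := rfl
  have h2 : blkB n (inclC n c) = 0 := rfl
  have h3 : blkC n (inclC n c) = c := rfl
  simp only [kacAct, LinearMap.add_apply, LinearMap.comp_apply, h1, h2, h3, map_zero, zero_add]

/-- The induced module is isomorphic to `Λ(g₋₁) ⊗ V`. -/
theorem exists_kac_equiv : ∃ Φ : (kac V).carrier ≃ₗ[ℂ] (ind V).carrier,
    (∀ X m, Φ ((kac V).act X m) = (ind V).act X (Φ m)) ∧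
    ∀ m, Φ ((kac V).parity m) = (ind V).parity (Φ m) := by
  -- the map to the induced module, from the recursive description of `Λ(g₋₁) ⊗ V`
  obtain ⟨Φ, h0, hΦ⟩ := exists_fock_hom (W := skewMat n) (V := V.carrier)
    ((ind V).act ∘ₗ inclC n) (act_inclC_sq (ind V)) (indMk V 1)
  have hC : ∀ c m, Φ (creat V.carrier c m) = (ind V).act (inclC n c) (Φ m) := hΦ
  -- the map from the induced module, from the universal property of `U(p(n))`
  let Ψ₀ : Env n ⊗[ℂ] V.carrier →ₗ[ℂ] KacSpace V :=
    TensorProduct.lift ((LinearMap.lcomp ℂ (KacSpace V) (vac (skewMat n))) ∘ₗ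
      (kac V).envHom.toLinearMap)
  have hΨ₀ : ∀ u v, Ψ₀ (u ⊗ₜ v) = (kac V).envHom u (vac (skewMat n) v) :=
    fun u v => TensorProduct.lift.tmul _ _
  have hrel : indRelations V ≤ LinearMap.ker Ψ₀ := by
    rw [indRelations, Submodule.span_le]
    rintro _ ⟨u, X, v, hX, rfl⟩
    have hX' : blkC n X = 0 := Subtype.ext hX
    have e : (kac V).act X (vac (skewMat n) v) = vac (skewMat n) (V.act (blkA n X) v) := by
      change (kacA V (blkA n X) + kacB V (blkB n X) + creat V.carrier (blkC n X)) _ = _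
      rw [hX', map_zero, add_zero, LinearMap.add_apply, kacA_vac, kacB_vac, add_zero]
    rw [SetLike.mem_coe, LinearMap.mem_ker, map_sub, hΨ₀, hΨ₀]
    exact sub_eq_zero.mpr (((kac V).envHom_mul_envι u X _).trans (congrArg _ e))
  let Ψ : (ind V).carrier →ₗ[ℂ] KacSpace V := (indRelations V).liftQ Ψ₀ hrel
  have hΨ : ∀ u v, Ψ (indMk V u v) = (kac V).envHom u (vac (skewMat n) v) := hΨ₀
  have hΨX : ∀ X m, Ψ ((ind V).act X m) = kacAct V X (Ψ m) := by
    intro X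
    suffices e : Ψ ∘ₗ (ind V).act X = kacAct V X ∘ₗ Ψ from LinearMap.congr_fun e
    apply Submodule.linearMap_qext
    apply TensorProduct.ext'
    intro u v
    exact (kac V).envHom_envι_mul X u _
  have hΨΦ : Ψ ∘ₗ Φ = LinearMap.id := by
    refine fock_hom_ext (fun v => ?_) fun c m hm => ?_
    · rw [LinearMap.comp_apply, h0, hΨ, map_one]; rfl
    · rw [LinearMap.comp_apply, LinearMap.id_apply] at hm ⊢
      rw [hC, hΨX, hm, kacAct_inclC]
  have hhom : ∀ (i : ZMod 2) (X : periplectic n), IsHomogeneous i (X : SMat n) →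
      ∀ m, Φ (kacAct V X m) = (ind V).act X (Φ m) := by
    have key : ∀ m, ∀ (i : ZMod 2) (X : periplectic n), IsHomogeneous i (X : SMat n) →
        Φ (kacAct V X m) = (ind V).act X (Φ m) := by
      let S : Submodule ℂ (KacSpace V) :=
        { carrier := {m | ∀ (i : ZMod 2) (X : periplectic n), IsHomogeneous i (X : SMat n) →
            Φ (kacAct V X m) = (ind V).act X (Φ m)}
          add_mem' := fun ha hb i X hX => by
            rw [map_add, map_add, map_add, map_add, ha i X hX, hb i X hX]
          zero_mem' := fun i X hX => by rw [map_zero, map_zero, map_zero]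
          smul_mem' := fun r m hm i X hX => by
            rw [map_smul, map_smul, map_smul, map_smul, hm i X hX] }
      have hS : S = ⊤ := by
        refine fock_eq_top (fun v i X hX => ?_) fun c m hm i X hX => ?_
        · rw [h0, ind_act, mul_one]
          rcases parity_cases i with rfl | rfl
          · rw [kacAct_even V hX, kacA_vac, h0, ← indMk_rel V 1 (homogeneous_zero_iff.mp hX).2,
              one_mul]
          · have hX0 := homogeneous_one_iff.mp hX
            let X₁ := ofBlocks (0 : Matrix (Fin n) (Fin n) ℂ) (blkB n X) 0
            have hsplit : X = X₁ + inclC n (blkC n X) := by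
              apply Subtype.ext
              rw [Submodule.coe_add, odd_eq_fromBlocks hX]
              simp [X₁, ofBlocks_coe, inclC, Matrix.fromBlocks_add]
            have h1 : indMk V (envι n X₁) v = 0 := by
              have := indMk_rel V 1 (X := X₁) rfl v
              rw [one_mul] at this
              rw [this]
              have e : blkA n X₁ = 0 := rfl
              rw [e, map_zero, LinearMap.zero_apply, map_zero]
            have h2 : indMk V (envι n X) v = indMk V (envι n (inclC n (blkC n X))) v := by
              conv_lhs => rw [hsplit, map_add]
              have : ∀ a b, indMk V (a + b) v = indMk V a v + indMk V b v := fun a b =>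
                (congrArg (indRelations V).mkQ (TensorProduct.add_tmul a b v)).trans
                  (map_add _ _ _)
              rw [this, h1, zero_add]
            rw [h2, kacAct_odd V hX, LinearMap.add_apply, kacB_vac, zero_add, hC, h0, ind_act,
              mul_one]
        · have e1 := LinearMap.congr_fun (kac_bracket V i 1 X (inclC n c) hX (inclC_odd c)) m
          have e2 := LinearMap.congr_fun
            ((ind V).act_bracket i 1 X (inclC n c) hX (inclC_odd c)) (Φ m)
          have hbr : Φ (kacAct V (bracket X (inclC n c)) m) =
              (ind V).act (bracket X (inclC n c)) (Φ m) := by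
            rcases parity_cases i with rfl | rfl
            · refine hm 1 _ (homogeneous_one_iff.mpr ?_)
              rw [bracket_even_odd hX (inclC_odd c)]; rfl
            · refine hm 0 _ (homogeneous_zero_iff.mpr ?_)
              rw [bracket_odd_odd hX (inclC_odd c)]; exact ⟨rfl, rfl⟩
          rw [e1, e2, kacAct_inclC] at hbr
          simp only [LinearMap.sub_apply, LinearMap.smul_apply, Module.End.mul_apply, map_sub,
            map_smul] at hbr
          rw [hC, hm i X hX] at hbr
          rw [hC]
          exact sub_left_inj.mp hbr
      intro m
      exact (hS ▸ Submodule.mem_top : m ∈ S)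
    exact fun i X hX m => key m i X hX
  have heq : ∀ X m, Φ (kacAct V X m) = (ind V).act X (Φ m) := by
    intro X m
    let X0 := ofBlocks (blkA n X) 0 0
    let X1 := ofBlocks (0 : Matrix (Fin n) (Fin n) ℂ) (blkB n X) (blkC n X)
    have hX : X = X0 + X1 := by
      apply Subtype.ext
      conv_lhs => rw [← ofBlocks_blk X]
      rw [Submodule.coe_add, ofBlocks_coe, ofBlocks_coe, ofBlocks_coe]
      simp [Matrix.fromBlocks_add]
    have h0 := hhom 0 X0 (homogeneous_zero_iff.mpr ⟨rfl, rfl⟩) m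
    have h1 := hhom 1 X1 (homogeneous_one_iff.mpr rfl) m
    rw [hX, map_add, map_add, LinearMap.add_apply, LinearMap.add_apply, map_add, h0, h1]
  have hpar : ∀ m, Φ (fockParity _ _ m) = (ind V).parity (Φ m) := by
    have : Φ ∘ₗ fockParity _ _ = (ind V).parity ∘ₗ Φ := by
      refine fock_hom_ext (fun v => ?_) fun c m hm => ?_
      · rw [LinearMap.comp_apply, LinearMap.comp_apply, fockParity_vac, h0, ind_parity, map_one]
      · rw [LinearMap.comp_apply, LinearMap.comp_apply] at hm ⊢
        have := LinearMap.congr_fun ((ind V).parity_act 1 _ (inclC_odd c)) (Φ m)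
        rw [sign_one_one, neg_one_smul] at this
        rw [fockParity_creat, map_neg, hC, hC, hm]
        exact this.symm
    exact LinearMap.congr_fun this
  have hbij : Function.Bijective Φ := by
    constructor
    · exact Function.LeftInverse.injective (g := Ψ) (LinearMap.congr_fun hΨΦ)
    · rw [← LinearMap.range_eq_top]
      refine ind_eq_top V (fun v => ⟨vac (skewMat n) v, h0 v⟩) ?_
      rintro X _ ⟨m, rfl⟩
      exact ⟨kacAct V X m, heq X m⟩
  exact ⟨LinearEquiv.ofBijective Φ hbij, heq, hpar⟩

end Ind

/-! ### The supercharacters of the thin Kac modules -/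

section ThinKac

variable {n : ℕ}

/-- The supercharacter of a purely even `gl(n)`-module. -/
def GLRep.ch (V : GLRep n) : Laurent n := schOf 1 V.torus

/-- The pairs `i < j`, which index the roots `-(ε_i + ε_j)` of `g₋₁`. -/
abbrev Pairs (n : ℕ) : Type := {p : Fin n × Fin n // p.1 < p.2}

/-- The weight `-(ε_i + ε_j)`. -/
def negRoot (i j : Fin n) : Fin n → ℤ := -(Pi.single i 1 + Pi.single j 1)

/-- The product of `1 - x_i⁻¹ x_j⁻¹` over all `i < j`, the supercharacter of `Λ(g₋₁)`. -/
def denom (n : ℕ) : Laurent n :=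
  ∏ p : Pairs n, (1 - AddMonoidAlgebra.single (negRoot p.1.1 p.1.2) 1)

/-- Coordinates on the antisymmetric matrices: the entries above the diagonal. -/
def skewEquiv (n : ℕ) : skewMat n ≃ₗ[ℂ] (Pairs n → ℂ) where
  toFun C p := (C : Matrix (Fin n) (Fin n) ℂ) p.1.1 p.1.2
  map_add' _ _ := rfl
  map_smul' _ _ := rfl
  invFun f := ⟨Matrix.of fun i j => if h : i < j then f ⟨(i, j), h⟩ else
      if h : j < i then -f ⟨(j, i), h⟩ else 0, by
    change Matrix.transpose _ = _
    ext i j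
    rcases lt_trichotomy i j with h | h | h
    · simp [h, h.not_gt]
    · simp [h]
    · simp [h, h.not_gt]⟩
  left_inv C := by
    have hC : ∀ i j, (C : Matrix (Fin n) (Fin n) ℂ) j i = -(C : Matrix (Fin n) (Fin n) ℂ) i j :=
      fun i j => congrFun (congrFun (skewMat_transpose C) i) j
    apply Subtype.ext
    ext i j
    rcases lt_trichotomy i j with h | h | h
    · simp [h]
    · subst h
      have := hC i i
      simp [self_eq_neg.mp this]
    · simp [h, h.not_gt, hC i j]
  right_inv f := by
    funext p
    simp [p.2]

/-- The basis of root vectors of `g₋₁`. -/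
def skewBasis (n : ℕ) : Module.Basis (Pairs n) ℂ (skewMat n) :=
  Module.Basis.ofEquivFun (skewEquiv n)

theorem skewBasis_mem (p : Pairs n) :
    skewBasis n p ∈ wtOf (fun h => skewAct n (Matrix.diagonal h)) (negRoot p.1.1 p.1.2) := by
  rw [mem_wtOf]
  intro h
  apply (skewEquiv n).injective
  have e : skewBasis n p = (skewEquiv n).symm (Pi.single p 1) := by
    simp [skewBasis, Module.Basis.coe_ofEquivFun]
  have he : skewEquiv n (skewBasis n p) = Pi.single p 1 := by rw [e, LinearEquiv.apply_symm_apply]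
  have hq : ∀ C : skewMat n, ∀ q : Pairs n, skewEquiv n (skewAct n (Matrix.diagonal h) C) q =
      -(h q.1.1 + h q.1.2) * skewEquiv n C q := fun C q => by
    change (skewAct n (Matrix.diagonal h) C : Matrix (Fin n) (Fin n) ℂ) q.1.1 q.1.2 =
      -(h q.1.1 + h q.1.2) * (C : Matrix (Fin n) (Fin n) ℂ) q.1.1 q.1.2
    rw [skewAct_coe]
    simp [Matrix.diagonal_mul, Matrix.mul_diagonal]
    ring
  funext q
  refine (hq _ q).trans ?_
  rw [map_smul, he]
  have hs : ∑ i, h i * ((negRoot p.1.1 p.1.2 i : ℤ) : ℂ) = -(h p.1.1 + h p.1.2) := by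
    simp [negRoot, Pi.single_apply, mul_add, Finset.sum_add_distrib]
  by_cases hpq : q = p
  · subst hpq
    rw [hs]; rfl
  · simp [hpq]

variable {V : GLRep n} {J : Type}

theorem exists_kac_weightBasis (B : WeightBasis 1 V.torus J) :
    ∃ B' : WeightBasis (kac V).parity (fun h => (kac V).act (cartan h)) (Finset (Pairs n) × J),
      ∀ S j, B'.wt (S, j) = ∑ p ∈ S, negRoot p.1.1 p.1.2 + B.wt j ∧
        B'.sg (S, j) = (-1) ^ S.card := by
  let _ : LinearOrder (Pairs n) :=
    LinearOrder.lift' (fun p : Pairs n => toLex p.1) fun _ _ h => Subtype.ext h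
  obtain ⟨B₁, h₁⟩ := exists_fock_weightBasis (U := skewRep n) (V := V) (skewBasis n)
    (fun p : Pairs n => negRoot p.1.1 p.1.2) skewBasis_mem B.basis B.wt (fun j => (B.mem j).1)
  refine ⟨⟨B₁.basis, B₁.wt, B₁.sg, fun i => ?_⟩, h₁⟩
  have e : (fun h => (kac V).act (cartan h)) = fun h => fockAct (skewRep n) V (Matrix.diagonal h) :=
    funext fun h => kacAct_even V (homogeneous_zero_iff.mpr ⟨rfl, rfl⟩)
  rw [e]
  exact B₁.mem i

/-- The supercharacter of an exterior algebra on odd vectors of weights `β p`. -/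
theorem sum_signed_subsets {I : Type} [Fintype I] (β : I → Fin n → ℤ) :
    ∑ S : Finset I, AddMonoidAlgebra.single (∑ p ∈ S, β p) (((-1) ^ S.card : ℤˣ) : ℤ) =
      ∏ p, (1 - AddMonoidAlgebra.single (β p) 1 : Laurent n) := by
  classical
  have h : ∀ S : Finset I, (AddMonoidAlgebra.single (∑ p ∈ S, β p) (((-1) ^ S.card : ℤˣ) : ℤ) :
      Laurent n) = ∏ p ∈ S, AddMonoidAlgebra.single (β p) (-1) := by
    intro S
    induction S using Finset.induction_on with
    | empty => simp; rfl
    | insert a S ha ih =>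
      rw [Finset.sum_insert ha, Finset.prod_insert ha, Finset.card_insert_of_notMem ha, ← ih,
        AddMonoidAlgebra.single_mul_single, pow_succ']
      simp
  have h' : ∀ p, (1 - AddMonoidAlgebra.single (β p) 1 : Laurent n) =
      1 + AddMonoidAlgebra.single (β p) (-1) := fun p => by
    rw [AddMonoidAlgebra.single_neg, sub_eq_add_neg]
  simp_rw [h, h']
  rw [Finset.prod_one_add, Finset.powerset_univ]

/-- A linear isomorphism compatible with parity and torus transports weight bases. -/
def WeightBasis.map {V V' : Type} [AddCommGroup V] [Module ℂ V] [AddCommGroup V'] [Module ℂ V']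
    {P : Module.End ℂ V} {H : (Fin n → ℂ) → Module.End ℂ V} {P' : Module.End ℂ V'}
    {H' : (Fin n → ℂ) → Module.End ℂ V'} {ι : Type} (B : WeightBasis P H ι) (Φ : V ≃ₗ[ℂ] V')
    (hP : ∀ v, Φ (P v) = P' (Φ v)) (hH : ∀ h v, Φ (H h v) = H' h (Φ v)) :
    WeightBasis P' H' ι where
  basis := B.basis.map Φ
  wt := B.wt
  sg := B.sg
  mem i := by
    have := mem_gr.mp (B.mem i)
    rw [Module.Basis.map_apply, mem_gr]
    exact ⟨fun h => by rw [← hH, this.1, map_smul], by rw [← hP, this.2, map_smul]⟩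

theorem PRep.sch_eq (M : PRep n) : M.sch = schOf M.parity fun h => M.act (cartan h) := rfl

theorem PRep.isIntegrable_of_weightBasis {M : PRep n} {ι : Type} [Fintype ι]
    {P : Module.End ℂ M.carrier} (B : WeightBasis P (fun h => M.act (cartan h)) ι) :
    M.IsIntegrable :=
  ⟨Module.Finite.of_basis B.basis, B.iSup_wtOf⟩

theorem PRep.IsIntegrable.exists_weightBasis {M : PRep n} (hM : M.IsIntegrable) :
    ∃ (ι : Type) (_ : Fintype ι),
      Nonempty (WeightBasis M.parity (fun h => M.act (cartan h)) ι) := by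
  have := hM.1
  refine Periplectic.exists_weightBasis M.parity_sq (fun h => ?_) hM.2
  have := M.parity_act 0 (cartan h) (homogeneous_zero_iff.mpr ⟨rfl, rfl⟩)
  rwa [sign_zero_left, one_smul] at this

/-- The supercharacter of the induced module is that of `Λ(g₋₁) ⊗ V`. -/
theorem ind_sch [Fintype J] (B : WeightBasis 1 V.torus J) :
    (ind V).IsIntegrable ∧ (ind V).sch = denom n * V.ch := by
  obtain ⟨B', hB'⟩ := exists_kac_weightBasis B
  obtain ⟨Φ, hΦ, hΦ'⟩ := exists_kac_equiv V
  let B'' : WeightBasis (ind V).parity (fun h => (ind V).act (cartan h)) _ :=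
    B'.map Φ hΦ' fun h => hΦ (cartan h)
  refine ⟨PRep.isIntegrable_of_weightBasis B'', ?_⟩
  have hsg : ∀ j, B.sg j = 1 := fun j => by
    have h := (mem_gr.mp (B.mem j)).2
    rw [Module.End.one_apply] at h
    have h0 : (1 - ((B.sg j : ℤ) : ℂ)) • B.basis j = 0 := by rw [sub_smul, one_smul, ← h, sub_self]
    have h1 := sub_eq_zero.mp ((smul_eq_zero.mp h0).resolve_right (B.basis.ne_zero j))
    exact Units.ext (Int.cast_injective (α := ℂ) (by rw [← h1]; simp))
  rw [PRep.sch_eq, B''.schOf_eq, GLRep.ch, B.schOf_eq, denom, ← sum_signed_subsets,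
    Fintype.sum_prod_type, Finset.sum_mul_sum]
  refine Finset.sum_congr rfl fun S _ => Finset.sum_congr rfl fun j _ => ?_
  have e1 : B''.wt (S, j) = _ := (hB' S j).1
  have e2 : B''.sg (S, j) = _ := (hB' S j).2
  rw [e1, e2, AddMonoidAlgebra.single_mul_single, hsg]
  simp

theorem schOf_neg {V : Type} [AddCommGroup V] [Module ℂ V] (P : Module.End ℂ V)
    (H : (Fin n → ℂ) → Module.End ℂ V) : schOf (-P) H = -schOf P H := by
  rw [schOf, schOf, ← finsum_neg_distrib]
  refine finsum_congr fun μ => ?_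
  have h1 : LinearMap.ker (-P - 1) = LinearMap.ker (P + 1) := by
    ext v
    simp only [LinearMap.mem_ker, LinearMap.sub_apply, LinearMap.neg_apply, LinearMap.add_apply]
    rw [← neg_eq_zero, neg_sub, sub_neg_eq_add, add_comm]
  have h2 : LinearMap.ker (-P + 1) = LinearMap.ker (P - 1) := by
    ext v
    simp only [LinearMap.mem_ker, LinearMap.sub_apply, LinearMap.neg_apply, LinearMap.add_apply]
    rw [← neg_eq_zero, neg_add, neg_neg, sub_eq_add_neg]
  rw [sdimOf, sdimOf, h1, h2, ← AddMonoidAlgebra.single_neg, neg_sub]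

theorem PRep.sch_parityShift (M : PRep n) : M.parityShift.sch = -M.sch := schOf_neg _ _

theorem PRep.sch_parityShift_iterate (M : PRep n) (k : ℕ) :
    (PRep.parityShift^[k] M).sch = (-1) ^ k * M.sch ∧
      ((PRep.parityShift^[k] M).IsIntegrable ↔ M.IsIntegrable) := by
  induction k with
  | zero => simp
  | succ k ih =>
    rw [Function.iterate_succ_apply', PRep.sch_parityShift, ih.1]
    exact ⟨by ring, ih.2⟩

/-- The sign depends on the parity shifts in the definition of the thin Kac module, and does not
matter for the span. -/
theorem thinKac_sch [Fintype J] (wt : Fin n → ℤ) (B : WeightBasis 1 V.torus J) :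
    (thinKac wt V).IsIntegrable ∧
      ((thinKac wt V).sch = denom n * V.ch ∨ (thinKac wt V).sch = -(denom n * V.ch)) := by
  obtain ⟨h1, h2⟩ := ind_sch B
  rw [thinKac, (PRep.sch_parityShift_iterate _ _).1, (PRep.sch_parityShift_iterate _ _).1,
    (PRep.sch_parityShift_iterate _ _).2, (PRep.sch_parityShift_iterate _ _).2, h2, ← mul_assoc,
    ← pow_add]
  refine ⟨h1, ?_⟩
  rcases neg_one_pow_eq_or (Laurent n) (n * (n - 1) / 2 + (weightParity wt).val) with h | h
  · left; rw [h, one_mul]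
  · right; rw [h, neg_one_mul]

end ThinKac

/-! ### Invariance of characters under the symmetric group -/

section Exponential

variable {A : Type} [Ring A] [Algebra ℂ A]

/-- The truncated exponential series `∑_{i < N} Eⁱ / i!`. -/
def texp (E : A) (N : ℕ) : A := ∑ i ∈ Finset.range N, ((i.factorial : ℂ)⁻¹) • E ^ i

/-- Conjugation by the exponential of a nilpotent `E` takes `X` to `X + [E, X] + [E, [E, X]] / 2`, if
the triple bracket vanishes. The truncation is two steps beyond the order of nilpotency, so that
the shifted sums agree. -/
theorem texp_mul (E X Y Z : A) {N : ℕ} (hN : E ^ N = 0) (hX : E * X = X * E + Y)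
    (hY : E * Y = Y * E + (2 : ℂ) • Z) (hZ : E * Z = Z * E) :
    texp E (N + 2) * X = (X + Y + Z) * texp E (N + 2) := by
  let e : ℕ → A := fun i => ((i.factorial : ℂ)⁻¹) • E ^ i
  have he : ∀ i, E * e i = ((i : ℂ) + 1) • e (i + 1) := fun i => by
    simp only [e]
    rw [mul_smul_comm, ← pow_succ', smul_smul, Nat.factorial_succ]
    congr 1
    have h1 : ((i : ℂ) + 1) ≠ 0 := by exact_mod_cast Nat.succ_ne_zero i
    have h2 : ((i.factorial : ℂ)) ≠ 0 := by exact_mod_cast Nat.factorial_ne_zero i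
    push_cast
    field_simp
  have h0 : e 0 = 1 := by simp [e]
  have h1 : e 1 = E := by simp [e]
  have key : ∀ i, e (i + 2) * X = X * e (i + 2) + Y * e (i + 1) + Z * e i := by
    have step : ∀ (i : ℕ) (W : A), ((i : ℂ) + 1) • (e (i + 1) * X) = ((i : ℂ) + 1) • W →
        e (i + 1) * X = W := fun i W h => by
      have h1 : ((i : ℂ) + 1) ≠ 0 := by exact_mod_cast Nat.succ_ne_zero i
      exact (smul_right_injective A h1) h
    intro i
    induction i with
    | zero =>
      apply step
      rw [← smul_mul_assoc, ← he, mul_assoc, h1, hX, mul_add, ← mul_assoc, hX, hY, add_mul,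
        h0, smul_add, smul_add, ← mul_smul_comm, ← he 1, h1, ← mul_assoc]
      push_cast
      rw [mul_one]
      module
    | succ i ih =>
      apply step
      have e2 : E * e (i + 2) = ((i : ℂ) + 3) • e (i + 3) := by
        rw [he]; push_cast; congr 1; ring
      have e1 : E * e (i + 1) = ((i : ℂ) + 2) • e (i + 2) := by
        rw [he]; push_cast; congr 1; ring
      have e0 := he i
      clear_value e
      rw [← smul_mul_assoc, ← he, mul_assoc, ih, mul_add, mul_add, ← mul_assoc, ← mul_assoc,
        ← mul_assoc, hX, hY, hZ, add_mul, add_mul, mul_assoc X, mul_assoc Y, mul_assoc Z, e2, e1,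
        e0, mul_smul_comm, mul_smul_comm, mul_smul_comm, smul_mul_assoc]
      change _ = (((i + 2 : ℕ) : ℂ) + 1) • (X * e (i + 3) + Y * e (i + 2) + Z * e (i + 1))
      push_cast
      module
  have hzero : ∀ i, N ≤ i → e i = 0 := fun i hi => by
    simp only [e]
    rw [pow_eq_zero_of_le hi hN, smul_zero]
  have hs : ∀ k, texp E k = ∑ i ∈ Finset.range k, e i := fun _ => rfl
  have hs1 : texp E (N + 1) = texp E (N + 2) := by
    rw [hs (N + 2), Finset.sum_range_succ, hzero (N + 1) (by omega), add_zero, hs]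
  have hs0 : texp E N = texp E (N + 2) := by
    rw [← hs1, hs (N + 1), Finset.sum_range_succ, hzero N le_rfl, add_zero, hs]
  have hl : texp E (N + 2) = e 0 + e 1 + ∑ i ∈ Finset.range N, e (i + 2) := by
    rw [hs, Finset.sum_range_succ', Finset.sum_range_succ']
    abel
  have hm : texp E (N + 1) = e 0 + ∑ i ∈ Finset.range N, e (i + 1) := by
    rw [hs, Finset.sum_range_succ']
    abel
  calc texp E (N + 2) * X
      = e 0 * X + e 1 * X + ∑ i ∈ Finset.range N, e (i + 2) * X := by
        rw [hl, add_mul, add_mul, Finset.sum_mul]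
    _ = X * (e 0 + e 1 + ∑ i ∈ Finset.range N, e (i + 2)) +
          Y * (e 0 + ∑ i ∈ Finset.range N, e (i + 1)) + Z * ∑ i ∈ Finset.range N, e i := by
        simp_rw [key, Finset.sum_add_distrib, mul_add, Finset.mul_sum]
        rw [h0, h1, hX, one_mul, mul_one, mul_one]
        abel
    _ = (X + Y + Z) * texp E (N + 2) := by
        rw [← hl, ← hm, ← hs, hs1, hs0, add_mul, add_mul]

theorem isUnit_texp (E : A) {N : ℕ} (hN : E ^ N = 0) : IsUnit (texp E (N + 1)) := by
  have : texp E (N + 1) =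
      1 + E * ∑ i ∈ Finset.range N, (((i + 1).factorial : ℂ)⁻¹) • E ^ i := by
    rw [texp, Finset.sum_range_succ', Finset.mul_sum, add_comm]
    congr 1
    · simp
    · exact Finset.sum_congr rfl fun i _ => by rw [mul_smul_comm, pow_succ']
  rw [this]
  apply IsNilpotent.isUnit_one_add
  refine Commute.isNilpotent_mul_right ?_ ⟨N, hN⟩
  exact Commute.sum_right _ _ _ fun i _ => ((Commute.refl E).pow_right i).smul_right _

theorem commute_texp {P E : A} (h : Commute P E) (N : ℕ) : Commute P (texp E N) :=
  Commute.sum_right _ _ _ fun i _ => (h.pow_right i).smul_right _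

/-- For an `sl₂`-triple `E, F, H` of nilpotent `E` and `F`, the simple reflection is induced by the
invertible operator `exp(E) exp(-F) exp(E)`. -/
theorem exists_reflection {E F H : A} (hE : IsNilpotent E) (hF : IsNilpotent F)
    (hEF : E * F - F * E = H) (hHE : H * E - E * H = (2 : ℂ) • E)
    (hHF : H * F - F * H = (-2 : ℂ) • F) :
    ∃ w : A, IsUnit w ∧ (∀ P, Commute P E → Commute P F → Commute P w) ∧
      ∀ (D : A) (a : ℂ), D * E - E * D = a • E → D * F - F * D = -a • F →
        w * D = (D - a • H) * w := by
  obtain ⟨N, hN⟩ := hE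
  obtain ⟨M, hM⟩ := hF
  have hM' : (-F) ^ M = 0 := by rw [neg_pow, hM, mul_zero]
  set x := texp E (N + 2) with hx
  set y := texp (-F) (M + 2) with hy
  have hxu : IsUnit x := isUnit_texp E (N := N + 1) (pow_eq_zero_of_le (by omega) hN)
  have hyu : IsUnit y := isUnit_texp (-F) (N := M + 1) (pow_eq_zero_of_le (by omega) hM')
  refine ⟨x * y * x, (hxu.mul hyu).mul hxu, fun P hPE hPF => ?_, fun D a hDE hDF => ?_⟩
  · have h1 : Commute P x := commute_texp hPE _
    have h2 : Commute P y := commute_texp hPF.neg_right _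
    exact (h1.mul_right h2).mul_right h1
  · have xD : x * D = (D - a • E) * x := by
      have := texp_mul E D (-(a • E)) 0 hN (by rw [← hDE]; abel)
        (by rw [smul_zero, add_zero, mul_neg, neg_mul, mul_smul_comm, smul_mul_assoc]) (by simp)
      rw [this, add_zero, sub_eq_add_neg]
    have xE : x * E = E * x := by
      have := texp_mul E E 0 0 hN (by simp) (by simp) (by simp)
      rw [this, add_zero, add_zero]
    have xH : x * H = (H - (2 : ℂ) • E) * x := by
      have := texp_mul E H (-((2 : ℂ) • E)) 0 hN (by rw [← hHE]; abel)
        (by rw [smul_zero, add_zero, mul_neg, neg_mul, mul_smul_comm, smul_mul_assoc]) (by simp)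
      rw [this, add_zero, sub_eq_add_neg]
    have yD : y * D = (D - a • F) * y := by
      have := texp_mul (-F) D (-(a • F)) 0 hM' (by rw [← neg_smul, ← hDF, mul_neg, neg_mul]; abel)
        (by simp) (by simp)
      rw [this, add_zero, sub_eq_add_neg]
    have yE : y * E = (E + H - F) * y := by
      have := texp_mul (-F) E H (-F) hM' (by rw [← hEF, mul_neg, neg_mul]; abel)
        (by rw [smul_neg, ← neg_smul, ← hHF, mul_neg, neg_mul]; abel) (by simp)
      rw [this, ← sub_eq_add_neg]
    have e1 : y * (D - a • E) = (D - a • E - a • H) * y := by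
      rw [mul_sub, mul_smul_comm, yD, yE, ← smul_mul_assoc, ← sub_mul]
      congr 1
      module
    have e2 : x * (D - a • E - a • H) = (D - a • H) * x := by
      rw [mul_sub, mul_sub, mul_smul_comm, mul_smul_comm, xD, xE, xH, ← smul_mul_assoc,
        ← smul_mul_assoc, ← sub_mul, ← sub_mul]
      congr 1
      module
    rw [mul_assoc, xD, ← mul_assoc, mul_assoc x y, e1, ← mul_assoc, e2, mul_assoc, mul_assoc,
      mul_assoc]

end Exponential

section Weyl

variable {n : ℕ} (V : GLRep n)

/-- The matrix unit `E_ij` shifts weights by the root `ε_i - ε_j`. -/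
theorem GLRep.act_single_mem {i j : Fin n} {μ : Fin n → ℤ} {v : V.carrier}
    (hv : v ∈ wtOf V.torus μ) :
    V.act (Matrix.single i j 1) v ∈ wtOf V.torus (μ + Pi.single i 1 - Pi.single j 1) := by
  rw [mem_wtOf] at hv ⊢
  intro h
  have h1 := LinearMap.congr_fun (V.act_lie (Matrix.diagonal h) (Matrix.single i j 1)) v
  have e : Matrix.diagonal h * Matrix.single i j (1 : ℂ) - Matrix.single i j 1 * Matrix.diagonal h =
      (h i - h j) • Matrix.single i j 1 := by
    ext a b
    simp only [Matrix.sub_apply, Matrix.diagonal_mul, Matrix.mul_diagonal, Matrix.smul_apply,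
      Matrix.single_apply, smul_eq_mul]
    split_ifs with hab
    · obtain ⟨rfl, rfl⟩ := hab; ring
    · ring
  rw [e, map_smul] at h1
  simp only [LinearMap.smul_apply, LinearMap.sub_apply, Module.End.mul_apply] at h1
  have h2 := hv h
  rw [GLRep.torus] at h2 ⊢
  rw [h2, map_smul] at h1
  rw [sub_eq_iff_eq_add.mp h1.symm, ← add_smul]
  congr 1
  simp [mul_add, mul_sub, Finset.sum_add_distrib, Pi.single_apply]
  ring

theorem GLRep.act_single_pow_mem {i j : Fin n} {μ : Fin n → ℤ} {v : V.carrier}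
    (hv : v ∈ wtOf V.torus μ) (k : ℕ) :
    (V.act (Matrix.single i j 1) ^ k) v ∈
      wtOf V.torus (μ + (k : ℤ) • (Pi.single i 1 - Pi.single j 1)) := by
  induction k with
  | zero => simpa using hv
  | succ k ih =>
    rw [pow_succ', Module.End.mul_apply]
    have := V.act_single_mem (i := i) (j := j) ih
    convert this using 1
    push_cast
    rw [add_smul, one_smul, ← add_assoc, add_sub_assoc]

theorem WeightBasis.eq_zero_of_mem {V : Type} [AddCommGroup V] [Module ℂ V]
    {P : Module.End ℂ V} {H : (Fin n → ℂ) → Module.End ℂ V} {ι : Type} (B : WeightBasis P H ι)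
    {μ : Fin n → ℤ} (hμ : ∀ i, B.wt i ≠ μ) {v : V} (hv : v ∈ wtOf H μ) : v = 0 := by
  -- forgetting the parity, `B` is still a basis of weight vectors
  let B' : WeightBasis 1 H ι := ⟨B.basis, B.wt, fun _ => 1, fun i => mem_gr.mpr
    ⟨(mem_gr.mp (B.mem i)).1, by simp⟩⟩
  have hv' : v ∈ gr 1 H (μ, 1) := mem_gr.mpr ⟨mem_wtOf.mp hv, by simp⟩
  apply B.basis.repr.injective
  rw [map_zero]
  ext i
  exact B'.repr_eq_zero hv' fun h => hμ i (congrArg Prod.fst h)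

variable {V} {P : Module.End ℂ V.carrier} {ι : Type} [Fintype ι]

/-- `E_ij` is nilpotent, since the `i`-th entries of the weights are bounded. -/
theorem GLRep.isNilpotent_act_single (B : WeightBasis P V.torus ι) {i j : Fin n} (hij : i ≠ j) :
    IsNilpotent (V.act (Matrix.single i j 1)) := by
  let K : ℕ := ∑ m, (B.wt m i).natAbs
  have hK : ∀ m, (B.wt m i).natAbs ≤ K := fun m =>
    Finset.single_le_sum (f := fun m => (B.wt m i).natAbs) (fun _ _ => Nat.zero_le _)
      (Finset.mem_univ m)
  refine ⟨2 * K + 1, B.basis.ext fun m => ?_⟩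
  rw [LinearMap.zero_apply]
  refine B.eq_zero_of_mem (fun m' h => ?_)
    (V.act_single_pow_mem (i := i) (j := j) (B.mem m).1 (2 * K + 1))
  have h1 := congrFun h i
  simp only [Pi.add_apply, Pi.smul_apply, Pi.sub_apply, Pi.single_eq_same, smul_eq_mul,
    Pi.single_eq_of_ne hij, sub_zero, mul_one] at h1
  have := hK m
  have := hK m'
  omega

/-- The operator of the reflection in `ε_i - ε_j` takes the weight spaces to their reflections. -/
theorem GLRep.finrank_gr_swap_le (B : WeightBasis P V.torus ι)
    (hP : ∀ A, Commute P (V.act A)) {i j : Fin n} (hij : i ≠ j) (μ : Fin n → ℤ) (ε : ℤˣ) :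
    Module.finrank ℂ (gr P V.torus (μ, ε)) ≤
      Module.finrank ℂ (gr P V.torus (μ ∘ Equiv.swap i j, ε)) := by
  have : FiniteDimensional ℂ V.carrier := Module.Finite.of_basis B.basis
  have hlie : ∀ X Y, V.act X * V.act Y - V.act Y * V.act X = V.act (X * Y - Y * X) :=
    fun X Y => (V.act_lie X Y).symm
  let η : Fin n → ℂ := Pi.single i 1 - Pi.single j 1
  have hd : ∀ (h : Fin n → ℂ) (a b : Fin n), Matrix.diagonal h * Matrix.single a b (1 : ℂ) -
      Matrix.single a b 1 * Matrix.diagonal h = (h a - h b) • Matrix.single a b 1 := by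
    intro h a b
    ext k l
    simp only [Matrix.sub_apply, Matrix.diagonal_mul, Matrix.mul_diagonal, Matrix.smul_apply,
      Matrix.single_apply, smul_eq_mul]
    split_ifs with hab
    · obtain ⟨rfl, rfl⟩ := hab; ring
    · ring
  have hη : Matrix.single i j (1 : ℂ) * Matrix.single j i 1 -
      Matrix.single j i 1 * Matrix.single i j 1 = Matrix.diagonal η := by
    rw [Matrix.single_mul_single_same, Matrix.single_mul_single_same, mul_one]
    ext k l
    by_cases hkl : k = l
    · subst hkl
      simp [η, Matrix.single_apply, Pi.single_apply, eq_comm]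
    · have h1 : ∀ a : Fin n, ¬ (a = k ∧ a = l) := fun a h => hkl (h.1.symm.trans h.2)
      simp [hkl, h1]
  obtain ⟨w, hw, hwP, hwD⟩ := exists_reflection (A := Module.End ℂ V.carrier)
    (E := V.act (Matrix.single i j 1)) (F := V.act (Matrix.single j i 1))
    (H := V.act (Matrix.diagonal η))
    (GLRep.isNilpotent_act_single B hij) (GLRep.isNilpotent_act_single B hij.symm)
    (by rw [hlie, hη])
    (by
      rw [hlie, hd, map_smul]
      congr 1
      simp [η, hij, hij.symm]; norm_num)
    (by
      rw [hlie, hd, map_smul]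
      congr 1
      simp [η, hij, hij.symm]; norm_num)
  have hwPP : Commute P w := hwP P (hP _) (hP _)
  have hwinj : Function.Injective w := ((Module.End.isUnit_iff w).mp hw).1
  have hmaps : ∀ v ∈ gr P V.torus (μ, ε), w v ∈ gr P V.torus (μ ∘ Equiv.swap i j, ε) := by
    intro v hv
    rw [mem_gr] at hv ⊢
    refine ⟨fun h => ?_, ?_⟩
    · let h' : Fin n → ℂ := h ∘ Equiv.swap i j
      have e1 := hwD (V.act (Matrix.diagonal h')) (h' i - h' j)
        (by rw [hlie, hd, map_smul]) (by rw [hlie, hd, map_smul, neg_sub])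
      have e2 : V.act (Matrix.diagonal h') - (h' i - h' j) • V.act (Matrix.diagonal η) =
          V.act (Matrix.diagonal h) := by
        rw [← map_smul, ← map_sub, ← Matrix.diagonal_smul, Matrix.diagonal_sub]
        congr 2
        funext k
        simp only [h', η, Function.comp_apply, Pi.smul_apply, Pi.sub_apply, smul_eq_mul,
          Equiv.swap_apply_left, Equiv.swap_apply_right]
        by_cases hki : k = i
        · subst hki; simp [hij]
        · by_cases hkj : k = j
          · subst hkj; simp [hki]
          · simp [hki, hkj, Equiv.swap_apply_of_ne_of_ne hki hkj]
      rw [e2] at e1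
      have e3 := LinearMap.congr_fun e1 v
      rw [Module.End.mul_apply, Module.End.mul_apply] at e3
      have e4 := hv.1 h'
      rw [GLRep.torus] at e4 ⊢
      rw [← e3, e4, map_smul]
      congr 1
      rw [← Equiv.sum_comp (Equiv.swap i j) fun k => h' k * (μ k : ℂ)]
      refine Finset.sum_congr rfl fun k _ => ?_
      simp [h']
    · have := LinearMap.congr_fun hwPP.eq v
      rw [Module.End.mul_apply, Module.End.mul_apply] at this
      rw [this, hv.2, map_smul]
  exact LinearMap.finrank_le_finrank_of_injective (f := w.restrict hmaps)
    (fun a b hab => Subtype.ext (hwinj (congrArg Subtype.val hab)))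

/-- The homogeneous parts of weights in one orbit of the symmetric group are isomorphic. -/
theorem GLRep.finrank_gr_perm (B : WeightBasis P V.torus ι)
    (hP : ∀ A, Commute P (V.act A)) (σ : Equiv.Perm (Fin n)) (μ : Fin n → ℤ) (ε : ℤˣ) :
    Module.finrank ℂ (gr P V.torus (μ ∘ σ, ε)) = Module.finrank ℂ (gr P V.torus (μ, ε)) := by
  induction σ using Equiv.Perm.swap_induction_on' with
  | one => rfl
  | mul_swap f x y hxy ih =>
    rw [← ih]
    have e : μ ∘ ⇑(f * Equiv.swap x y) = (μ ∘ f) ∘ Equiv.swap x y := rfl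
    rw [e]
    apply le_antisymm
    · have := GLRep.finrank_gr_swap_le B hP hxy ((μ ∘ f) ∘ Equiv.swap x y) ε
      have e' : ((μ ∘ f) ∘ Equiv.swap x y) ∘ Equiv.swap x y = μ ∘ f := by
        funext k; simp
      rwa [e'] at this
    · exact GLRep.finrank_gr_swap_le B hP hxy _ ε

/-- The coefficients of a supercharacter are the superdimensions. -/
theorem WeightBasis.coeff_schOf {V : Type} [AddCommGroup V] [Module ℂ V]
    {P : Module.End ℂ V} {H : (Fin n → ℂ) → Module.End ℂ V} (B : WeightBasis P H ι)
    (μ : Fin n → ℤ) : (schOf P H).coeff μ = sdimOf P H μ := by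
  classical
  rw [B.schOf_eq, B.sdimOf_eq_sum, AddMonoidAlgebra.coeff_sum, Finsupp.finsetSum_apply]
  refine Finset.sum_congr rfl fun i _ => ?_
  rw [AddMonoidAlgebra.coeff_single, Finsupp.single_apply]

/-- The supercharacter of a `gl(n)`-module, with respect to an involution commuting with the action,
is symmetric. -/
theorem GLRep.coeff_schOf_perm (B : WeightBasis P V.torus ι)
    (hP : ∀ A, Commute P (V.act A)) (σ : Equiv.Perm (Fin n)) (μ : Fin n → ℤ) :
    (schOf P V.torus).coeff (μ ∘ σ) = (schOf P V.torus).coeff μ := by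
  rw [B.coeff_schOf, B.coeff_schOf, sdimOf_eq, sdimOf_eq, GLRep.finrank_gr_perm B hP,
    GLRep.finrank_gr_perm B hP]

/-- The restriction of a `p(n)`-module to `gl(n)`. -/
def PRep.res (M : PRep n) : GLRep n where
  carrier := M.carrier
  act :=
    { toFun := fun A => M.act (ofBlocks A 0 0)
      map_add' := fun A A' => by
        rw [← map_add]
        congr 1
        apply Subtype.ext
        simp [ofBlocks_coe, Matrix.fromBlocks_add, add_comm]
      map_smul' := fun r A => by
        rw [RingHom.id_apply, ← map_smul]
        congr 1
        apply Subtype.ext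
        simp [ofBlocks_coe, Matrix.fromBlocks_smul] }
  act_lie X Y := by
    have hX : ∀ A : Matrix (Fin n) (Fin n) ℂ, IsHomogeneous 0 (ofBlocks A 0 0 : SMat n) :=
      fun A => homogeneous_zero_iff.mpr ⟨rfl, rfl⟩
    have h := M.act_bracket 0 0 _ _ (hX X) (hX Y)
    rw [bracket_even_even (hX X) (hX Y), sign_zero_left, one_smul] at h
    exact h

/-- Supercharacters of `p(n)`-modules are symmetric. -/
theorem PRep.IsIntegrable.coeff_sch_perm {M : PRep n} (hM : M.IsIntegrable)
    (σ : Equiv.Perm (Fin n)) (μ : Fin n → ℤ) : M.sch.coeff (μ ∘ σ) = M.sch.coeff μ := by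
  obtain ⟨ι, _, ⟨B⟩⟩ := hM.exists_weightBasis
  have e : (fun h => M.act (cartan h)) = M.res.torus := by
    funext h
    change M.act _ = M.act _
    congr 1
  rw [PRep.sch_eq]
  have B' : WeightBasis (V := M.carrier) M.parity M.res.torus ι := e ▸ B
  have := GLRep.coeff_schOf_perm (V := M.res) (P := M.parity) B' (fun A => by
    have := M.parity_act 0 (ofBlocks A 0 0) (homogeneous_zero_iff.mpr ⟨rfl, rfl⟩)
    rw [sign_zero_left, one_smul] at this
    exact this) σ μ
  rw [e]
  exact this

end Weyl

/-! ### Simple modules of dominant highest weight -/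

section Constructions

variable {n : ℕ}

/-- The trace representation of `gl(n)` of weight `c (ε₁ + ⋯ + ε_n)`. -/
def traceRep (n : ℕ) (c : ℤ) : GLRep n where
  carrier := ℂ
  act := (((c : ℂ) • Matrix.traceLinearMap (Fin n) ℂ ℂ).smulRight (1 : Module.End ℂ ℂ))
  act_lie X Y := by
    ext
    simp [Matrix.trace_mul_comm X Y]
    ring

/-- The natural representation of `gl(n)` on `ℂⁿ`. -/
def naturalRep (n : ℕ) : GLRep n where
  carrier := Fin n → ℂ
  act := (Matrix.toLin' : Matrix (Fin n) (Fin n) ℂ ≃ₗ[ℂ] _).toLinearMap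
  act_lie X Y := by
    simp only [LinearEquiv.coe_coe, map_sub, Matrix.toLin'_mul]
    rfl

/-- The tensor product of two representations of `gl(n)`. -/
def GLRep.tensor (U V : GLRep n) : GLRep n where
  carrier := U.carrier ⊗[ℂ] V.carrier
  act :=
    { toFun := fun A => (U.act A).rTensor V.carrier + (V.act A).lTensor U.carrier
      map_add' := fun A B => by
        rw [map_add, map_add, LinearMap.rTensor_add, LinearMap.lTensor_add]; abel
      map_smul' := fun c A => by
        rw [map_smul, map_smul, LinearMap.rTensor_smul, LinearMap.lTensor_smul, RingHom.id_apply,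
          smul_add] }
  act_lie X Y := by
    apply TensorProduct.ext'
    intro u v
    change (U.act _).rTensor _ (u ⊗ₜ v) + (V.act _).lTensor _ (u ⊗ₜ v) = _
    rw [U.act_lie, V.act_lie]
    simp only [LinearMap.rTensor_sub, LinearMap.lTensor_sub, LinearMap.sub_apply,
      Module.End.mul_apply, LinearMap.add_apply, map_add, LinearMap.rTensor_tmul,
      LinearMap.lTensor_tmul, LinearMap.coe_mk, AddHom.coe_mk]
    abel

/-- The restriction of a representation to a stable subspace. -/
def GLRep.sub (V : GLRep n) (W : Submodule ℂ V.carrier) (hW : ∀ X, ∀ v ∈ W, V.act X v ∈ W) :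
    GLRep n where
  carrier := W
  act :=
    { toFun := fun A => (V.act A).restrict (hW A)
      map_add' := fun A B => by ext v; simp
      map_smul' := fun c A => by ext v; simp }
  act_lie X Y := by
    ext v
    simp [V.act_lie]

/-- The quotient of a representation by a stable subspace. -/
def GLRep.quot (V : GLRep n) (W : Submodule ℂ V.carrier) (hW : ∀ X, ∀ v ∈ W, V.act X v ∈ W) :
    GLRep n where
  carrier := V.carrier ⧸ W
  act :=
    { toFun := fun A => W.mapQ W (V.act A) (hW A)
      map_add' := fun A B => by
        apply Submodule.linearMap_qext
        ext v; simp
      map_smul' := fun c A => by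
        apply Submodule.linearMap_qext
        ext v; simp }
  act_lie X Y := by
    apply Submodule.linearMap_qext
    ext v
    simp [V.act_lie]

/-- `v` is a nonzero vector of weight `μ` killed by the strictly upper triangular matrices. -/
structure GLRep.IsHighest (V : GLRep n) (μ : Fin n → ℤ) (v : V.carrier) : Prop where
  ne_zero : v ≠ 0
  raising : ∀ i j, i < j → V.act (Matrix.single i j 1) v = 0
  weight : ∀ i, V.act (Matrix.single i i 1) v = (μ i : ℂ) • v

/-- `μ` is the weight of a highest weight vector of some finite-dimensional representation. -/
def HasHighest (μ : Fin n → ℤ) : Prop :=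
  ∃ V : GLRep n, FiniteDimensional ℂ V.carrier ∧ ∃ v, V.IsHighest μ v

theorem HasHighest.add {μ ν : Fin n → ℤ} (hμ : HasHighest μ) (hν : HasHighest ν) :
    HasHighest (μ + ν) := by
  obtain ⟨U, hU, u, hu⟩ := hμ
  obtain ⟨V, hV, v, hv⟩ := hν
  have e : ∀ A, (U.tensor V).act A (u ⊗ₜ[ℂ] v) = U.act A u ⊗ₜ v + u ⊗ₜ V.act A v := fun _ => rfl
  refine ⟨U.tensor V, inferInstanceAs (FiniteDimensional ℂ (U.carrier ⊗[ℂ] V.carrier)),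
    (u ⊗ₜ v : U.carrier ⊗[ℂ] V.carrier), ?_, fun i j hij => ?_, fun i => ?_⟩
  · intro h
    obtain ⟨f, hf⟩ := not_forall.mp (mt (Module.forall_dual_apply_eq_zero_iff ℂ u).mp hu.ne_zero)
    obtain ⟨g, hg⟩ := not_forall.mp (mt (Module.forall_dual_apply_eq_zero_iff ℂ v).mp hv.ne_zero)
    have := congrArg (fun z => TensorProduct.lid ℂ ℂ (TensorProduct.map f g z)) h
    have h0 : TensorProduct.lid ℂ ℂ (TensorProduct.map f g (0 : U.carrier ⊗[ℂ] V.carrier)) = 0 := by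
      simp
    have h1 : TensorProduct.lid ℂ ℂ (TensorProduct.map f g (u ⊗ₜ v)) = f u * g v := by simp
    exact mul_ne_zero hf hg (h1.symm.trans (this.trans h0))
  · rw [e, hu.raising i j hij, hv.raising i j hij]
    exact (congrArg₂ (· + ·) (TensorProduct.zero_tmul _ _) (TensorProduct.tmul_zero _ _)).trans
      (add_zero _)
  · rw [e, hu.weight, hv.weight]
    change ((μ i : ℂ) • u) ⊗ₜ[ℂ] v + u ⊗ₜ[ℂ] ((ν i : ℂ) • v) = (((μ + ν) i : ℤ) : ℂ) • (u ⊗ₜ[ℂ] v)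
    rw [← TensorProduct.smul_tmul', TensorProduct.tmul_smul, ← add_smul]
    push_cast [Pi.add_apply]
    rfl

theorem hasHighest_const (c : ℤ) : HasHighest fun _ : Fin n => c := by
  refine ⟨traceRep n c, inferInstanceAs (FiniteDimensional ℂ ℂ), (1 : ℂ), ?_, fun i j hij => ?_,
    fun i => ?_⟩
  · exact one_ne_zero (α := ℂ)
  · change ((c : ℂ) * Matrix.trace (Matrix.single i j (1 : ℂ))) * (1 : ℂ) = 0
    rw [Matrix.trace_single_eq_of_ne _ _ _ hij.ne, mul_zero, zero_mul]
  · change ((c : ℂ) * Matrix.trace (Matrix.single i i (1 : ℂ))) * (1 : ℂ) = (c : ℂ) * 1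
    rw [Matrix.trace_single_eq_same, mul_one]

theorem mem_wtOf_torus_iff {V : GLRep n} {μ : Fin n → ℤ} {v : V.carrier} :
    v ∈ wtOf V.torus μ ↔ ∀ i, V.act (Matrix.single i i 1) v = (μ i : ℂ) • v := by
  rw [mem_wtOf]
  constructor
  · intro h i
    have := h (Pi.single i 1)
    rw [GLRep.torus, Matrix.diagonal_single] at this
    simpa [Pi.single_apply] using this
  · intro h c
    have : Matrix.diagonal c = ∑ i, c i • Matrix.single i i (1 : ℂ) := by
      ext a b
      simp [Matrix.sum_apply, Matrix.single_apply, Matrix.diagonal_apply, ite_and]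
    rw [GLRep.torus, this, map_sum, LinearMap.sum_apply, Finset.sum_smul]
    refine Finset.sum_congr rfl fun i _ => ?_
    rw [map_smul, LinearMap.smul_apply, h, smul_smul]

/-- The fundamental weights occur in the exterior algebra of the natural representation, where all
weights have entries `0` and `1`. -/
theorem hasHighest_indicator (S : Finset (Fin n)) (hS : ∀ i j, i < j → j ∈ S → i ∈ S) :
    HasHighest fun i => if i ∈ S then 1 else 0 := by
  have hnat : ∀ (i : Fin n) (h : Fin n → ℂ),
      Matrix.toLin' (Matrix.diagonal h) (Pi.basisFun ℂ (Fin n) i) =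
        (∑ j, h j * ((Pi.single i 1 : Fin n → ℤ) j : ℂ)) • Pi.basisFun ℂ (Fin n) i := by
    intro i h
    rw [Matrix.toLin'_apply, Pi.basisFun_apply, Matrix.diagonal_mulVec_single]
    funext k
    by_cases hk : k = i
    · subst hk; simp [Pi.single_apply]
    · simp [hk]
  obtain ⟨B, hB⟩ := exists_fock_weightBasis (U := naturalRep n) (V := traceRep n 0)
    (Pi.basisFun ℂ (Fin n)) (fun i => Pi.single i 1) (fun i => mem_wtOf.mpr (hnat i))
    (Module.Basis.singleton Unit ℂ) (fun _ => 0)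
    (fun _ => mem_wtOf.mpr fun h => by
      change (((0 : ℤ) : ℂ) * Matrix.trace (Matrix.diagonal h)) * _ = (∑ j, h j * ((0 : ℤ) : ℂ)) * _
      simp only [Int.cast_zero, zero_mul, mul_zero, Finset.sum_const_zero]
      exact (zero_mul _).symm)
  let N := fockRep (naturalRep n) (traceRep n 0)
  let B' : WeightBasis (V := N.carrier) _ N.torus _ := B
  have hwt : ∀ (T : Finset (Fin n)) (u : Unit) (i : Fin n),
      B.wt (T, u) i = if i ∈ T then 1 else 0 := fun T u i => by
    rw [(hB T u).1]
    simp [Finset.sum_apply, Pi.single_apply]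
  have hv : B'.basis (S, ()) ∈ wtOf N.torus (fun i => if i ∈ S then 1 else 0) := by
    have := (B'.mem (S, ())).1
    have e : B'.wt (S, ()) = fun i => if i ∈ S then 1 else 0 := funext (hwt S ())
    rwa [e] at this
  refine ⟨N, Module.Finite.of_basis B'.basis, B'.basis (S, ()), B'.basis.ne_zero _,
    fun i j hij => ?_, mem_wtOf_torus_iff.mp hv⟩
  refine B'.eq_zero_of_mem ?_ (N.act_single_mem hv)
  rintro ⟨T, u⟩ h
  have hi := congrFun h i
  have hj := congrFun h j
  have e1 := hwt T u i
  have e2 := hwt T u j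
  change B.wt (T, u) i = _ at hi
  change B.wt (T, u) j = _ at hj
  rw [e1] at hi
  rw [e2] at hj
  simp only [Pi.add_apply, Pi.sub_apply, Pi.single_eq_same, Pi.single_eq_of_ne hij.ne,
    Pi.single_eq_of_ne hij.ne'] at hi hj
  have := hS i j hij
  by_cases hjS : j ∈ S
  · have := this hjS
    simp only [this, if_true] at hi
    split_ifs at hi <;> omega
  · simp only [hjS, if_false] at hj
    split_ifs at hj <;> omega

/-- A dominant weight is a sum of a constant weight and indicators of initial segments. -/
theorem hasHighest_of_antitone {μ : Fin n → ℤ} (hμ : Antitone μ) : HasHighest μ := by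
  rcases Nat.eq_zero_or_pos n with rfl | hn
  · have : μ = fun _ => 0 := funext fun i => i.elim0
    rw [this]; exact hasHighest_const 0
  let a : Fin n := ⟨0, hn⟩
  let z : Fin n := ⟨n - 1, by omega⟩
  have ha : ∀ i, a ≤ i := fun i => Fin.mk_le_of_le_val (Nat.zero_le _)
  have hz : ∀ i, i ≤ z := fun i => Fin.le_def.mpr (by have := i.2; simp only [z]; omega)
  have key : ∀ (k : ℕ) (μ : Fin n → ℤ), Antitone μ → μ a - μ z = k → HasHighest μ := by
    intro k
    induction k with
    | zero =>
      intro μ hμ h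
      have : μ = fun _ => μ a := funext fun i =>
        le_antisymm (hμ (ha i)) (by have := hμ (hz i); push_cast at h; omega)
      rw [this]; exact hasHighest_const _
    | succ k ih =>
      intro μ hμ h
      let S : Finset (Fin n) := Finset.univ.filter fun i => μ i = μ a
      have e : μ = (μ - fun i => if i ∈ S then 1 else 0) + fun i => if i ∈ S then 1 else 0 := by
        rw [sub_add_cancel]
      rw [e]
      refine (ih _ ?_ ?_).add (hasHighest_indicator S fun i j hij hj => ?_)
      · intro i j hij
        have h1 := hμ hij
        have h2 := hμ (ha i)
        have h3 := hμ (ha j)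
        simp only [Pi.sub_apply, S, Finset.mem_filter, Finset.mem_univ, true_and]
        split_ifs <;> omega
      · simp only [Pi.sub_apply, S, Finset.mem_filter, Finset.mem_univ, true_and, if_true]
        rw [if_neg (by push_cast at h; omega)]
        push_cast at h
        omega
      · simp only [S, Finset.mem_filter, Finset.mem_univ, true_and] at hj ⊢
        have h1 := hμ hij.le
        have h2 := hμ (ha i)
        omega
  exact key (μ a - μ z).toNat μ hμ (by have := hμ (ha z); omega)

/-- A representation of minimal dimension among those with a highest weight vector of weight `μ`
is simple. -/
theorem exists_simple_of_antitone {μ : Fin n → ℤ} (hμ : Antitone μ) :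
    ∃ V : GLRep n, V.IsSimpleOfHighestWeight μ := by
  classical
  have hex : ∃ d : ℕ, ∃ V : GLRep n, FiniteDimensional ℂ V.carrier ∧ (∃ v, V.IsHighest μ v) ∧
      Module.finrank ℂ V.carrier = d := by
    obtain ⟨V, h1, h2⟩ := hasHighest_of_antitone hμ
    exact ⟨_, V, h1, h2, rfl⟩
  obtain ⟨V, hV, ⟨v, hv⟩, hd⟩ := Nat.find_spec hex
  have hmin : ∀ U : GLRep n, FiniteDimensional ℂ U.carrier → ∀ u, U.IsHighest μ u →
      Module.finrank ℂ V.carrier ≤ Module.finrank ℂ U.carrier := fun U hU u hu =>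
    hd ▸ Nat.find_min' hex ⟨U, hU, ⟨u, hu⟩, rfl⟩
  refine ⟨V, hV, fun W hW => ?_, v, hv.ne_zero, hv.raising, hv.weight⟩
  by_cases hvW : v ∈ W
  · right
    have := hmin (V.sub W hW) (inferInstanceAs (FiniteDimensional ℂ W)) ⟨v, hvW⟩
      ⟨fun h => hv.ne_zero (congrArg Subtype.val h),
        fun i j hij => Subtype.ext (hv.raising i j hij), fun i => Subtype.ext (hv.weight i)⟩
    exact Submodule.eq_top_of_finrank_eq (le_antisymm W.finrank_le this)
  · left
    have h := hmin (V.quot W hW) (inferInstanceAs (FiniteDimensional ℂ (V.carrier ⧸ W)))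
      (Submodule.Quotient.mk v)
      ⟨fun h => hvW ((Submodule.Quotient.mk_eq_zero W).mp h),
        fun i j hij => congrArg (Submodule.Quotient.mk (p := W)) (hv.raising i j hij),
        fun i => congrArg (Submodule.Quotient.mk (p := W)) (hv.weight i)⟩
    have h2 := W.finrank_quotient_add_finrank
    change Module.finrank ℂ V.carrier ≤ Module.finrank ℂ (V.carrier ⧸ W) at h
    exact Submodule.finrank_eq_zero.mp (by omega)

end Constructions

/-! ### Characters of simple modules -/

section SimpleCharacters

variable {n : ℕ} {V : GLRep n} {μ : Fin n → ℤ}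

theorem GLRep.act_eq_sum (V : GLRep n) (X : Matrix (Fin n) (Fin n) ℂ) (v : V.carrier) :
    V.act X v = ∑ i, ∑ j, X i j • V.act (Matrix.single i j 1) v := by
  conv_lhs => rw [Matrix.matrix_eq_sum_single X]
  rw [map_sum, LinearMap.sum_apply]
  refine Finset.sum_congr rfl fun i _ => ?_
  rw [map_sum, LinearMap.sum_apply]
  refine Finset.sum_congr rfl fun j _ => ?_
  rw [← mul_one (X i j), ← smul_eq_mul, ← Matrix.smul_single, map_smul, LinearMap.smul_apply,
    smul_eq_mul, mul_one]

theorem GLRep.stable_of_single {W : Submodule ℂ V.carrier}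
    (h : ∀ i j, ∀ v ∈ W, V.act (Matrix.single i j 1) v ∈ W) (X : Matrix (Fin n) (Fin n) ℂ) :
    ∀ v ∈ W, V.act X v ∈ W := fun v hv => by
  rw [V.act_eq_sum]
  exact W.sum_mem fun i _ => W.sum_mem fun j _ => W.smul_mem _ (h i j v hv)

/-- The torus acts diagonalizably on a simple module with a highest weight. -/
theorem GLRep.IsSimpleOfHighestWeight.exists_weightBasis (hV : V.IsSimpleOfHighestWeight μ) :
    ∃ (ι : Type) (_ : Fintype ι), Nonempty (WeightBasis 1 V.torus ι) := by
  have := hV.finiteDimensional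
  refine Periplectic.exists_weightBasis (one_mul 1) (fun h => by rw [one_mul, mul_one]) ?_
  obtain ⟨v, hv0, -, hv⟩ := hV.highest
  refine (hV.simple _ (GLRep.stable_of_single fun i j w hw => ?_)).resolve_left fun h => hv0 ?_
  · refine Submodule.iSup_induction _
      (motive := fun w => V.act (Matrix.single i j 1) w ∈ ⨆ μ, wtOf V.torus μ) hw ?_ ?_ ?_
    · exact fun ν x hx => Submodule.mem_iSup_of_mem _ (V.act_single_mem hx)
    · rw [map_zero]; exact zero_mem _
    · intro x y hx hy
      rw [map_add]; exact add_mem hx hy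
  · rw [← Submodule.mem_bot ℂ, ← h]
    exact Submodule.mem_iSup_of_mem μ (mem_wtOf_torus_iff.mpr hv)

/-- `ν` is lexicographically smaller than `μ` and has the same sum of entries. -/
def Below (ν μ : Fin n → ℤ) : Prop := toLex ν < toLex μ ∧ ∑ i, ν i = ∑ i, μ i

theorem below_lowering (ν : Fin n → ℤ) {i j : Fin n} (hij : j < i) :
    Below (ν + Pi.single i 1 - Pi.single j 1) ν := by
  refine ⟨⟨j, fun k hk => ?_, ?_⟩, ?_⟩
  · simp [hk.ne, (hk.trans hij).ne]
  · simp [hij.ne]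
  · simp [Finset.sum_add_distrib]

/-- A simple module of highest weight `μ` is spanned by the highest weight vector and vectors of
smaller weights. -/
theorem GLRep.IsSimpleOfHighestWeight.span_sup_eq_top (hV : V.IsSimpleOfHighestWeight μ)
    {v : V.carrier} (hv : V.IsHighest μ v) :
    Submodule.span ℂ {v} ⊔ ⨆ (ν) (_ : Below ν μ), wtOf V.torus ν = ⊤ := by
  set L := Submodule.span ℂ {v} ⊔ ⨆ (ν) (_ : Below ν μ), wtOf V.torus ν with hL
  have hwt : ∀ ν, Below ν μ → wtOf V.torus ν ≤ L := fun ν hν =>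
    (le_iSup₂ (f := fun ν (_ : Below ν μ) => wtOf V.torus ν) ν hν).trans le_sup_right
  have hvL : v ∈ L := Submodule.mem_sup_left (Submodule.mem_span_singleton_self v)
  have hvw := mem_wtOf_torus_iff.mpr hv.weight
  -- the weights of `L` are closed under lowering
  have hlow : ∀ i j, j ≤ i → ∀ w ∈ L, V.act (Matrix.single i j 1) w ∈ L := by
    intro i j hij
    change L ≤ L.comap _
    rw [hL, sup_le_iff, Submodule.span_singleton_le_iff_mem, iSup₂_le_iff, ← hL]
    constructor
    · rw [Submodule.mem_comap]
      rcases hij.lt_or_eq with h | rfl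
      · exact hwt _ (below_lowering μ h) (V.act_single_mem hvw)
      · rw [hv.weight]; exact L.smul_mem _ hvL
    · intro ν hν w hw
      rw [Submodule.mem_comap]
      have h1 := V.act_single_mem (i := i) (j := j) hw
      rcases hij.lt_or_eq with h | rfl
      · have h2 := below_lowering ν h
        exact hwt _ ⟨h2.1.trans hν.1, h2.2.trans hν.2⟩ h1
      · rw [add_sub_cancel_right] at h1
        exact hwt _ hν h1
  -- the subspace generated by `v` under lowering is stable
  let W : Submodule ℂ V.carrier := sInf {W | v ∈ W ∧
    ∀ i j, j ≤ i → ∀ w ∈ W, V.act (Matrix.single i j 1) w ∈ W}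
  have hWle : ∀ W', v ∈ W' → (∀ i j, j ≤ i → ∀ w ∈ W', V.act (Matrix.single i j 1) w ∈ W') →
      W ≤ W' := fun W' h1 h2 => sInf_le ⟨h1, h2⟩
  have hvW : v ∈ W := Submodule.mem_sInf.mpr fun W' h => h.1
  have hWlow : ∀ i j, j ≤ i → ∀ w ∈ W, V.act (Matrix.single i j 1) w ∈ W :=
    fun i j hij w hw => Submodule.mem_sInf.mpr fun W' h =>
      h.2 i j hij w (Submodule.mem_sInf.mp hw W' h)
  let T : Submodule ℂ V.carrier := W ⊓ ⨅ X, W.comap (V.act X)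
  have hT : ∀ w, w ∈ T ↔ w ∈ W ∧ ∀ X, V.act X w ∈ W := fun w => by
    simp [T, Submodule.mem_iInf]
  have hWT : W ≤ T := by
    refine hWle T ((hT v).mpr ⟨hvW, fun X => ?_⟩) fun i j hij w hw => (hT _).mpr ⟨?_, fun X => ?_⟩
    · rw [V.act_eq_sum]
      refine W.sum_mem fun i _ => W.sum_mem fun j _ => W.smul_mem _ ?_
      rcases lt_or_ge i j with h | h
      · rw [hv.raising i j h]; exact W.zero_mem
      · exact hWlow i j h v hvW
    · exact ((hT w).mp hw).2 _
    · have h1 := LinearMap.congr_fun (V.act_lie X (Matrix.single i j 1)) w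
      rw [LinearMap.sub_apply, Module.End.mul_apply, Module.End.mul_apply] at h1
      rw [sub_eq_iff_eq_add.mp h1.symm]
      exact W.add_mem (((hT w).mp hw).2 _) (hWlow i j hij _ (((hT w).mp hw).2 X))
  have hW : W = ⊤ := (hV.simple W fun X w hw => ((hT w).mp (hWT hw)).2 X).resolve_left fun h =>
    hv.ne_zero ((Submodule.mem_bot ℂ).mp (h ▸ hvW))
  exact eq_top_iff.mpr (hW ▸ hWle L hvL hlow)

theorem GLRep.gr_one (ν : Fin n → ℤ) :
    gr (1 : Module.End ℂ V.carrier) V.torus (ν, 1) = wtOf V.torus ν := by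
  ext w; simp [mem_gr, mem_wtOf]

theorem WeightBasis.coeff_ch {ι : Type} [Fintype ι] (B : WeightBasis 1 V.torus ι)
    (ν : Fin n → ℤ) : V.ch.coeff ν = Module.finrank ℂ (wtOf V.torus ν) := by
  have : gr (1 : Module.End ℂ V.carrier) V.torus (ν, -1) = ⊥ := by
    refine eq_bot_iff.mpr fun w hw => ?_
    have h := (mem_gr.mp hw).2
    simp only [Module.End.one_apply, Units.val_neg, Units.val_one, Int.cast_neg, Int.cast_one,
      neg_smul, one_smul] at h
    have h2 : (2 : ℂ) • w = 0 := by rw [two_smul]; nth_rewrite 2 [h]; exact add_neg_cancel w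
    exact (Submodule.mem_bot ℂ).mpr ((smul_eq_zero.mp h2).resolve_left two_ne_zero)
  rw [GLRep.ch, B.coeff_schOf, sdimOf_eq, this, GLRep.gr_one, finrank_bot]
  simp

/-- The character of a simple module of highest weight `μ` is `e^μ` plus smaller terms. -/
theorem GLRep.IsSimpleOfHighestWeight.coeff_ch (hV : V.IsSimpleOfHighestWeight μ) :
    V.ch.coeff μ = 1 ∧ ∀ ν, V.ch.coeff ν ≠ 0 → ν = μ ∨ Below ν μ := by
  obtain ⟨ι, _, ⟨B⟩⟩ := hV.exists_weightBasis
  obtain ⟨v, h1, h2, h3⟩ := hV.highest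
  have hv : V.IsHighest μ v := ⟨h1, h2, h3⟩
  have hvw := mem_wtOf_torus_iff.mpr h3
  have htop := hV.span_sup_eq_top hv
  have hproj : ∀ ν, ∃ p : Module.End ℂ V.carrier, (∀ w ∈ wtOf V.torus ν, p w = w) ∧
      ∀ ψ ≠ ν, ∀ w ∈ wtOf V.torus ψ, p w = 0 := fun ν => by
    obtain ⟨p, hp1, hp2⟩ := B.exists_proj (ν, 1)
    refine ⟨p, fun w hw => hp1 w (GLRep.gr_one ν ▸ hw), fun ψ hψ w hw =>
      hp2 (ψ, 1) (fun h => hψ (congrArg Prod.fst h)) w (GLRep.gr_one ψ ▸ hw)⟩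
  constructor
  · obtain ⟨p, hp1, hp2⟩ := hproj μ
    have hs : wtOf V.torus μ = Submodule.span ℂ {v} := by
      refine le_antisymm (fun w hw => ?_)
        ((Submodule.span_singleton_le_iff_mem _ _).mpr hvw)
      rw [← hp1 w hw]
      have : (⊤ : Submodule ℂ V.carrier) ≤ (Submodule.span ℂ {v}).comap p := by
        rw [← htop, sup_le_iff, Submodule.span_singleton_le_iff_mem, iSup₂_le_iff]
        refine ⟨?_, fun ν hν x hx => ?_⟩
        · rw [Submodule.mem_comap, hp1 v hvw]; exact Submodule.mem_span_singleton_self v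
        · rw [Submodule.mem_comap, hp2 ν (fun h => (h ▸ hν.1).ne rfl) x hx]
          exact zero_mem _
      exact this Submodule.mem_top
    rw [B.coeff_ch, hs, finrank_span_singleton h1]
    rfl
  · intro ν hν
    by_contra! hne
    obtain ⟨p, hp1, hp2⟩ := hproj ν
    apply hν
    rw [B.coeff_ch]
    have : wtOf V.torus ν = ⊥ := by
      refine eq_bot_iff.mpr fun w hw => ?_
      rw [← hp1 w hw]
      have : (⊤ : Submodule ℂ V.carrier) ≤ LinearMap.ker p := by
        rw [← htop, sup_le_iff, Submodule.span_singleton_le_iff_mem, iSup₂_le_iff]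
        refine ⟨hp2 μ hne.1.symm v hvw, fun ψ hψ x hx => hp2 ψ (fun h => hne.2 (h ▸ hψ)) x hx⟩
      exact this Submodule.mem_top
    rw [this, finrank_bot]
    rfl

/-- Laurent polynomials whose coefficients are constant on orbits of the symmetric group. -/
def IsSymm (f : Laurent n) : Prop := ∀ (σ : Equiv.Perm (Fin n)) (μ), f.coeff (μ ∘ σ) = f.coeff μ

theorem GLRep.IsSimpleOfHighestWeight.isSymm_ch (hV : V.IsSimpleOfHighestWeight μ) :
    IsSymm V.ch := by
  obtain ⟨ι, _, ⟨B⟩⟩ := hV.exists_weightBasis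
  exact fun σ ν => GLRep.coeff_schOf_perm B (fun A => Commute.one_left _) σ ν

theorem toLex_lt_swap {μ : Fin n → ℤ} {i j : Fin n} (hij : i < j) (h : μ i < μ j) :
    toLex μ < toLex (μ ∘ Equiv.swap i j) := by
  refine ⟨i, fun k hk => ?_, ?_⟩
  · simp [Equiv.swap_apply_of_ne_of_ne hk.ne (hk.trans hij).ne]
  · simpa using h

theorem apply_zero_le_of_toLex_le {μ ν : Fin n → ℤ} (h : toLex ν ≤ toLex μ) {z : Fin n}
    (hz : ∀ i, z ≤ i) : ν z ≤ μ z := by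
  rcases h.lt_or_eq with ⟨k, hk1, hk2⟩ | h
  · rcases (hz k).lt_or_eq with hk | hk
    · exact (hk1 z hk).le
    · rw [hk]; exact hk2.le
  · exact (congrFun (toLex.injective h) z).le

/-- The entries of the weights of a simple module are at most the largest entry of the highest
weight. -/
theorem GLRep.IsSimpleOfHighestWeight.le_of_coeff_ne_zero (hV : V.IsSimpleOfHighestWeight μ)
    {K : ℤ} (hK : ∀ i, μ i ≤ K) {ν : Fin n → ℤ} (hν : V.ch.coeff ν ≠ 0) (i : Fin n) :
    ν i ≤ K := by
  let z : Fin n := ⟨0, i.pos⟩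
  have hz : ∀ i, z ≤ i := fun i => Fin.mk_le_of_le_val (Nat.zero_le _)
  have h1 : V.ch.coeff (ν ∘ Equiv.swap z i) ≠ 0 := by rwa [hV.isSymm_ch]
  have h2 : toLex (ν ∘ Equiv.swap z i) ≤ toLex μ := by
    rcases hV.coeff_ch.2 _ h1 with h | h
    · exact h ▸ le_rfl
    · exact h.1.le
  have h3 := apply_zero_le_of_toLex_le h2 hz
  rw [Function.comp_apply, Equiv.swap_apply_left] at h3
  exact h3.trans (hK z)

/-- The characters of the simple modules span the symmetric Laurent polynomials. -/
theorem IsSymm.mem_closure {f : Laurent n} (hf : IsSymm f) :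
    f ∈ AddSubgroup.closure {g | ∃ (μ : Fin n → ℤ) (V : GLRep n), Antitone μ ∧
      V.IsSimpleOfHighestWeight μ ∧ V.ch = g} := by
  classical
  set C := AddSubgroup.closure {g | ∃ (μ : Fin n → ℤ) (V : GLRep n), Antitone μ ∧
      V.IsSimpleOfHighestWeight μ ∧ V.ch = g} with hC
  -- the weights with entries at most `K` and sum at least `d` form a finite set
  have hfin : ∀ K d : ℤ, {ν : Fin n → ℤ | (∀ i, ν i ≤ K) ∧ d ≤ ∑ i, ν i}.Finite := by
    intro K d
    refine (Set.finite_Icc (fun _ => d - (n - 1 : ℤ) * K : Fin n → ℤ) (fun _ => K)).subset ?_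
    rintro ν ⟨h1, h2⟩
    refine ⟨fun i => ?_, h1⟩
    have h3 : ∑ j ∈ Finset.univ.erase i, ν j ≤ (n - 1 : ℤ) * K := by
      refine (Finset.sum_le_card_nsmul _ _ K fun j _ => h1 j).trans_eq ?_
      rw [Finset.card_erase_of_mem (Finset.mem_univ i), Finset.card_univ, Fintype.card_fin,
        nsmul_eq_mul, Nat.cast_sub i.pos]
      simp
    have h4 := Finset.add_sum_erase Finset.univ ν (Finset.mem_univ i)
    change d - (n - 1 : ℤ) * K ≤ ν i
    linarith
  obtain ⟨K, hK⟩ : ∃ K : ℤ, ∀ ν ∈ f.coeff.support, ∀ i, ν i ≤ K := by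
    refine ⟨∑ ν ∈ f.coeff.support, ∑ i, |ν i|, fun ν hν i => ?_⟩
    calc ν i ≤ |ν i| := le_abs_self _
      _ ≤ ∑ i, |ν i| := Finset.single_le_sum (f := fun i => |ν i|) (fun _ _ => abs_nonneg _)
        (Finset.mem_univ i)
      _ ≤ _ := Finset.single_le_sum (f := fun ν : Fin n → ℤ => ∑ i, |ν i|)
        (fun _ _ => Finset.sum_nonneg fun _ _ => abs_nonneg _) hν
  obtain ⟨d, hd⟩ : ∃ d : ℤ, ∀ ν ∈ f.coeff.support, d ≤ ∑ i, ν i := by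
    refine ⟨-∑ ν ∈ f.coeff.support, |∑ i, ν i|, fun ν hν => ?_⟩
    have h1 := Finset.single_le_sum (f := fun ν : Fin n → ℤ => |∑ i, ν i|)
      (fun _ _ => abs_nonneg _) hν
    have h2 := neg_abs_le (∑ i, ν i)
    linarith
  let box := (hfin K d).toFinset
  have hbox : ∀ ν, ν ∈ box ↔ (∀ i, ν i ≤ K) ∧ d ≤ ∑ i, ν i := fun ν => by simp [box]
  -- the position of a weight in the lexicographic order of this finite set
  let N : (Fin n → ℤ) → ℕ := fun μ => (box.filter fun ν => toLex ν < toLex μ).card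
  have hN : ∀ {ν μ}, ν ∈ box → toLex ν < toLex μ → N ν < N μ := by
    intro ν μ hν h
    refine Finset.card_lt_card ((Finset.ssubset_iff_of_subset fun ψ hψ => ?_).mpr ⟨ν, ?_, ?_⟩)
    · rw [Finset.mem_filter] at hψ ⊢
      exact ⟨hψ.1, hψ.2.trans h⟩
    · exact Finset.mem_filter.mpr ⟨hν, h⟩
    · exact fun h' => (Finset.mem_filter.mp h').2.ne rfl
  -- subtract a multiple of the character whose highest weight is the largest weight of `g`
  suffices key : ∀ (m : ℕ) (g : Laurent n), IsSymm g → (∀ ν, g.coeff ν ≠ 0 → ν ∈ box) →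
      (∀ ν, g.coeff ν ≠ 0 → N ν < m) → g ∈ C by
    have hb : ∀ ν, f.coeff ν ≠ 0 → ν ∈ box := fun ν hν =>
      (hbox ν).mpr ⟨hK ν (Finsupp.mem_support_iff.mpr hν), hd ν (Finsupp.mem_support_iff.mpr hν)⟩
    exact key (box.card + 1) f hf hb fun ν _ =>
      Nat.lt_succ_of_le (Finset.card_le_card (Finset.filter_subset _ _))
  intro m
  induction m with
  | zero =>
    intro g _ _ h
    have : g = 0 := AddMonoidAlgebra.ext (Finsupp.ext fun ν => by
      by_contra hν
      exact Nat.not_lt_zero _ (h ν hν))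
    rw [this]; exact C.zero_mem
  | succ m ih =>
    intro g hg hgb hgm
    rcases g.coeff.support.eq_empty_or_nonempty with h0 | hne
    · have : g = 0 := AddMonoidAlgebra.ext (Finsupp.support_eq_empty.mp h0)
      rw [this]; exact C.zero_mem
    obtain ⟨μ, hμ, hmax⟩ := Finset.exists_max_image g.coeff.support toLex hne
    have hμ0 := Finsupp.mem_support_iff.mp hμ
    have hanti : Antitone μ := by
      intro i j hij
      by_contra! h
      have hlt := toLex_lt_swap (lt_of_le_of_ne hij fun e => (e ▸ h).ne rfl) h
      exact (hmax (μ ∘ Equiv.swap i j) (Finsupp.mem_support_iff.mpr (by rwa [hg]))).not_gt hlt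
    obtain ⟨V, hV⟩ := exists_simple_of_antitone hanti
    obtain ⟨hV1, hV2⟩ := hV.coeff_ch
    have hμb := (hbox μ).mp (hgb μ hμ0)
    have hcoeff : ∀ ν, (g - g.coeff μ • V.ch).coeff ν = g.coeff ν - g.coeff μ * V.ch.coeff ν :=
      fun ν => by simp [-zsmul_eq_mul]
    have hVC : V.ch ∈ C := AddSubgroup.subset_closure ⟨μ, V, hanti, hV, rfl⟩
    have hsub : g - g.coeff μ • V.ch ∈ C := by
      have hcase : ∀ ν, (g - g.coeff μ • V.ch).coeff ν ≠ 0 → ν ∈ box ∧ toLex ν < toLex μ := by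
        intro ν hν
        rw [hcoeff] at hν
        have hνμ : ν ≠ μ := by
          rintro rfl
          rw [hV1, mul_one, sub_self] at hν
          exact hν rfl
        by_cases hgν : g.coeff ν = 0
        · rw [hgν, zero_sub, neg_ne_zero] at hν
          have h1 := right_ne_zero_of_mul hν
          have h2 := (hV2 ν h1).resolve_left hνμ
          exact ⟨(hbox ν).mpr ⟨hV.le_of_coeff_ne_zero hμb.1 h1, h2.2 ▸ hμb.2⟩, h2.1⟩
        · exact ⟨hgb ν hgν, lt_of_le_of_ne (hmax ν (Finsupp.mem_support_iff.mpr hgν))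
            fun h => hνμ (toLex.injective h)⟩
      refine ih _ (fun σ ν => ?_) (fun ν hν => (hcase ν hν).1) fun ν hν => ?_
      · rw [hcoeff, hcoeff, hg, hV.isSymm_ch]
      · have := hN (hcase ν hν).1 (hcase ν hν).2
        have := hgm μ hμ0
        omega
    have := C.add_mem hsub (C.zsmul_mem hVC (g.coeff μ))
    rwa [sub_add_cancel] at this

end SimpleCharacters

/-! ### Substitutions and symmetric Laurent polynomials -/

section Laurent

variable {n : ℕ} {R : Type} [CommRing R]

theorem subst_single (u : Fin n → Rˣ) (μ : Fin n → ℤ) (c : ℤ) :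
    subst u (AddMonoidAlgebra.single μ c) = c • ((∏ i, u i ^ μ i : Rˣ) : R) := by
  change AddMonoidAlgebra.lift ℤ R (Fin n → ℤ) _ _ = _
  rw [AddMonoidAlgebra.lift_single]
  rfl

theorem var_zpow (i : Fin n) (k : ℤ) :
    ((var i ^ k : (Laurent n)ˣ) : Laurent n) = AddMonoidAlgebra.single (k • Pi.single i 1) 1 := by
  have hnat : ∀ m : ℕ, ((var i ^ m : (Laurent n)ˣ) : Laurent n) =
      AddMonoidAlgebra.single ((m : ℤ) • Pi.single i 1) 1 := fun m => by
    rw [Units.val_pow_eq_pow_val]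
    change (AddMonoidAlgebra.single (Pi.single i 1) 1 : Laurent n) ^ m = _
    rw [AddMonoidAlgebra.single_pow, one_pow, natCast_zsmul]
  obtain ⟨m, rfl | rfl⟩ := k.eq_nat_or_neg
  · rw [zpow_natCast, hnat]
  · rw [zpow_neg, zpow_natCast]
    refine Units.inv_eq_of_mul_eq_one_right ?_
    rw [hnat, AddMonoidAlgebra.single_mul_single, neg_smul, add_neg_cancel, one_mul]
    rfl

theorem prod_var_zpow (s : Fin n → Fin n) (μ : Fin n → ℤ) :
    ((∏ i, var (s i) ^ μ i : (Laurent n)ˣ) : Laurent n) =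
      AddMonoidAlgebra.single (∑ i, μ i • Pi.single (s i) 1) 1 := by
  have : ∀ S : Finset (Fin n), ((∏ i ∈ S, var (s i) ^ μ i : (Laurent n)ˣ) : Laurent n) =
      AddMonoidAlgebra.single (∑ i ∈ S, μ i • Pi.single (s i) 1) 1 := by
    intro S
    induction S using Finset.induction_on with
    | empty => rfl
    | insert a S ha ih =>
      rw [Finset.prod_insert ha, Finset.sum_insert ha, Units.val_mul, ih, var_zpow,
        AddMonoidAlgebra.single_mul_single, one_mul]
  exact this _

theorem single_eq_prod_var (μ : Fin n → ℤ) (c : ℤ) :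
    (AddMonoidAlgebra.single μ c : Laurent n) =
      c • ((∏ i, var i ^ μ i : (Laurent n)ˣ) : Laurent n) := by
  have h := prod_var_zpow id μ
  simp only [id] at h
  rw [h, AddMonoidAlgebra.smul_single]
  congr 1
  · funext j
    simp [Finset.sum_apply, Pi.single_apply]
  · simp

/-- Ring homomorphisms out of the Laurent polynomials which agree on the variables are equal. -/
theorem laurent_hom_ext {g h : Laurent n →+* R} 
    (hgh : ∀ i : Fin n, g ((var i : (Laurent n)ˣ) : Laurent n) = h (var i : (Laurent n)ˣ)) :
    g = h := by
  have hu : ∀ i, Units.map (g : Laurent n →* R) (var i) = Units.map (h : Laurent n →* R) (var i) :=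
    fun i => Units.ext (hgh i)
  have hv : ∀ (k : Laurent n →+* R) (μ : Fin n → ℤ) (c : ℤ), k (AddMonoidAlgebra.single μ c) =
      c • ((∏ i, Units.map (k : Laurent n →* R) (var i) ^ μ i : Rˣ) : R) := fun k μ c => by
    rw [single_eq_prod_var, map_zsmul]
    congr 1
    have := congrArg Units.val (map_prod (Units.map (k : Laurent n →* R)) (fun i => var i ^ μ i)
      Finset.univ)
    simp_rw [map_zpow] at this
    exact this
  refine RingHom.ext fun f => ?_
  induction f using AddMonoidAlgebra.induction_linear with
  | zero => rw [map_zero, map_zero]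
  | add f f' hf hf' => rw [map_add, map_add, hf, hf']
  | single μ c =>
    rw [hv g, hv h]
    simp_rw [hu]

theorem subst_var (u : Fin n → Rˣ) (i : Fin n) : subst u (var i : Laurent n) = u i := by
  change subst u (AddMonoidAlgebra.single _ _) = _
  rw [subst_single, one_smul, Finset.prod_eq_single i]
  · simp
  · intro j _ hj
    rw [Pi.single_eq_of_ne hj, zpow_zero]
  · simp

theorem subst_var_inv (u : Fin n → Rˣ) (i : Fin n) :
    subst u (((var i)⁻¹ : (Laurent n)ˣ) : Laurent n) = ((u i)⁻¹ : Rˣ) := by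
  refine (Units.inv_eq_of_mul_eq_one_right ?_).symm
  rw [← subst_var u i, ← map_mul, Units.mul_inv, map_one]

theorem subst_var_perm (s : Equiv.Perm (Fin n)) (μ : Fin n → ℤ) (c : ℤ) :
    subst (fun k => var (s k)) (AddMonoidAlgebra.single μ c) =
      AddMonoidAlgebra.single (μ ∘ s.symm) c := by
  rw [subst_single, prod_var_zpow s, AddMonoidAlgebra.smul_single]
  congr 1
  · funext j
    rw [Finset.sum_apply, Finset.sum_eq_single (s.symm j)]
    · simp
    · intro i _ hi
      have : j ≠ s i := fun h => hi (by rw [h, Equiv.symm_apply_apply])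
      simp [this]
    · simp
  · simp

/-- Permuting the variables permutes the entries of the exponents. -/
theorem coeff_subst_perm (s : Equiv.Perm (Fin n)) (f : Laurent n) (μ : Fin n → ℤ) :
    (subst (fun k => var (s k)) f).coeff μ = f.coeff (μ ∘ s) := by
  induction f using AddMonoidAlgebra.induction_linear with
  | zero => simp
  | add f g hf hg => rw [map_add, AddMonoidAlgebra.coeff_add, AddMonoidAlgebra.coeff_add,
      Finsupp.add_apply, Finsupp.add_apply, hf, hg]
  | single ν c =>
    classical
    rw [subst_var_perm, AddMonoidAlgebra.coeff_single, AddMonoidAlgebra.coeff_single,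
      Finsupp.single_apply, Finsupp.single_apply]
    have : ν ∘ s.symm = μ ↔ ν = μ ∘ s := by
      constructor
      · rintro rfl; funext i; simp
      · rintro rfl; funext i; simp
    simp only [this]

theorem isSymm_iff {f : Laurent n} :
    IsSymm f ↔ ∀ s : Equiv.Perm (Fin n), subst (fun k => var (s k)) f = f := by
  refine forall_congr' fun s => ⟨fun h => AddMonoidAlgebra.ext (Finsupp.ext fun μ => ?_),
    fun h μ => ?_⟩
  · rw [coeff_subst_perm, h]
  · rw [← coeff_subst_perm, h]

/-- The factor `1 - x_i⁻¹ x_j⁻¹` of `denom`. -/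
def factor (i j : Fin n) : Laurent n := 1 - AddMonoidAlgebra.single (negRoot i j) 1

theorem factor_eq (i j : Fin n) :
    factor i j = 1 - (((var i)⁻¹ * (var j)⁻¹ : (Laurent n)ˣ) : Laurent n) := by
  rw [factor, negRoot, neg_add]
  have : (AddMonoidAlgebra.single (-Pi.single i 1 + -Pi.single j 1) 1 : Laurent n) =
    AddMonoidAlgebra.single (-Pi.single i 1) 1 * AddMonoidAlgebra.single (-Pi.single j 1) 1 := by
    rw [AddMonoidAlgebra.single_mul_single, one_mul]
  rw [this]
  rfl

theorem denom_eq (n : ℕ) : denom n = ∏ p : Pairs n, factor p.1.1 p.1.2 := rfl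

theorem subst_factor (u : Fin n → Rˣ) (i j : Fin n) :
    subst u (factor i j) = 1 - (((u i)⁻¹ * (u j)⁻¹ : Rˣ) : R) := by
  rw [factor_eq, map_sub, map_one, Units.val_mul, map_mul, subst_var_inv, subst_var_inv,
    Units.val_mul]

theorem factor_comm (i j : Fin n) : factor i j = factor j i := by
  rw [factor_eq, factor_eq, mul_comm]

theorem factor_ne_zero (i j : Fin n) : factor i j ≠ 0 := by
  intro h
  have h1 := congrArg (fun f : Laurent n => f.coeff 0) h
  have h0 : (0 : Fin n → ℤ) ≠ negRoot i j := fun h => by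
    have := congrFun h i
    by_cases hij : i = j
    · subst hij; simp [negRoot] at this
    · simp [negRoot, hij] at this
  simp [factor, AddMonoidAlgebra.one_def, AddMonoidAlgebra.coeff_sub, h0.symm] at h1

theorem denom_ne_zero (n : ℕ) : denom n ≠ 0 :=
  Finset.prod_ne_zero_iff.mpr fun _ _ => factor_ne_zero _ _

theorem isSymm_denom (n : ℕ) : IsSymm (denom n) := by
  rw [isSymm_iff]
  intro s
  let e : Pairs n → Pairs n := fun p =>
    if h : s p.1.1 < s p.1.2 then ⟨(s p.1.1, s p.1.2), h⟩
    else ⟨(s p.1.2, s p.1.1), lt_of_le_of_ne (not_lt.mp h) fun h' => p.2.ne (s.injective h').symm⟩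
  have he : Function.Injective e := by
    rintro ⟨⟨i, j⟩, hij⟩ ⟨⟨k, l⟩, hkl⟩ h
    dsimp only at hij hkl
    simp only [e] at h
    split_ifs at h <;> simp only [Subtype.mk.injEq, Prod.mk.injEq, s.injective.eq_iff] at h ⊢ <;>
      obtain ⟨rfl, rfl⟩ := h
    · exact ⟨rfl, rfl⟩
    · exact absurd hij hkl.not_gt
    · exact absurd hij hkl.not_gt
    · exact ⟨rfl, rfl⟩
  rw [denom_eq, map_prod]
  refine Fintype.prod_bijective e (Finite.injective_iff_bijective.mp he) _ _ fun p => ?_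
  rw [subst_factor, ← factor_eq]
  simp only [e]
  split_ifs with h
  · rfl
  · exact factor_comm _ _

theorem IsSymm.mul {f g : Laurent n} (hf : IsSymm f) (hg : IsSymm g) : IsSymm (f * g) :=
  isSymm_iff.mpr fun s => by rw [map_mul, isSymm_iff.mp hf, isSymm_iff.mp hg]

theorem IsSymm.of_denom_mul {g : Laurent n} (h : IsSymm (denom n * g)) : IsSymm g :=
  isSymm_iff.mpr fun s => by
    have := isSymm_iff.mp h s
    rw [map_mul, isSymm_iff.mp (isSymm_denom n)] at this
    exact mul_left_cancel₀ (denom_ne_zero n) this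

/-- The substitution `x_j ↦ x_i⁻¹`. -/
def substInv (i j : Fin n) : Laurent n →+* Laurent n :=
  subst fun k => if k = j then (var i)⁻¹ else var k

/-- The kernel of the substitution `x_j ↦ x_i⁻¹` is generated by `1 - x_i⁻¹ x_j⁻¹`: modulo this
element, the substitution does not change anything. -/
theorem factor_dvd {i j : Fin n} {f : Laurent n} (hf : substInv i j f = 0) : factor i j ∣ f := by
  let I := Ideal.span {factor i j}
  have h : (Ideal.Quotient.mk I).comp (substInv i j) = Ideal.Quotient.mk I := by
    apply laurent_hom_ext
    intro k
    rw [RingHom.comp_apply, substInv, subst_var]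
    split_ifs with hk
    · subst hk
      rw [Ideal.Quotient.eq, Ideal.mem_span_singleton, factor_eq]
      refine ⟨-(var k : Laurent n), ?_⟩
      rw [sub_mul, one_mul, mul_neg, Units.val_mul, mul_assoc, Units.inv_mul, mul_one]
      ring
    · rfl
  have h1 := RingHom.congr_fun h f
  rw [RingHom.comp_apply, hf, map_zero] at h1
  exact Ideal.mem_span_singleton.mp (Ideal.Quotient.eq_zero_iff_mem.mp h1.symm)

theorem substInv_factor_ne_zero {i j k l : Fin n} (hij : i < j) (hkl : k < l)
    (hne : (k, l) ≠ (i, j)) : substInv i j (factor k l) ≠ 0 := by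
  -- there is a variable other than `x_i` and `x_j` which occurs in the factor
  obtain ⟨m, hm, hmi, hmj⟩ : ∃ m, (m = k ∨ m = l) ∧ m ≠ i ∧ m ≠ j := by
    by_contra! h
    have h1 := h k (Or.inl rfl)
    have h2 := h l (Or.inr rfl)
    refine hne ?_
    by_cases hk : k = i
    · subst hk; rw [h2 hkl.ne']
    · have := h1 hk
      subst this
      by_cases hl : l = i
      · subst hl; exact absurd hkl hij.not_gt
      · exact absurd (h2 hl) hkl.ne'
  -- specialise all the other variables to `1`, and `x_m` to `2 ∈ ℚ`
  let u : Fin n → ℚˣ := fun a => if a = m then Units.mk0 2 two_ne_zero else 1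
  intro h
  have h1 := congrArg (subst u) h
  have h2 : (subst u).comp (substInv i j) =
      subst fun a => if a = m then Units.mk0 (2 : ℚ) two_ne_zero else 1 := by
    apply laurent_hom_ext
    intro a
    rw [RingHom.comp_apply, substInv, subst_var, subst_var]
    split_ifs with h3 h4 h4
    · exact absurd (h4.symm.trans h3) hmj
    · rw [subst_var_inv]; simp [u, hmi.symm]
    · rw [subst_var]; simp [u, h4]
    · rw [subst_var]; simp [u, h4]
  rw [← RingHom.comp_apply, h2, map_zero, subst_factor] at h1
  rcases hm with rfl | rfl
  · simp [hkl.ne'] at h1; norm_num at h1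
  · simp [hkl.ne] at h1; norm_num at h1

/-- The factors of `denom` can be split off one at a time, because none of them is killed by the
substitution belonging to another one. -/
theorem denom_dvd {f : Laurent n} (hf : ∀ i j, i < j → substInv i j f = 0) : denom n ∣ f := by
  have : ∀ S : Finset (Pairs n), (∏ p ∈ S, factor p.1.1 p.1.2) ∣ f := by
    intro S
    induction S using Finset.induction_on with
    | empty => simp
    | insert p S hp ih =>
      obtain ⟨g, rfl⟩ := ih
      have h := hf p.1.1 p.1.2 p.2
      rw [map_mul, map_prod] at h
      have h0 : ∏ q ∈ S, substInv p.1.1 p.1.2 (factor q.1.1 q.1.2) ≠ 0 :=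
        Finset.prod_ne_zero_iff.mpr fun q hq =>
          substInv_factor_ne_zero p.2 q.2 fun e => hp ((Subtype.ext e : q = p) ▸ hq)
      rw [Finset.prod_insert hp, mul_comm (factor _ _)]
      exact mul_dvd_mul_left _ (factor_dvd ((mul_eq_zero.mp h).resolve_left h0))
  exact this _

end Laurent

/-! ### The kernel of the evaluation -/

section Kernel

theorem exists_perm_pair {m : ℕ} {a b i j : Fin m} (hab : a ≠ b) (hij : i ≠ j) :
    ∃ s : Equiv.Perm (Fin m), s a = i ∧ s b = j := by
  have h : Equiv.swap a i b ≠ i := fun h => hab (by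
    have := congrArg (Equiv.swap a i) h
    rw [Equiv.swap_apply_self, Equiv.swap_apply_right] at this
    exact this.symm)
  refine ⟨(Equiv.swap a i).trans (Equiv.swap (Equiv.swap a i b) j), ?_, ?_⟩
  · simp [Equiv.swap_apply_of_ne_of_ne h.symm hij]
  · simp

theorem natAdd_zero_ne_one (n : ℕ) : (Fin.natAdd n 0 : Fin (n + 2)) ≠ Fin.natAdd n 1 := by
  simp [Fin.ext_iff]

/-- By symmetry, a symmetric Laurent polynomial in the kernel of one evaluation is in the kernel of
all the substitutions `x_j ↦ x_i⁻¹`. -/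
theorem substInv_eq_zero {n : ℕ} {f : Laurent (n + 2)} (hf : IsSymm f) (h : evalLast n f = 0)
    {i j : Fin (n + 2)} (hij : i ≠ j) : substInv i j f = 0 := by
  obtain ⟨s, hs0, hs1⟩ := exists_perm_pair (natAdd_zero_ne_one n) hij
  let ψ : LaurentPolynomial (Laurent n) →+* Laurent (n + 2) :=
    LaurentPolynomial.eval₂ (subst fun k => var (s (Fin.castAdd 2 k))) (var i)
  have hψ : ψ.comp (evalLast n) = (substInv i j).comp (subst fun k => var (s k)) := by
    apply laurent_hom_ext
    intro k
    rw [RingHom.comp_apply, RingHom.comp_apply, subst_var, evalLast, subst_var, substInv, subst_var]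
    refine Fin.addCases (fun l => ?_) (fun l => ?_) k
    · have h1 : s (Fin.castAdd 2 l) ≠ j := fun h => by
        have := s.injective (h.trans hs1.symm)
        simp [Fin.ext_iff] at this
        omega
      rw [Fin.append_left, if_neg h1]
      change LaurentPolynomial.eval₂ _ _ (LaurentPolynomial.C _) = _
      rw [LaurentPolynomial.eval₂_C, subst_var]
    · rw [Fin.append_right]
      fin_cases l
      · change LaurentPolynomial.eval₂ _ _ (LaurentPolynomial.T 1) =
          ((if s (Fin.natAdd n 0) = j then (var i)⁻¹ else var (s (Fin.natAdd n 0)) : (Laurent _)ˣ) :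
            Laurent (n + 2))
        rw [LaurentPolynomial.eval₂_T, hs0, if_neg hij, zpow_one]
      · change LaurentPolynomial.eval₂ _ _ (LaurentPolynomial.T (-1)) =
          ((if s (Fin.natAdd n 1) = j then (var i)⁻¹ else var (s (Fin.natAdd n 1)) : (Laurent _)ˣ) :
            Laurent (n + 2))
        rw [LaurentPolynomial.eval₂_T, hs1, if_pos rfl, zpow_neg_one]
  have h1 := RingHom.congr_fun hψ f
  rw [RingHom.comp_apply, RingHom.comp_apply, h, map_zero, isSymm_iff.mp hf] at h1
  exact h1.symm

/-- `denom` vanishes as soon as two of the variables are inverse to each other. -/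
theorem subst_denom_eq_zero {n : ℕ} {R : Type} [CommRing R] {u : Fin n → Rˣ} {i j : Fin n}
    (hij : i ≠ j) (hu : u j = (u i)⁻¹) : subst u (denom n) = 0 := by
  wlog h : i < j generalizing i j
  · exact this hij.symm (by rw [hu, inv_inv]) (lt_of_le_of_ne (not_lt.mp h) hij.symm)
  rw [denom_eq, map_prod]
  refine Finset.prod_eq_zero (Finset.mem_univ ⟨(i, j), h⟩) ?_
  rw [subst_factor, hu, inv_inv, inv_mul_cancel, Units.val_one, sub_self]

theorem evalLast_denom (n : ℕ) : evalLast n (denom (n + 2)) = 0 := by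
  refine subst_denom_eq_zero (natAdd_zero_ne_one n) ?_
  rw [Fin.append_right, Fin.append_right]
  rfl

/-- The symmetric Laurent polynomials in the kernel of the evaluation are the symmetric multiples of
`denom`. -/
theorem evalLast_eq_zero_iff {n : ℕ} {f : Laurent (n + 2)} (hf : IsSymm f) :
    evalLast n f = 0 ↔ ∃ g, IsSymm g ∧ denom (n + 2) * g = f := by
  constructor
  · intro h
    obtain ⟨g, rfl⟩ := denom_dvd fun i j hij => substInv_eq_zero hf h hij.ne
    exact ⟨g, hf.of_denom_mul, rfl⟩
  · rintro ⟨g, -, rfl⟩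
    rw [map_mul, evalLast_denom, zero_mul]

theorem mem_J_iff {n : ℕ} {f : Laurent n} : f ∈ J n ↔ IsSymm f ∧
    ∀ i j, i ≠ j → substPair i j f ∈
      (LaurentPolynomial.C : Laurent n →+* LaurentPolynomial (Laurent n)).range := by
  rw [J, Subring.mem_inf, isSymm_iff]
  simp only [Subring.mem_iInf, RingHom.mem_eqLocus, RingHom.id_apply, Subring.mem_comap]

theorem denom_mul_mem_J {n : ℕ} {g : Laurent n} (hg : IsSymm g) : denom n * g ∈ J n := by
  refine mem_J_iff.mpr ⟨(isSymm_denom n).mul hg, fun i j hij => ?_⟩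
  have : substPair i j (denom n) = 0 :=
    subst_denom_eq_zero hij (by rw [if_neg hij.symm, if_pos rfl, if_pos rfl])
  rw [map_mul, this, zero_mul]
  exact zero_mem _

theorem thinKac_of_simple {n : ℕ} {wt : Fin n → ℤ} {V : GLRep n}
    (hV : V.IsSimpleOfHighestWeight (wt - gammaWeight n)) : (thinKac wt V).IsIntegrable ∧
      ((thinKac wt V).sch = denom n * V.ch ∨ (thinKac wt V).sch = -(denom n * V.ch)) := by
  obtain ⟨ι, _, ⟨B⟩⟩ := hV.exists_weightBasis
  exact thinKac_sch wt B

/-- The supercharacters of the thin Kac modules span the symmetric multiples of `denom`. -/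
theorem mem_thinKacSpan_iff {n : ℕ} {f : Laurent n} :
    f ∈ thinKacSpan n ↔ ∃ g, IsSymm g ∧ denom n * g = f := by
  constructor
  · intro hf
    induction hf using AddSubgroup.closure_induction with
    | mem f hf =>
      obtain ⟨wt, V, -, hV, rfl⟩ := hf
      rcases (thinKac_of_simple hV).2 with h | h
      · exact ⟨V.ch, hV.isSymm_ch, h.symm⟩
      · exact ⟨-V.ch, fun σ μ => by simp [hV.isSymm_ch σ μ], by rw [h, mul_neg]⟩
    | zero => exact ⟨0, fun _ _ => rfl, mul_zero _⟩
    | add _ _ _ _ hf hg =>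
      obtain ⟨f, hf, rfl⟩ := hf
      obtain ⟨g, hg, rfl⟩ := hg
      exact ⟨f + g, fun σ μ => by simp [hf σ μ, hg σ μ], mul_add _ _ _⟩
    | neg _ _ hf =>
      obtain ⟨f, hf, rfl⟩ := hf
      exact ⟨-f, fun σ μ => by simp [hf σ μ], mul_neg _ _⟩
  · rintro ⟨g, hg, rfl⟩
    have hc := hg.mem_closure
    clear hg
    induction hc using AddSubgroup.closure_induction with
    | mem g hg =>
      obtain ⟨μ, V, hμ, hV, rfl⟩ := hg
      have hV' : V.IsSimpleOfHighestWeight ((μ + gammaWeight n) - gammaWeight n) := by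
        rwa [add_sub_cancel_right]
      have hmem : (thinKac (μ + gammaWeight n) V).sch ∈ thinKacSpan n :=
        AddSubgroup.subset_closure ⟨_, V, fun i j hij => add_le_add_left (hμ hij) _, hV', rfl⟩
      rcases (thinKac_of_simple hV').2 with h | h
      · rwa [h] at hmem
      · rw [h] at hmem; exact neg_mem_iff.mp hmem
    | zero => rw [mul_zero]; exact zero_mem _
    | add f g _ _ hf hg => rw [mul_add]; exact add_mem hf hg
    | neg f _ hf => rw [mul_neg]; exact neg_mem hf

theorem map_ker_dsJ (n : ℕ) :
    (dsJ n).toAddMonoidHom.ker.map (J (n + 2)).subtype.toAddMonoidHom = thinKacSpan (n + 2) := by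
  ext f
  rw [mem_thinKacSpan_iff]
  constructor
  · rintro ⟨⟨f, hf⟩, h, rfl⟩
    exact (evalLast_eq_zero_iff (mem_J_iff.mp hf).1).mp h
  · rintro ⟨g, hg, rfl⟩
    exact ⟨⟨_, denom_mul_mem_J hg⟩,
      (evalLast_eq_zero_iff ((isSymm_denom _).mul hg)).mpr ⟨g, hg, rfl⟩, rfl⟩

theorem isSymm_of_mem_JP {n : ℕ} {f : Laurent n} (hf : f ∈ JP n) : IsSymm f := by
  induction hf using AddSubgroup.closure_induction with
  | mem f hf => obtain ⟨M, hM, rfl⟩ := hf; exact fun σ μ => hM.coeff_sch_perm σ μ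
  | zero => exact fun _ _ => rfl
  | add f g _ _ hf hg => exact fun σ μ => by simp [hf σ μ, hg σ μ]
  | neg f _ hf => exact fun σ μ => by simp [hf σ μ]

theorem thinKacSpan_le_JP (n : ℕ) : thinKacSpan n ≤ JP n := by
  refine (AddSubgroup.closure_le _).mpr ?_
  rintro _ ⟨wt, V, -, hV, rfl⟩
  exact sch_mem_JP _ (thinKac_of_simple hV).1

end Kernel

/-! ### The Duflo–Serganova functor on supercharacters -/

section DufloSerganova

variable {n : ℕ} (M : PRep (n + 2))

theorem rootVector_sq : M.act (rootVector n) * M.act (rootVector n) = 0 :=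
  act_inclC_sq M ⟨_, (rootVector n).2.2.2⟩

theorem cartan_homogeneous {m : ℕ} (h : Fin m → ℂ) : IsHomogeneous 0 (cartan h : SMat m) :=
  homogeneous_zero_iff.mpr ⟨rfl, rfl⟩

/-- The root vector commutes with the kernel of its root in the torus. -/
theorem rootVector_cartan {h : Fin (n + 2) → ℂ} (hh : h (Fin.natAdd n 0) + h (Fin.natAdd n 1) = 0) :
    M.act (rootVector n) * M.act (cartan h) = M.act (cartan h) * M.act (rootVector n) := by
  have hc := M.act_bracket 0 1 _ _ (cartan_homogeneous h) (rootVector_odd n)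
  have hb : bracket (cartan h) (rootVector n) = 0 := by
    have e1 := eq_neg_of_add_eq_zero_left hh
    apply Subtype.ext
    change superBracket (cartan h : SMat (n + 2)) (rootVector n) = 0
    rw [rootVector, cartan, superBracket_fromBlocks, ← Matrix.fromBlocks_zero]
    congr 1
    · simp
    · simp
    · rw [Matrix.diagonal_transpose]
      ext a b
      simp only [Matrix.zero_mul, Matrix.neg_mul, Matrix.add_apply, Matrix.sub_apply,
        Matrix.neg_apply, Matrix.zero_apply, Matrix.diagonal_mul, Matrix.mul_diagonal,
        Matrix.single_apply]
      split_ifs with h1 h2 h2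
      · exact absurd (h1.1.trans h2.1.symm) (natAdd_zero_ne_one n).symm
      · rw [← h1.1, ← h1.2, e1]; ring
      · rw [← h2.1, ← h2.2, e1]; ring
      · ring
    · simp
  rw [hb, map_zero, sign_zero_left, one_smul] at hc
  exact (sub_eq_zero.mp hc.symm).symm

/-- The root vector of weight `ε_{n+1} + ε_{n+2}`. -/
def oppVector (n : ℕ) : periplectic (n + 2) :=
  ⟨Matrix.fromBlocks 0 (Matrix.single (Fin.natAdd n 0) (Fin.natAdd n 1) 1 +
      Matrix.single (Fin.natAdd n 1) (Fin.natAdd n 0) 1) 0 0, by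
    rw [fromBlocks_mem]; simp [add_comm]⟩

/-- The coordinate vector `ε_{n+1}^* - ε_{n+2}^*` of the torus. -/
def corootLast (n : ℕ) : Fin (n + 2) → ℂ :=
  Pi.single (Fin.natAdd n 0) 1 - Pi.single (Fin.natAdd n 1) 1

theorem oppVector_odd (n : ℕ) : IsHomogeneous 1 (oppVector n : SMat (n + 2)) := by
  change evenPart _ = 0
  simp [evenPart, oppVector]

/-- The two root vectors generate a copy of `gl(1|1)`, with this central element. -/
theorem rootVector_oppVector :
    M.act (rootVector n) * M.act (oppVector n) + M.act (oppVector n) * M.act (rootVector n) =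
      M.act (cartan (corootLast n)) := by
  have h := M.act_bracket 1 1 _ _ (rootVector_odd n) (oppVector_odd n)
  have hne := natAdd_zero_ne_one n
  have hb : bracket (rootVector n) (oppVector n) = cartan (corootLast n) := by
    apply Subtype.ext
    change superBracket (rootVector n : SMat (n + 2)) (oppVector n) =
      Matrix.fromBlocks (Matrix.diagonal (corootLast n)) 0 0
        (-(Matrix.diagonal (corootLast n)).transpose)
    have hd : Matrix.diagonal (corootLast n) =
        Matrix.single (Fin.natAdd n 0) (Fin.natAdd n 0) 1 -
          Matrix.single (Fin.natAdd n 1) (Fin.natAdd n 1) 1 := by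
      rw [← Matrix.diagonal_single, ← Matrix.diagonal_single, Matrix.diagonal_sub]
      rfl
    rw [rootVector, oppVector, superBracket_fromBlocks, hd]
    congr 1 <;> simp [Matrix.mul_sub, Matrix.sub_mul, Matrix.mul_add, Matrix.add_mul, hne, hne.symm]
    exact (sub_eq_add_neg _ _).symm
  rw [hb, sign_one_one, neg_smul, one_smul, sub_neg_eq_add] at h
  exact h.symm

/-- The parametrization of the centralizer in the torus of the root vector: the last coordinate is
the one of `ε_{n+1}^* - ε_{n+2}^*`. -/
def extTorus (h : Fin (n + 1) → ℂ) : Fin (n + 2) → ℂ :=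
  Fin.append (fun i => h i.castSucc) ![h (Fin.last n), -h (Fin.last n)]

/-- The restriction of weights to the centralizer of the root vector. -/
def extWeight (μ : Fin (n + 2) → ℤ) : Fin (n + 1) → ℤ :=
  Fin.snoc (fun i => μ (Fin.castAdd 2 i)) (μ (Fin.natAdd n 0) - μ (Fin.natAdd n 1))

theorem extTorus_extWeight (h : Fin (n + 1) → ℂ) (μ : Fin (n + 2) → ℤ) :
    ∑ i, extTorus h i * (μ i : ℂ) = ∑ i, h i * (extWeight μ i : ℂ) := by
  rw [Fin.sum_univ_add, Fin.sum_univ_two, Fin.sum_univ_castSucc]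
  refine congrArg₂ (fun a b : ℂ => a + b) (Finset.sum_congr rfl fun i _ => ?_) ?_
  · rw [extTorus, Fin.append_left, extWeight, Fin.snoc_castSucc]
  · rw [extWeight, Fin.snoc_last, extTorus, Fin.append_right, Fin.append_right]
    simp
    ring

theorem extTorus_cond (h : Fin (n + 1) → ℂ) :
    extTorus h (Fin.natAdd n 0) + extTorus h (Fin.natAdd n 1) = 0 := by
  rw [extTorus, Fin.append_right, Fin.append_right]
  simp

/-- The torus of `p(n)` centralizes the root vector. -/
theorem emb_cartan (h : Fin n → ℂ) :
    emb n (cartan h) = cartan (extTorus (Fin.snoc h 0)) := by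
  have key : inclMatrix n * Matrix.diagonal h * (inclMatrix n).transpose =
      Matrix.diagonal (extTorus (Fin.snoc h 0 : Fin (n + 1) → ℂ)) := by
    ext a b
    rw [Matrix.mul_apply]
    simp only [Matrix.mul_diagonal, Matrix.transpose_apply, inclMatrix, Matrix.of_apply,
      Matrix.diagonal_apply]
    refine Fin.addCases (fun i => ?_) (fun i => ?_) a
    · rw [extTorus, Fin.append_left, Fin.snoc_castSucc, Finset.sum_eq_single i]
      · simp [eq_comm]
      · intro j _ hj
        simp [hj.symm]
      · simp
    · rw [extTorus, Fin.append_right, Fin.snoc_last]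
      have h0 : (![0, -0] : Fin 2 → ℂ) i = 0 := by fin_cases i <;> simp
      rw [h0, ite_self]
      refine Finset.sum_eq_zero fun j _ => ?_
      have : Fin.natAdd n i ≠ Fin.castAdd 2 j := fun h => by
        simp [Fin.ext_iff] at h
        omega
      simp [this]
  apply Subtype.ext
  change embMatrix (Matrix.fromBlocks _ _ _ _) = Matrix.fromBlocks _ _ _ _
  rw [embMatrix_fromBlocks, Matrix.diagonal_transpose, Matrix.diagonal_transpose, Matrix.mul_neg,
    Matrix.neg_mul, key]
  simp

variable {M} {ι : Type}

/-- A weight basis for the torus is one for the centralizer of the root vector. -/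
def WeightBasis.toCentralizer (B : WeightBasis M.parity (fun h => M.act (cartan h)) ι) :
    WeightBasis M.parity (fun h : Fin (n + 1) → ℂ => M.act (cartan (extTorus h))) ι where
  basis := B.basis
  wt i := extWeight (B.wt i)
  sg := B.sg
  mem i := mem_gr.mpr ⟨fun h => by
    rw [(mem_gr.mp (B.mem i)).1, extTorus_extWeight], (mem_gr.mp (B.mem i)).2⟩

/-- A weight basis for the torus of `p(n+2)` is one for the torus of `p(n)`. -/
def WeightBasis.restrict (B : WeightBasis M.parity (fun h => M.act (cartan h)) ι) :
    WeightBasis M.parity (fun h : Fin n → ℂ => M.act (emb n (cartan h))) ι where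
  basis := B.basis
  wt i k := B.wt i (Fin.castAdd 2 k)
  sg := B.sg
  mem i := mem_gr.mpr ⟨fun h => by
    rw [emb_cartan, (mem_gr.mp (B.mem i)).1, extTorus_extWeight, Fin.sum_univ_castSucc]
    simp [extWeight], (mem_gr.mp (B.mem i)).2⟩

/-- The weight spaces on which `ε_{n+1}^* - ε_{n+2}^*` acts by a nonzero scalar have superdimension
zero, since they are acyclic for the root vector. -/
theorem sdimOf_ext_eq_zero [Fintype ι] (B : WeightBasis M.parity (fun h => M.act (cartan h)) ι)
    {μ : Fin (n + 1) → ℤ} (hμ : μ (Fin.last n) ≠ 0) :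
    sdimOf M.parity (fun h : Fin (n + 1) → ℂ => M.act (cartan (extTorus h))) μ = 0 := by
  have : FiniteDimensional ℂ M.carrier := Module.Finite.of_basis B.basis
  refine sdimOf_eq_zero_of_acyclic B.toCentralizer (x := M.act (rootVector n))
    (fun h => rootVector_cartan M (extTorus_cond h)) (parity_rootVector M) (rootVector_sq M) μ
    fun v hv hxv => ?_
  have hc : (corootLast n : Fin (n + 2) → ℂ) = extTorus (Pi.single (Fin.last n) 1) := by
    funext k
    refine Fin.addCases (fun i => ?_) (fun i => ?_) k
    · rw [extTorus, Fin.append_left]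
      have h0 : ∀ l, Fin.castAdd 2 i ≠ Fin.natAdd n l := fun l h => by
        simp [Fin.ext_iff] at h
        omega
      simp [corootLast, h0, (Fin.castSucc_lt_last i).ne]
    · rw [extTorus, Fin.append_right, corootLast]
      have hne := natAdd_zero_ne_one n
      fin_cases i
      · simp [hne]
      · simp [hne.symm]
  have h1 := LinearMap.congr_fun (rootVector_oppVector M) v
  rw [LinearMap.add_apply, Module.End.mul_apply, Module.End.mul_apply, hxv, map_zero, add_zero, hc,
    mem_wtOf.mp hv] at h1
  have h2 : ∑ i, (Pi.single (Fin.last n) 1 : Fin (n + 1) → ℂ) i * (μ i : ℂ) = μ (Fin.last n) := by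
    simp [Pi.single_apply]
  rw [h2] at h1
  have h3 : (μ (Fin.last n) : ℂ) ≠ 0 := by exact_mod_cast hμ
  refine ⟨(μ (Fin.last n) : ℂ)⁻¹ • M.act (oppVector n) v, ?_⟩
  rw [map_smul, h1, smul_smul, inv_mul_cancel₀ h3, one_smul]

/-- `M_x` is integrable, and its weight spaces have the same superdimensions as those of `M` for the
torus of `p(n)`. -/
theorem exists_weightBasis_DS [Fintype ι]
    (B : WeightBasis M.parity (fun h => M.act (cartan h)) ι) :
    (∃ (κ : Type) (_ : Fintype κ),
      Nonempty (WeightBasis (DS M).parity (fun h => (DS M).act (cartan h)) κ)) ∧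
    ∀ μ, sdimOf M.parity (fun h : Fin n → ℂ => M.act (emb n (cartan h))) μ =
      sdimOf (DS M).parity (fun h => (DS M).act (cartan h)) μ := by
  have : FiniteDimensional ℂ M.carrier := Module.Finite.of_basis B.basis
  refine sdimOf_homology B.restrict (x := M.act (rootVector n))
    (fun h => by rw [emb_cartan]; exact rootVector_cartan M (extTorus_cond _))
    (parity_rootVector M) (rootVector_sq M) (dsRange M).mkQ (Submodule.mkQ_surjective _)
    (fun v => (Submodule.Quotient.mk_eq_zero _).trans Iff.rfl)
    fun χ v hv => mem_gr.mpr ⟨fun h => ?_, ?_⟩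
  · exact congrArg (dsRange M).mkQ (Subtype.ext ((mem_gr.mp hv).1 h))
  · exact congrArg (dsRange M).mkQ (Subtype.ext (mem_gr.mp hv).2)

theorem isIntegrable_DS (hM : M.IsIntegrable) : (DS M).IsIntegrable := by
  obtain ⟨ι, _, ⟨B⟩⟩ := hM.exists_weightBasis
  obtain ⟨⟨κ, _, ⟨B'⟩⟩, -⟩ := exists_weightBasis_DS B
  exact PRep.isIntegrable_of_weightBasis B'

theorem varT_zpow (k : ℤ) : ((varT n ^ k : (LaurentPolynomial (Laurent n))ˣ) :
    LaurentPolynomial (Laurent n)) = LaurentPolynomial.T k := by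
  have hnat : ∀ m : ℕ, ((varT n ^ m : (LaurentPolynomial (Laurent n))ˣ) :
      LaurentPolynomial (Laurent n)) = LaurentPolynomial.T m := fun m => by
    rw [Units.val_pow_eq_pow_val]
    change LaurentPolynomial.T 1 ^ m = _
    rw [LaurentPolynomial.T_pow, mul_one]
  obtain ⟨m, rfl | rfl⟩ := k.eq_nat_or_neg
  · rw [zpow_natCast, hnat]
  · rw [zpow_neg, zpow_natCast]
    refine Units.inv_eq_of_mul_eq_one_right ?_
    rw [hnat, ← LaurentPolynomial.T_add, add_neg_cancel, LaurentPolynomial.T_zero]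

theorem evalLast_single (μ : Fin (n + 2) → ℤ) (c : ℤ) :
    evalLast n (AddMonoidAlgebra.single μ c) =
      LaurentPolynomial.C (AddMonoidAlgebra.single (fun k => μ (Fin.castAdd 2 k)) c) *
        LaurentPolynomial.T (μ (Fin.natAdd n 0) - μ (Fin.natAdd n 1)) := by
  rw [evalLast, subst_single, Fin.prod_univ_add, Units.val_mul, single_eq_prod_var, map_zsmul,
    smul_mul_assoc]
  congr 2
  · simp only [Fin.append_left, varC, ← map_zpow, ← map_prod]
    rfl
  · rw [Fin.prod_univ_two, Fin.append_right, Fin.append_right]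
    change ((varT n ^ _ * (varT n)⁻¹ ^ _ : (LaurentPolynomial (Laurent n))ˣ) :
        LaurentPolynomial (Laurent n)) = _
    rw [inv_zpow', ← zpow_add, varT_zpow, sub_eq_add_neg]

/-- If the coefficients of all nonzero powers of `T` cancel, the sum is a constant. -/
theorem sum_C_mul_T {R : Type} [CommRing R] [Fintype ι] (κ : ι → ℤ) (a : ι → R)
    (h : ∀ k ≠ 0, ∑ b with κ b = k, a b = 0) :
    ∑ b, LaurentPolynomial.C (a b) * LaurentPolynomial.T (κ b) =
      LaurentPolynomial.C (∑ b, a b) := by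
  classical
  rw [map_sum, ← sub_eq_zero, ← Finset.sum_sub_distrib,
    ← Finset.sum_fiberwise_of_maps_to (g := κ) (t := Finset.univ.image κ)
      (fun i _ => Finset.mem_image_of_mem _ (Finset.mem_univ i))]
  refine Finset.sum_eq_zero fun k _ => ?_
  have : ∀ b ∈ Finset.univ.filter (fun b => κ b = k),
      LaurentPolynomial.C (a b) * LaurentPolynomial.T (κ b) - LaurentPolynomial.C (a b) =
        LaurentPolynomial.C (a b) * (LaurentPolynomial.T k - 1) := fun b hb => by
    rw [(Finset.mem_filter.mp hb).2]; ring
  rw [Finset.sum_congr rfl this, ← Finset.sum_mul, ← map_sum]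
  by_cases hk : k = 0
  · rw [hk, LaurentPolynomial.T_zero, sub_self, mul_zero]
  · rw [h k hk, map_zero, zero_mul]

/-- The evaluation of the supercharacter of `M` is the supercharacter of `M_x`. -/
theorem evalLast_sch (hM : M.IsIntegrable) :
    evalLast n M.sch = LaurentPolynomial.C (DS M).sch := by
  classical
  obtain ⟨ι, _, ⟨B⟩⟩ := hM.exists_weightBasis
  have hDS : (DS M).sch =
      ∑ b, AddMonoidAlgebra.single (fun k => B.wt b (Fin.castAdd 2 k)) (B.sg b : ℤ) := by
    refine Eq.trans ?_ B.restrict.schOf_eq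
    rw [PRep.sch_eq, schOf, schOf]
    exact finsum_congr fun μ => by rw [(exists_weightBasis_DS B).2]
  rw [hDS, PRep.sch_eq, B.schOf_eq, map_sum]
  simp_rw [evalLast_single]
  refine sum_C_mul_T _ _ fun k hk => AddMonoidAlgebra.ext (Finsupp.ext fun ν => ?_)
  have h := sdimOf_ext_eq_zero B (μ := Fin.snoc ν k) (by rwa [Fin.snoc_last])
  rw [B.toCentralizer.sdimOf_eq_sum] at h
  rw [AddMonoidAlgebra.coeff_sum, Finsupp.finsetSum_apply, Finset.sum_filter]
  refine Eq.trans (Finset.sum_congr rfl fun b _ => ?_) h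
  have : B.toCentralizer.wt b = Fin.snoc ν k ↔ (fun k => B.wt b (Fin.castAdd 2 k)) = ν ∧
      B.wt b (Fin.natAdd n 0) - B.wt b (Fin.natAdd n 1) = k := by
    have hw : B.toCentralizer.wt b = Fin.snoc (α := fun _ => ℤ) (fun k => B.wt b (Fin.castAdd 2 k))
      (B.wt b (Fin.natAdd n 0) - B.wt b (Fin.natAdd n 1)) := rfl
    rw [hw]
    exact Fin.snoc_inj
  rw [AddMonoidAlgebra.coeff_single, Finsupp.single_apply]
  simp only [this]
  by_cases h1 : B.wt b (Fin.natAdd n 0) - B.wt b (Fin.natAdd n 1) = k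
  · simp only [h1, if_true, and_true]
    rfl
  · simp only [h1, if_false, and_false]

end DufloSerganova

/-! ### The induced map on supercharacters -/

section Main

variable {n : ℕ}

/-- On supercharacters, the evaluation takes values in the supercharacters. -/
theorem exists_evalLast_eq_C {f : Laurent (n + 2)} (hf : f ∈ JP (n + 2)) :
    ∃ g ∈ JP n, evalLast n f = LaurentPolynomial.C g := by
  induction hf using AddSubgroup.closure_induction with
  | mem f hf =>
    obtain ⟨M, hM, rfl⟩ := hf
    exact ⟨_, sch_mem_JP (DS M) (isIntegrable_DS hM), evalLast_sch hM⟩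
  | zero => exact ⟨0, zero_mem _, by rw [map_zero, map_zero]⟩
  | add f f' _ _ hf hf' =>
    obtain ⟨g, hg, h⟩ := hf
    obtain ⟨g', hg', h'⟩ := hf'
    exact ⟨g + g', add_mem hg hg', by rw [map_add, map_add, h, h']⟩
  | neg f _ hf =>
    obtain ⟨g, hg, h⟩ := hf
    exact ⟨-g, neg_mem hg, by rw [map_neg, map_neg, h]⟩

theorem laurentC_injective (R : Type) [CommRing R] :
    Function.Injective (LaurentPolynomial.C : R →+* LaurentPolynomial R) := fun a b h => by
  have := congrArg (LaurentPolynomial.eval₂ (RingHom.id R) 1) h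
  rwa [LaurentPolynomial.eval₂_C, LaurentPolynomial.eval₂_C] at this

end Main

end Periplectic

end

theorem proposition3p1 (n : ℕ) :
    (∃ ds : Periplectic.JP (n + 2) →+ Periplectic.JP n,
      (∀ (M : Periplectic.PRep (n + 2)) (hM : M.IsIntegrable),
        (ds ⟨M.sch, Periplectic.sch_mem_JP M hM⟩ : Periplectic.Laurent n) =
          (Periplectic.DS M).sch) ∧
      (∀ f : Periplectic.JP (n + 2),
        Periplectic.evalLast n (f : Periplectic.Laurent (n + 2)) =
          LaurentPolynomial.C (ds f : Periplectic.Laurent n)) ∧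
      ds.ker.map (Periplectic.JP (n + 2)).subtype = Periplectic.thinKacSpan (n + 2)) ∧
    (Periplectic.dsJ n).toAddMonoidHom.ker.map (Periplectic.J (n + 2)).subtype.toAddMonoidHom =
      Periplectic.thinKacSpan (n + 2) := by
  refine ⟨?_, Periplectic.map_ker_dsJ n⟩
  have hC := Periplectic.laurentC_injective (Periplectic.Laurent n)
  choose g hg hfg using fun f : Periplectic.JP (n + 2) => Periplectic.exists_evalLast_eq_C f.2
  let ds : Periplectic.JP (n + 2) →+ Periplectic.JP n := AddMonoidHom.mk'
    (fun f => ⟨g f, hg f⟩) fun f f' => Subtype.ext <| hC <| by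
      change _ = LaurentPolynomial.C (g f + g f')
      rw [map_add, ← hfg, ← hfg, ← hfg, AddSubgroup.coe_add, map_add]
  refine ⟨ds, fun M hM => hC ?_, hfg, ?_⟩
  · exact (hfg _).symm.trans (Periplectic.evalLast_sch hM)
  · ext f
    rw [Periplectic.mem_thinKacSpan_iff]
    constructor
    · rintro ⟨f, hf, rfl⟩
      refine (Periplectic.evalLast_eq_zero_iff (Periplectic.isSymm_of_mem_JP f.2)).mp ?_
      have h0 : g f = 0 := congrArg Subtype.val (AddMonoidHom.mem_ker.mp hf)
      rw [hfg, h0, map_zero]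
    · intro h
      have hf : f ∈ Periplectic.JP (n + 2) :=
        Periplectic.thinKacSpan_le_JP _ (Periplectic.mem_thinKacSpan_iff.mpr h)
      refine ⟨⟨f, hf⟩, Subtype.ext (hC ?_), rfl⟩
      change LaurentPolynomial.C (g ⟨f, hf⟩) = LaurentPolynomial.C 0
      rw [← hfg, map_zero]
      exact (Periplectic.evalLast_eq_zero_iff (Periplectic.isSymm_of_mem_JP hf)).mpr h
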